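/- Let $n\ge 1$, $r>1$ and $p\mid r$. Let $\zeta=e^{2\pi i/r}$, let $\zeta_i=\mathrm{diag}(1,\dots,\zeta,\dots,1)$ ($\zeta$ in the $i$th place), let $s_{ij}$ be the transposition matrices, and let $W=G(r,p,n)$ be the group of $n\times n$ monomial matrices whose non-zero entries are $r$th roots of $1$ with product an $(r/p)$th root of $1$, acting on $\mathfrak h=\mathbb C^n$ with standard basis $y_1,\dots,y_n$ and dual basis $x_1,\dots,x_n$ of $\mathfrak h^*$. Let $T$ be the set of reflections in $W$, and let $c_0,c_1,\dots,c_{r-1}\in\mathbb C$ with $c_l=0$ for $1\le l\le r-1$, $p\nmid l$. Put $c_s=c_l$ for $s=\zeta_i^l\in T$ and $c_s=c_0$ for $s=\zeta_i^l s_{ij}\zeta_i^{-l}$, and $d_j=\sum_{l=1}^{r-1}\zeta^{lj}c_l$ for $j\in\mathbb Z$. The rational Cherednik algebra $\mathbb H$ of $W$ with $\kappa=1$ is the $\mathbb C$-algebra generated by $\mathfrak h^*$, $\mathfrak h$ and elements $t_w$ ($w\in W$), with the linear relations of $\mathfrak h^*$ and $\mathfrak h$ and the relations $t_1=1$, $t_wt_v=t_{wv}$,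 $t_wx=(wx)t_w$, $t_wy=(wy)t_w$, $xx'=x'x$, $yy'=y'y$ and $$yx-xy=\langle x,y\rangle-\sum_{s\in T}c_s\,\langle x-sx,y\rangle\, t_s\qquad(x,x'\in\mathfrak h^*,\ y,y'\in\mathfrak h,\ w,v\in W).$$ Let $M(\mathbf 1)$ be the polynomial representation, i.e. the $\mathbb H$-module induced from the trivial representation of the subalgebra generated by $\mathfrak h$ (acting by $0$) and the $t_w$ (acting by $1$). For $\mu\in\mathbb Z_{\ge 0}^n$ write $x^\mu=x_1^{\mu_1}\cdots x_n^{\mu_n}\in M(\mathbf 1)$. Let $\mathfrak t\subseteq\mathbb H$ be the subalgebra generated by $z_i=y_ix_i+c_0\sum_{1\le j<i}\sum_{l=0}^{r-1}t_{\zeta_i^ls_{ij}\zeta_i^{-l}}$ ($1\le i\le n$), the $t_{\zeta_i\zeta_{i+1}^{-1}}$ ($1\le i<n$) and the $t_{\zeta_i^p}$ ($1\le i\le n$). For $\mu\in\mathbb Z_{\ge0}^n$ let $\mu_+$ be its non-increasing rearrangement and $v_\mu$ the permutation of maximal length such that $v_\mu.\mu$ is non-decreasing; write $\nu<\mu$ if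 $\nu_+<\mu_+$ in dominance order, or $\nu_+=\mu_+$ and $v_\nu<v_\mu$ in Bruhat order. The Jack polynomial $f_\mu$ is the unique (if it exists) $\mathfrak t$-eigenvector in $M(\mathbf 1)$ of the form $x^\mu+\sum_{\nu<\mu}a_\nu x^\nu$. For $1\le l\le n$ and $j\in\mathbb Z_{>0}$ with $j\not\equiv0$ mod $r$ let $H_{j,l}$ be the hyperplane $d_0-d_{-j}+rc_0(n-l)=j$, and for $x\in\mathbb C$ let $H_x$ be the hyperplane $c_0=x$. **Theorem.** Let $k\in\mathbb Z_{>0}$ with $k\not\equiv 0$ mod $r$. Suppose that the parameters lie on $H_{k,1}$, that they do not lie on $H_{j,l}$ for any pair $(j,l)\ne(k,1)$ with $1\le l\le n$, $j\in\mathbb Z_{>0}$, $j\not\equiv0$ mod $r$, and that they do not lie on $H_x$ for any $x\in\bigcup_{q=1}^n\frac1q\mathbb Z_{>0}$. Then the Jack polynomial $f_\mu$ exists for every $\mu\in\mathbb Z_{\ge0}^n$, and $M(\mathbf 1)$ has exactly one submodule different from $0$ and $M(\mathbf 1)$, namely $$\mathbb C\text{-span}\{f_\lambda \mid \lambda\in\mathbb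 Z_{\ge0}^n \text{ has at least one part of size at least } k\}.$$ -/

import Mathlib

noncomputable section

namespace Cherednik

/-! ### Rational Cherednik algebras -/

section General

variable {k h : Type} [Field k] [AddCommGroup h] [Module k h]

/-- A reflection of `h`: an invertible linear map whose fixed space has codimension one. -/
def IsReflection (s : h ≃ₗ[k] h) : Prop :=
  Module.finrank k (h ⧸ LinearMap.ker ((s : h →ₗ[k] h) - LinearMap.id)) = 1

/-- The contragredient action on the dual space: `(w x)(v) = x (w⁻¹ v)`. -/
def dualAct (w : h ≃ₗ[k] h) (x : Module.Dual k h) : Module.Dual k h :=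
  x ∘ₗ ((w⁻¹ : h ≃ₗ[k] h) : h →ₗ[k] h)

/-- Generators of the rational Cherednik algebra of `W`: linear forms `x ∈ h*`, vectors `v ∈ h`
and group elements. -/
inductive Gen (W : Subgroup (h ≃ₗ[k] h)) : Type
  | x (x : Module.Dual k h) : Gen W
  | y (v : h) : Gen W
  | t (w : W) : Gen W

variable (W : Subgroup (h ≃ₗ[k] h))

/-- The free generator attached to a linear form. -/
def fx (x : Module.Dual k h) : FreeAlgebra k (Gen W) := FreeAlgebra.ι k (Gen.x x)

/-- The free generator attached to a vector. -/
def fy (v : h) : FreeAlgebra k (Gen W) := FreeAlgebra.ι k (Gen.y v)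

/-- The free generator attached to a group element. -/
def ft (w : W) : FreeAlgebra k (Gen W) := FreeAlgebra.ι k (Gen.t w)

/-- The relations of the rational Cherednik algebra.  If `s x = x - ⟨x, αˢ⟩ α_s` for a reflection
`s`, then `⟨α_s, v⟩ ⟨x, αˢ⟩ = ⟨x - s x, v⟩ = x v - (s x) v`, which is the coefficient of `c_s t_s`
in `cross`; in this form no choice of `α_s` and of its coroot is needed. -/
inductive Rel (κ : k) (c : W → k) : FreeAlgebra k (Gen W) → FreeAlgebra k (Gen W) → Prop
  | x_add (x x' : Module.Dual k h) : Rel κ c (fx W (x + x')) (fx W x + fx W x')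
  | x_smul (a : k) (x : Module.Dual k h) : Rel κ c (fx W (a • x)) (a • fx W x)
  | y_add (v v' : h) : Rel κ c (fy W (v + v')) (fy W v + fy W v')
  | y_smul (a : k) (v : h) : Rel κ c (fy W (a • v)) (a • fy W v)
  | t_one : Rel κ c (ft W 1) 1
  | t_mul (w w' : W) : Rel κ c (ft W (w * w')) (ft W w * ft W w')
  | t_x (w : W) (x : Module.Dual k h) :
      Rel κ c (ft W w * fx W x) (fx W (dualAct (w : h ≃ₗ[k] h) x) * ft W w)
  | t_y (w : W) (v : h) :
      Rel κ c (ft W w * fy W v) (fy W ((w : h ≃ₗ[k] h) v) * ft W w)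
  | x_comm (x x' : Module.Dual k h) : Rel κ c (fx W x * fx W x') (fx W x' * fx W x)
  | y_comm (v v' : h) : Rel κ c (fy W v * fy W v') (fy W v' * fy W v)
  | cross (v : h) (x : Module.Dual k h) :
      Rel κ c (fy W v * fx W x - fx W x * fy W v)
        ((κ * x v) • (1 : FreeAlgebra k (Gen W)) -
          ∑ᶠ (s : W) (_ : IsReflection (s : h ≃ₗ[k] h)),
            (c s * (x v - dualAct (s : h ≃ₗ[k] h) x v)) • ft W s)

variable (κ : k) (c : W → k)

/-- The rational Cherednik algebra of `W` with parameters `κ` and `c`. -/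
def RCA : Type := RingQuot (Rel W κ c)

instance : Ring (RCA W κ c) := inferInstanceAs (Ring (RingQuot (Rel W κ c)))

instance : Algebra k (RCA W κ c) := inferInstanceAs (Algebra k (RingQuot (Rel W κ c)))

/-- The canonical projection from the free algebra. -/
def RCA.mk : FreeAlgebra k (Gen W) →ₐ[k] RCA W κ c := RingQuot.mkAlgHom k (Rel W κ c)

/-- The element of the algebra given by a linear form. -/
def X (x : Module.Dual k h) : RCA W κ c := RCA.mk W κ c (fx W x)

/-- The element of the algebra given by a vector. -/
def Y (v : h) : RCA W κ c := RCA.mk W κ c (fy W v)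

/-- The element of the algebra given by a group element. -/
def T (w : W) : RCA W κ c := RCA.mk W κ c (ft W w)

/-- The left ideal generated by all `y` and all `t_w - 1`. -/
def stdIdeal : Submodule (RCA W κ c) (RCA W κ c) :=
  Submodule.span (RCA W κ c)
    (Set.range (Y W κ c) ∪ Set.range (fun w : W => T W κ c w - 1))

/-- The standard module `M(𝟏)`: the module induced from the trivial representation of the
subalgebra generated by the vectors `y` (acting by zero) and the group elements (acting by one). -/
abbrev M1 : Type := RCA W κ c ⧸ stdIdeal W κ c

end General

/-! ### The groups `G(r,p,n)` -/

/-- The space `ℂⁿ`. -/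
abbrev V (n : ℕ) : Type := Fin n → ℂ

/-- The standard basis vector `y_i` of `ℂⁿ`. -/
def yv {n : ℕ} (i : Fin n) : V n := Pi.single i 1

/-- The dual basis vector `x_i`. -/
def xv {n : ℕ} (i : Fin n) : Module.Dual ℂ (V n) := LinearMap.proj i

/-- `G(r,p,n)`: the `n × n` monomial matrices whose non-zero entries are `r`-th roots of unity
with product an `(r/p)`-th root of unity.  Here `a i` is the non-zero entry in row `i`, which
stands in column `σ⁻¹ i`. -/
def G (r p n : ℕ) : Subgroup (V n ≃ₗ[ℂ] V n) where
  carrier := {g | ∃ (σ : Equiv.Perm (Fin n)) (a : Fin n → ℂ), (∀ i, a i ^ r = 1) ∧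
    (∏ i, a i) ^ (r / p) = 1 ∧ ∀ v i, g v i = a i * v (σ⁻¹ i)}
  one_mem' := ⟨1, fun _ => 1, by simp, by simp, by simp⟩
  mul_mem' := by
    rintro g g' ⟨σ, a, h1, h2, h3⟩ ⟨σ', a', h1', h2', h3'⟩
    refine ⟨σ * σ', fun i => a i * a' (σ⁻¹ i), fun i => by simp [mul_pow, h1, h1'], ?_, ?_⟩
    · rw [Finset.prod_mul_distrib, Equiv.prod_comp σ⁻¹ a', mul_pow, h2, h2', one_mul]
    · intro v i
      simp [h3, h3', mul_assoc]
  inv_mem' := by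
    rintro g ⟨σ, a, h1, h2, h3⟩
    refine ⟨σ⁻¹, fun i => (a (σ i))⁻¹, fun i => by simp [h1], ?_, ?_⟩
    · rw [Equiv.prod_comp σ (fun i => (a i)⁻¹), Finset.prod_inv_distrib, inv_pow, h2, inv_one]
    · intro v i
      have h := h3 (g⁻¹ v) (σ i)
      have e : g (g⁻¹ v) = v := g.apply_symm_apply v
      have hinv : (σ⁻¹ : Equiv.Perm (Fin n)) (σ i) = i := σ.symm_apply_apply i
      rw [e, hinv] at h
      by_cases ha : a (σ i) = 0
      · have h0 := g.surjective (Pi.single (σ i) 1)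
        obtain ⟨u, hu⟩ := h0
        have := h3 u (σ i)
        rw [hu, ha] at this
        simp at this
      · rw [inv_inv, h, inv_mul_cancel_left₀ ha]

/-- `ζ = exp(2πi/r)`, as a unit. -/
def zeta (r : ℕ) : ℂˣ :=
  Units.mk0 (Complex.exp (2 * Real.pi * Complex.I / r)) (Complex.exp_ne_zero _)

lemma zeta_pow (r : ℕ) : zeta r ^ r = 1 := by
  rcases Nat.eq_zero_or_pos r with rfl | h
  · simp
  · ext
    exact (Complex.isPrimitiveRoot_exp r h.ne').pow_eq_one

/-- The invertible diagonal matrix with entries `a i`. -/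
def dg {n : ℕ} (a : Fin n → ℂˣ) : V n ≃ₗ[ℂ] V n :=
  LinearEquiv.piCongrRight fun i => LinearEquiv.smulOfUnit (a i)

/-- The diagonal matrix `ζ_i`, with `i`-th entry `ζ` and all other diagonal entries `1`. -/
def zt (r : ℕ) {n : ℕ} (i : Fin n) : V n ≃ₗ[ℂ] V n := dg (Pi.mulSingle i (zeta r))

/-- The transposition matrix `s_{ij}`. -/
def sw {n : ℕ} (i j : Fin n) : V n ≃ₗ[ℂ] V n := LinearEquiv.funCongrLeft ℂ ℂ (Equiv.swap i j)

lemma dg_apply {n : ℕ} (a : Fin n → ℂˣ) (v : V n) (i : Fin n) : dg a v i = (a i : ℂ) * v i := rfl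

lemma sw_apply {n : ℕ} (i j : Fin n) (v : V n) (m : Fin n) :
    sw i j v m = v (Equiv.swap i j m) := rfl

lemma dg_mul {n : ℕ} (a b : Fin n → ℂˣ) : dg a * dg b = dg (a * b) := by
  ext v i
  simp [dg_apply, mul_assoc]

lemma dg_one {n : ℕ} : dg (1 : Fin n → ℂˣ) = 1 := by
  ext v i
  simp [dg_apply]

lemma dg_inv {n : ℕ} (a : Fin n → ℂˣ) : (dg a)⁻¹ = dg a⁻¹ := by
  rw [inv_eq_iff_mul_eq_one, dg_mul, mul_inv_cancel, dg_one]

lemma dg_pow {n : ℕ} (a : Fin n → ℂˣ) (l : ℕ) : dg a ^ l = dg (a ^ l) := by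
  induction l with
  | zero => simp [dg_one]
  | succ l ih => rw [pow_succ, ih, dg_mul, pow_succ]

lemma dg_mem {r p n : ℕ} (a : Fin n → ℂˣ) (h1 : ∀ i, a i ^ r = 1) (h2 : (∏ i, a i) ^ (r / p) = 1) :
    dg a ∈ G r p n := by
  refine ⟨1, fun i => (a i : ℂ), fun i => ?_, ?_, fun v i => by simp [dg_apply]⟩
  · simpa using congrArg Units.val (h1 i)
  · simpa using congrArg Units.val h2

lemma single_pow {n r : ℕ} (i m : Fin n) :
    (Pi.mulSingle i (zeta r) : Fin n → ℂˣ) m ^ r = 1 := by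
  rcases eq_or_ne m i with rfl | h
  · simp [zeta_pow]
  · simp [Pi.mulSingle_eq_of_ne h]

lemma sw_mem (r p : ℕ) {n : ℕ} (i j : Fin n) : sw i j ∈ G r p n :=
  ⟨Equiv.swap i j, fun _ => 1, by simp, by simp, fun v m => by simp [sw_apply, Equiv.swap_inv]⟩

lemma conj_mem (r p : ℕ) {n : ℕ} (i j : Fin n) (l : ℕ) :
    zt r i ^ l * sw i j * (zt r i ^ l)⁻¹ ∈ G r p n := by
  have key : zt r i ^ l * sw i j * (zt r i ^ l)⁻¹ =
      dg ((Pi.mulSingle i (zeta r) : Fin n → ℂˣ) ^ l *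
        (((Pi.mulSingle j (zeta r) : Fin n → ℂˣ) ^ l)⁻¹)) * sw i j := by
    rw [zt, dg_pow, dg_inv]
    ext v m
    have : ((Pi.mulSingle i (zeta r) : Fin n → ℂˣ) (Equiv.swap i j m)) =
        (Pi.mulSingle j (zeta r) : Fin n → ℂˣ) m := by
      simp only [Pi.mulSingle_apply, Equiv.swap_apply_eq_iff, Equiv.swap_apply_left]
    simp [dg_apply, sw_apply, this, mul_assoc]
  rw [key]
  refine mul_mem (dg_mem _ (fun m => ?_) ?_) (sw_mem r p i j)
  · simp only [Pi.mul_apply, Pi.pow_apply, Pi.inv_apply, mul_pow, inv_pow]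
    rw [pow_right_comm, single_pow, pow_right_comm, single_pow]
    simp
  · simp [Finset.prod_mul_distrib, Finset.prod_inv_distrib, Finset.prod_pow,
      Finset.prod_pi_mulSingle']

lemma quot_mem (r p : ℕ) {n : ℕ} (i j : Fin n) : zt r i * (zt r j)⁻¹ ∈ G r p n := by
  rw [zt, zt, dg_inv, dg_mul]
  refine dg_mem _ (fun m => ?_) ?_
  · simp only [Pi.mul_apply, Pi.inv_apply, mul_pow, inv_pow, single_pow]
    simp
  · simp [Finset.prod_mul_distrib, Finset.prod_inv_distrib, Finset.prod_pi_mulSingle']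

lemma ztp_mem {r p : ℕ} (hp : p ∣ r) {n : ℕ} (i : Fin n) : zt r i ^ p ∈ G r p n := by
  rw [zt, dg_pow]
  refine dg_mem _ (fun m => ?_) ?_
  · rw [Pi.pow_apply, pow_right_comm, single_pow, one_pow]
  · simp only [Pi.pow_apply, Finset.prod_pow, Finset.prod_pi_mulSingle', Finset.mem_univ, if_true]
    rw [← pow_mul, Nat.mul_div_cancel' hp, zeta_pow]

/-- `G(r,p,n)` is finite, so that the sum over its reflections is a genuine finite sum. -/
lemma finite_G {r : ℕ} (hr : 0 < r) (p n : ℕ) : Finite (G r p n) := by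
  have hroots : {z : ℂ | z ^ r = 1}.Finite := by
    refine (Polynomial.nthRoots r (1 : ℂ)).toFinset.finite_toSet.subset fun z hz => ?_
    simpa [Polynomial.mem_nthRoots hr] using hz
  have hA : (Set.univ.pi fun _ : Fin n => {z : ℂ | z ^ r = 1}).Finite :=
    Set.Finite.pi' (fun _ => hroots) |>.subset fun a ha i => ha i trivial
  have := hA.to_subtype
  choose σ a h1 _ h3 using fun g : G r p n => g.2
  refine Finite.of_injective (β := Equiv.Perm (Fin n) ×
    (Set.univ.pi fun _ : Fin n => {z : ℂ | z ^ r = 1}))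
    (fun g => (σ g, ⟨a g, fun i _ => h1 g i⟩)) fun g g' e => ?_
  have e1 : σ g = σ g' := congrArg Prod.fst e
  have e2 : a g = a g' := congrArg (fun q => (q.2 : Fin n → ℂ)) e
  refine Subtype.ext (LinearEquiv.ext fun v => funext fun i => ?_)
  rw [h3, h3, e1, e2]

/-! ### Parameters and hyperplanes -/

open scoped Classical in
/-- The parameter function on the reflections of `G(r,p,n)`: `c_s = c l` for `s = ζ_i^l`
(`1 ≤ l ≤ r - 1`), and `c_s = c0` for the remaining reflections `s = ζ_i^l s_{ij} ζ_i^{-l}`.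
(The values at elements that are not reflections play no role.) -/
def param (r p n : ℕ) (c0 : ℂ) (c : ℕ → ℂ) (s : G r p n) : ℂ :=
  if ∃ l ∈ Finset.Ico 1 r, ∃ i : Fin n, (s : V n ≃ₗ[ℂ] V n) = zt r i ^ l then
    ∑ l ∈ Finset.Ico 1 r, if ∃ i : Fin n, (s : V n ≃ₗ[ℂ] V n) = zt r i ^ l then c l else 0
  else c0

/-- `d_j = ∑_{l=1}^{r-1} ζ^{lj} c_l` for `j ∈ ℤ`. -/
def dpar (r : ℕ) (c : ℕ → ℂ) (j : ℤ) : ℂ :=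
  ∑ l ∈ Finset.Ico 1 r, ((zeta r : ℂˣ) : ℂ) ^ ((l : ℤ) * j) * c l

/-- The parameters lie on the hyperplane `H_{j,l} : d_0 - d_{-j} + r c_0 (n - l) = j`. -/
def OnH (r n : ℕ) (c0 : ℂ) (c : ℕ → ℂ) (j l : ℕ) : Prop :=
  dpar r c 0 - dpar r c (-(j : ℤ)) + (r : ℂ) * c0 * ((n : ℂ) - (l : ℂ)) = (j : ℂ)

/-! ### The order on exponents -/

/-- The length (number of inversions) of a permutation. -/
def len {n : ℕ} (w : Equiv.Perm (Fin n)) : ℕ :=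
  (Finset.univ.filter fun q : Fin n × Fin n => q.1 < q.2 ∧ w q.2 < w q.1).card

/-- The strict Bruhat order: the transitive closure of `u < u * t` for `t` a transposition with
`len u < len (u * t)`. -/
def BruhatLT {n : ℕ} : Equiv.Perm (Fin n) → Equiv.Perm (Fin n) → Prop :=
  Relation.TransGen fun u v =>
    (∃ i j : Fin n, i ≠ j ∧ v = u * Equiv.swap i j) ∧ len u < len v

/-- `v` is the permutation `v_μ`: it has maximal length among the permutations `w` for which
`w.μ = μ ∘ w⁻¹` is non-decreasing. -/
def IsMaxSort {n : ℕ} (μ : Fin n → ℕ) (v : Equiv.Perm (Fin n)) : Prop :=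
  Monotone (μ ∘ (v⁻¹ : Equiv.Perm (Fin n))) ∧
    ∀ w : Equiv.Perm (Fin n), Monotone (μ ∘ (w⁻¹ : Equiv.Perm (Fin n))) → len w ≤ len v

/-- The non-increasing rearrangement `μ_+` of `μ`. -/
def plus {n : ℕ} (μ : Fin n → ℕ) : Fin n → ℕ := fun i => μ (Tuple.sort μ (Fin.rev i))

/-- Dominance: `μ - ν` is a non-negative integer combination of the `ε_i - ε_{i+1}`, that is, the
partial sums of `ν` are at most those of `μ` and the total sums agree. -/
def DomLE {n : ℕ} (ν μ : Fin n → ℕ) : Prop :=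
  (∀ m : Fin n, ∑ i ∈ Finset.Iic m, ν i ≤ ∑ i ∈ Finset.Iic m, μ i) ∧ ∑ i, ν i = ∑ i, μ i

/-- The strict partial order on exponents used for leading terms. -/
def ExpLT {n : ℕ} (ν μ : Fin n → ℕ) : Prop :=
  (DomLE (plus ν) (plus μ) ∧ plus ν ≠ plus μ) ∨
    (plus ν = plus μ ∧ ∃ u v, IsMaxSort ν u ∧ IsMaxSort μ v ∧ BruhatLT u v)

/-! ### The algebra of `G(r,p,n)` at `κ = 1` and its Jack polynomials -/

section Jack

variable (r p n : ℕ) (c0 : ℂ) (c : ℕ → ℂ)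

/-- The rational Cherednik algebra of `G(r,p,n)` with `κ = 1`. -/
abbrev HH : Type := RCA (G r p n) (1 : ℂ) (param r p n c0 c)

/-- The polynomial representation `M(𝟏)` of `G(r,p,n)` with `κ = 1`. -/
abbrev MM : Type := M1 (G r p n) (1 : ℂ) (param r p n c0 c)

/-- The element `x_i` of the algebra. -/
def xi (i : Fin n) : HH r p n c0 c := X _ _ _ (xv i)

/-- The element `y_i` of the algebra. -/
def yi (i : Fin n) : HH r p n c0 c := Y _ _ _ (yv i)

/-- `φ_i`, the sum over `j < i` and `0 ≤ l ≤ r - 1` of `t` at `ζ_i^l s_{ij} ζ_i^{-l}`. -/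
def phi (i : Fin n) : HH r p n c0 c :=
  ∑ j ∈ Finset.Iio i, ∑ l ∈ Finset.range r,
    T _ _ _ (⟨zt r i ^ l * sw i j * (zt r i ^ l)⁻¹, conj_mem r p i j l⟩ : G r p n)

/-- `z_i = y_i x_i + c_0 φ_i`. -/
def zi (i : Fin n) : HH r p n c0 c :=
  yi r p n c0 c i * xi r p n c0 c i + c0 • phi r p n c0 c i

/-- The subalgebra `𝔱` generated by the `z_i`, the `t` at `ζ_i ζ_{i+1}⁻¹` and the `t` at `ζ_i^p`. -/
def tAlg (hp : p ∣ r) : Subalgebra ℂ (HH r p n c0 c) :=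
  Algebra.adjoin ℂ
    (Set.range (zi r p n c0 c) ∪
      {a | ∃ i j : Fin n, (i : ℕ) + 1 = j ∧
        a = T _ _ _ (⟨zt r i * (zt r j)⁻¹, quot_mem r p i j⟩ : G r p n)} ∪
      Set.range fun i : Fin n => T _ _ _ (⟨zt r i ^ p, ztp_mem hp i⟩ : G r p n))

/-- The monomial `x^μ` as an element of `M(𝟏)`: the class of `x_1^{μ_1} ⋯ x_n^{μ_n}`. -/
def mon (μ : Fin n → ℕ) : MM r p n c0 c :=
  Submodule.Quotient.mk (List.ofFn fun i => xi r p n c0 c i ^ μ i).prod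

/-- `f` is the (nonsymmetric) Jack polynomial `f_μ`: a `𝔱`-eigenvector of the form
`x^μ + lower terms`. -/
def IsJack (hp : p ∣ r) (μ : Fin n → ℕ) (f : MM r p n c0 c) : Prop :=
  f ≠ 0 ∧ (∀ a ∈ tAlg r p n c0 c hp, ∃ e : ℂ, a • f = e • f) ∧
    f - mon r p n c0 c μ ∈ Submodule.span ℂ (mon r p n c0 c '' {ν | ExpLT ν μ})

end Jack

end Cherednik

end

noncomputable section
namespace Cherednik

/-! ### Reflections as rank-one perturbations of the identity -/

section General

variable {k h : Type} [Field k] [AddCommGroup h] [Module k h]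

/-! The standard module is the polynomial ring with the `y_i` acting by Dunkl operators (`equivMM`),
so everything can be done with polynomials. In the monomial basis the operators `z_i` are triangular
for `ExpLT`. Their diagonal entry `wtz` at `x^μ` depends on `μ i` and on the rank of `i` when `μ` is
sorted with ties broken from right to left (`zOp_mono_sub_mem`). Genericity makes the joint
eigenvalues of the generators of `𝔱` separate exponents, even on the hyperplane `H_{k,1}`
(`Generic.sorted_eq`, `Generic.gwt_unique`). Hence joint eigenspaces are at most lines, an
eigenvector with the weight of `μ` has leading term `x^μ` up to scaling, and every submodule is
spanned by the eigenvectors it contains (`eq_span_of_stable`).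

Eigenvectors are produced from the constant `1` by two kinds of intertwiners. For adjacent `i`, `j`
with `μ i ≠ μ j`, a combination `s_{ij} + e` carries the weight of `μ` to that of the swapped
exponent; it is injective on the eigenvector because `e ^ 2 ≠ 1` away from the hyperplanes `H_x`
(`Special.exists_swap`). The operator `raise`, a cyclic permutation followed by multiplication by
the last coordinate, moves the first part of `μ` to the end and adds one to it (`IsEigen.raise`).
These moves reach every exponent.

For the submodules one asks which moves can be undone inside the algebra. Swaps can. The operator
`lowerOp` satisfies `lowerOp ∘ raise = z_1`, so it undoes `raise` up to the eigenvalue of `z_1`. By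
genericity this eigenvalue vanishes only when the first part of `μ` is maximal and equal to `k - 1`
(`Special.wtz_zero_eq_zero_iff`). The only one-way step is therefore the one that takes the largest
part from `k - 1` to `k`. A set of exponents closed under the remaining moves is empty, everything,
or the exponents with a part at least `k` (`exponent_dichotomy`), and the last set does span a
submodule (`IsJackFamily.rho_mem_span`). -/

/-- Since `s - id` factors through the one-dimensional quotient by its kernel, `α` is the coordinate
on that quotient relative to the class of `v0`, and `u` is `s v0 - v0`. -/
lemma IsReflection.exists_rank_one {s : h ≃ₗ[k] h} (hs : IsReflection s) :
    ∃ (α : Module.Dual k h) (u : h), ∀ v, s v - v = α v • u := by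
  obtain ⟨w, hw, hspan⟩ := finrank_eq_one_iff'.1 hs
  obtain ⟨v0, rfl⟩ := Submodule.mkQ_surjective _ w
  choose a ha using hspan
  have key : ∀ v, s v - v = a (Submodule.Quotient.mk v) • (s v0 - v0) := by
    intro v
    have h1 := ha (Submodule.Quotient.mk v)
    rw [Submodule.mkQ_apply, ← Submodule.Quotient.mk_smul, Submodule.Quotient.eq] at h1
    have h2 : s (a (Submodule.Quotient.mk v) • v0 - v) =
        a (Submodule.Quotient.mk v) • v0 - v := by
      have := LinearMap.mem_ker.1 h1
      simpa [sub_eq_zero] using this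
    rw [map_sub, map_smul] at h2
    rw [smul_sub]
    have h3 : s v = s (a (Submodule.Quotient.mk v) • v0) - (a (Submodule.Quotient.mk v) • v0 - v) := by
      rw [map_smul, ← h2]; abel
    rw [h3, map_smul]; abel
  have hinj : ∀ b b' : k, b • (Submodule.mkQ _ v0) = b' • (Submodule.mkQ _ v0) → b = b' :=
    fun b b' e => smul_left_injective k hw e
  refine ⟨{ toFun := fun v => a (Submodule.Quotient.mk v), map_add' := fun v v' => hinj _ _ ?_,
            map_smul' := fun b v => hinj _ _ ?_ }, s v0 - v0, key⟩
  · rw [add_smul, ha, ha, ha]; simp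
  · simp only [RingHom.id_apply, smul_eq_mul]
    rw [mul_smul, ha, ha]; simp

lemma isReflection_of_rank_one {s : h ≃ₗ[k] h} {α : Module.Dual k h} {u : h}
    (hs : ∀ v, s v - v = α v • u) (v0 : h) (h0 : s v0 ≠ v0) : IsReflection s := by
  unfold IsReflection
  rw [LinearEquiv.finrank_eq (LinearMap.quotKerEquivRange ((s : h →ₗ[k] h) - LinearMap.id))]
  have hu : u ≠ 0 := by
    rintro rfl
    exact h0 (by simpa [sub_eq_zero] using hs v0)
  have hα : α v0 ≠ 0 := fun e => h0 (by simpa [sub_eq_zero, e] using hs v0)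
  have : LinearMap.range ((s : h →ₗ[k] h) - LinearMap.id) = Submodule.span k {u} := by
    ext w
    rw [Submodule.mem_span_singleton]
    constructor
    · rintro ⟨v, rfl⟩
      exact ⟨α v, by simp [hs]⟩
    · rintro ⟨a, rfl⟩
      exact ⟨(a * (α v0)⁻¹) • v0, by simp [hs, smul_smul, hα]⟩
  rw [this, finrank_span_singleton hu]

lemma IsReflection.conj {s : h ≃ₗ[k] h} (hs : IsReflection s) (w : h ≃ₗ[k] h) :
    IsReflection (w * s * w⁻¹) := by
  obtain ⟨α, u, hα⟩ := hs.exists_rank_one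
  -- The identity is not a reflection: its quotient has dimension zero.
  have hne : ∃ v0, s v0 ≠ v0 := by
    by_contra! hcon
    unfold IsReflection at hs
    rw [LinearEquiv.finrank_eq (LinearMap.quotKerEquivRange ((s : h →ₗ[k] h) - LinearMap.id))] at hs
    have : ((s : h →ₗ[k] h) - LinearMap.id) = 0 := by ext v; simp [hcon]
    rw [this, LinearMap.range_zero, finrank_bot] at hs
    exact zero_ne_one hs
  obtain ⟨v0, h0⟩ := hne
  refine isReflection_of_rank_one (α := dualAct w α) (u := w u) (fun v => ?_) (w v0) ?_
  · have := congrArg w (hα (w⁻¹ v))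
    have e : w (w⁻¹ v) = v := w.apply_symm_apply v
    simpa [dualAct, e] using this
  · have e : w⁻¹ (w v0) = v0 := w.symm_apply_apply v0
    simpa [e] using h0

end General

/-! ### The reflections of `G(r,p,n)` -/

/-- The reflection `ζ_i^l s_{ij} ζ_i^{-l}`. -/
def rf (r : ℕ) {n : ℕ} (i j : Fin n) (l : ℕ) : V n ≃ₗ[ℂ] V n :=
  zt r i ^ l * sw i j * (zt r i ^ l)⁻¹

lemma zt_pow_apply (r : ℕ) {n : ℕ} (i : Fin n) (l : ℕ) (v : V n) (m : Fin n) :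
    (zt r i ^ l) v m = if m = i then (zeta r : ℂ) ^ l * v m else v m := by
  rw [zt, dg_pow, dg_apply]
  split_ifs with h
  · subst h; simp
  · simp [Pi.mulSingle_eq_of_ne h]

lemma zt_pow_inv_apply (r : ℕ) {n : ℕ} (i : Fin n) (l : ℕ) (v : V n) (m : Fin n) :
    (zt r i ^ l)⁻¹ v m = if m = i then ((zeta r : ℂ) ^ l)⁻¹ * v m else v m := by
  rw [zt, dg_pow, dg_inv, dg_apply]
  split_ifs with h
  · subst h; simp
  · simp [Pi.mulSingle_eq_of_ne h]

lemma rf_apply (r : ℕ) {n : ℕ} {i j : Fin n} (hij : j ≠ i) (l : ℕ) (v : V n) (m : Fin n) :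
    rf r i j l v m = if m = i then (zeta r : ℂ) ^ l * v j else
      if m = j then ((zeta r : ℂ) ^ l)⁻¹ * v i else v m := by
  rw [rf, LinearEquiv.mul_apply, LinearEquiv.mul_apply, zt_pow_apply, sw_apply, zt_pow_inv_apply]
  rcases eq_or_ne m i with rfl | hmi
  · simp [hij]
  · rcases eq_or_ne m j with rfl | hmj
    · simp [hmi]
    · simp [hmi, hmj, Equiv.swap_apply_of_ne_of_ne hmi hmj]

lemma rf_mul_self (r : ℕ) {n : ℕ} (i j : Fin n) (l : ℕ) : rf r i j l * rf r i j l = 1 := by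
  have : sw i j * sw i j = 1 := by
    ext v m
    simp [sw_apply]
  rw [rf]
  calc _ = zt r i ^ l * (sw i j * sw i j) * (zt r i ^ l)⁻¹ := by group
    _ = 1 := by rw [this]; group

lemma rf_inv (r : ℕ) {n : ℕ} (i j : Fin n) (l : ℕ) : (rf r i j l)⁻¹ = rf r i j l :=
  inv_eq_of_mul_eq_one_left (rf_mul_self r i j l)

lemma isPrimitiveRoot_zeta {r : ℕ} (hr : r ≠ 0) : IsPrimitiveRoot (zeta r : ℂ) r :=
  Complex.isPrimitiveRoot_exp r hr

lemma zeta_ne_zero (r : ℕ) : (zeta r : ℂ) ≠ 0 := (zeta r).ne_zero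

lemma isReflection_zt {r n : ℕ} (hr : 1 < r) (i : Fin n) {l : ℕ} (h1 : 1 ≤ l) (h2 : l < r) :
    IsReflection (zt r i ^ l) := by
  refine isReflection_of_rank_one (α := ((zeta r : ℂ) ^ l - 1) • xv i) (u := yv i)
    (fun v => ?_) (yv i) fun e => ?_
  · ext m
    simp only [Pi.sub_apply, zt_pow_apply, yv, xv, Pi.smul_apply, LinearMap.smul_apply,
      LinearMap.proj_apply, Pi.single_apply]
    split_ifs with h
    · subst h; simp; ring
    · simp
  · have := congrFun e i
    rw [zt_pow_apply] at this
    simp [yv] at this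
    exact (isPrimitiveRoot_zeta (by omega)).pow_ne_one_of_pos_of_lt (by omega) h2 this

lemma isReflection_rf (r : ℕ) {n : ℕ} {i j : Fin n} (hij : j ≠ i) (l : ℕ) :
    IsReflection (rf r i j l) := by
  refine isReflection_of_rank_one (α := xv i - (zeta r : ℂ) ^ l • xv j)
    (u := ((zeta r : ℂ) ^ l)⁻¹ • yv j - yv i) (fun v => ?_) (yv i) fun e => ?_
  · have := zeta_ne_zero r
    ext m
    simp only [Pi.sub_apply, rf_apply r hij, yv, xv, Pi.smul_apply, LinearMap.smul_apply,
      LinearMap.proj_apply, Pi.single_apply, LinearMap.sub_apply]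
    rcases eq_or_ne m i with rfl | hmi
    · simp [hij.symm]
    · rcases eq_or_ne m j with rfl | hmj
      · simp [hmi]; field_simp
      · simp [hmi, hmj]
  · have := congrFun e i
    rw [rf_apply r hij] at this
    simp [yv, hij] at this

/-- Because `g` moves `y_i`, the vector `u` in `g - 1 = α ⊗ u` is proportional to `g y_i - y_i`, so
it is supported on `i` and `σ i`, and `g` preserves every other coordinate. Either `σ` fixes `i` and
`g` is diagonal, or `σ` exchanges `i` and `σ i` and the rank condition determines the two entries
from each other. -/
lemma reflection_cases {r p n : ℕ} (hr : 1 < r) (hp : p ∣ r) {g : V n ≃ₗ[ℂ] V n}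
    (hg : g ∈ G r p n) (hs : IsReflection g) {i : Fin n} (hi : g (yv i) ≠ yv i) :
    (∃ l ∈ Finset.Ico 1 r, p ∣ l ∧ g = zt r i ^ l) ∨
      ∃ j, j ≠ i ∧ ∃ l < r, g = rf r i j l := by
  obtain ⟨σ, a, h1, h2, h3⟩ := hg
  obtain ⟨α, u, hα⟩ := hs.exists_rank_one
  have hα' : ∀ v m, a m * v (σ⁻¹ m) - v m = α v * u m := fun v m => by
    rw [← h3]; simpa using congrFun (hα v) m
  have hσ : ∀ m m', σ⁻¹ m = m' ↔ m = σ m' := fun m m' => Equiv.symm_apply_eq σ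
  have hαi : α (yv i) ≠ 0 := fun e => hi (by simpa [sub_eq_zero, e] using hα (yv i))
  have : NeZero r := ⟨by omega⟩
  have hroot : ∀ m, ∃ l < r, (zeta r : ℂ) ^ l = a m := fun m =>
    (isPrimitiveRoot_zeta (by omega)).eq_pow_of_pow_eq_one (h1 m)
  rcases eq_or_ne (σ i) i with hii | hii
  · left
    have hu : ∀ m, m ≠ i → u m = 0 := fun m hm => by
      have := hα' (yv i) m
      have h4 : σ⁻¹ m ≠ i := fun e => hm (by rw [hσ] at e; rw [e, hii])
      simp only [yv, Pi.single_apply, h4, hm, if_false, mul_zero, sub_zero] at this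
      exact (mul_eq_zero.1 this.symm).resolve_left hαi
    have hfix : ∀ (v : V n) m, m ≠ i → a m * v (σ⁻¹ m) = v m := fun v m hm => by
      have := hα' v m
      rw [hu m hm, mul_zero, sub_eq_zero] at this
      exact this
    have ha1 : ∀ m, m ≠ i → a m = 1 := fun m hm => by simpa using hfix (fun _ => 1) m hm
    obtain ⟨l, hl, hla⟩ := hroot i
    have hprod : ∏ m, a m = a i := Finset.prod_eq_single i (fun m _ hm => ha1 m hm) (by simp)
    have hgl : g = zt r i ^ l := by
      ext v m
      rw [h3, zt_pow_apply]
      split_ifs with hm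
      · subst hm
        rw [hla, (hσ m m).2 hii.symm]
      · exact hfix v m hm
    refine ⟨l, Finset.mem_Ico.2 ⟨?_, hl⟩, ?_, hgl⟩
    · by_contra hl0
      have : l = 0 := by omega
      subst this
      exact hi (by rw [hgl]; simp)
    -- The determinant condition reads `ζ ^ (l * (r / p)) = 1`, which is divisibility of `l` by `p`.
    · rw [hprod, ← hla, ← pow_mul, (isPrimitiveRoot_zeta (by omega)).pow_eq_one_iff_dvd] at h2
      obtain ⟨q, rfl⟩ := hp
      have hp0 : 0 < p := Nat.pos_of_ne_zero (by rintro rfl; simp at hr)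
      have hq0 : 0 < q := Nat.pos_of_ne_zero (by rintro rfl; simp at hr)
      rw [Nat.mul_div_cancel_left _ hp0] at h2
      exact Nat.dvd_of_mul_dvd_mul_right hq0 h2
  · right
    set j := σ i with hj
    have hji : σ⁻¹ j = i := (hσ _ _).2 rfl
    have hu : ∀ m, m ≠ i → m ≠ j → u m = 0 := fun m hm hmj => by
      have := hα' (yv i) m
      have h4 : σ⁻¹ m ≠ i := fun e => hmj (by rw [hσ] at e; exact e)
      simp only [yv, Pi.single_apply, h4, hm, if_false, mul_zero, sub_zero] at this
      exact (mul_eq_zero.1 this.symm).resolve_left hαi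
    have hfix : ∀ (v : V n) m, m ≠ i → m ≠ j → a m * v (σ⁻¹ m) = v m := fun v m hm hmj => by
      have := hα' v m
      rw [hu m hm hmj, mul_zero, sub_eq_zero] at this
      exact this
    have hij : σ⁻¹ i = j := by
      by_contra hne
      have hne' : σ⁻¹ i ≠ i := fun e => hii ((hσ _ _).1 e).symm
      have h5 := hfix (yv (σ⁻¹ i)) (σ⁻¹ i) hne' hne
      have h6 : σ⁻¹ (σ⁻¹ i) ≠ σ⁻¹ i := fun e => hne' (σ⁻¹.injective e)
      simp only [yv, Pi.single_apply, h6, if_false, if_true, mul_zero] at h5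
      exact zero_ne_one h5
    have e1 := hα' (yv i) j
    have e2 := hα' (yv i) i
    have e3 := hα' (yv j) j
    have e4 := hα' (yv j) i
    simp only [hji, hij, yv, Pi.single_apply, hii, hii.symm, if_true, if_false] at e1 e2 e3 e4
    -- The block of `g - 1` on the coordinates `i`, `j` has rank one, so its determinant `1 - a i *
    -- a j` vanishes.
    have hprod : a i * a j = 1 := by
      linear_combination (a i) * e1 + (α (Pi.single i 1) * u j) * e4
        - α (Pi.single j 1) * u j * e2 + e3
    obtain ⟨l, hl, hla⟩ := hroot i
    refine ⟨j, hii, l, hl, ?_⟩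
    ext v m
    rw [h3, rf_apply r hii, hla]
    split_ifs with hm hmj
    · rw [hm, hij]
    · rw [hmj, hji, eq_inv_of_mul_eq_one_right hprod]
    · exact hfix v m hm hmj

lemma zeta_pow_inj {r l l' : ℕ} (hl : l < r) (hl' : l' < r)
    (h : (zeta r : ℂ) ^ l = (zeta r : ℂ) ^ l') : l = l' :=
  (isPrimitiveRoot_zeta (by omega)).pow_inj hl hl' h

lemma zt_pow_inj {r n : ℕ} {i : Fin n} {l l' : ℕ} (hl : l < r) (hl' : l' < r)
    (h : zt r i ^ l = zt r i ^ l') : l = l' := by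
  have := congrFun (congrArg (fun g : V n ≃ₗ[ℂ] V n => g (yv i)) h) i
  simp only [zt_pow_apply, if_true, yv, Pi.single_eq_same, mul_one] at this
  exact zeta_pow_inj hl hl' this

lemma rf_inj {r n : ℕ} {i j j' : Fin n} (hj : j ≠ i) (hj' : j' ≠ i) {l l' : ℕ} (hl : l < r)
    (hl' : l' < r) (h : rf r i j l = rf r i j' l') : j = j' ∧ l = l' := by
  have h0 := congrFun (congrArg (fun g : V n ≃ₗ[ℂ] V n => g (yv i)) h) j
  simp only [rf_apply r hj, rf_apply r hj', hj, if_true, if_false, yv, Pi.single_eq_same,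
    mul_one] at h0
  have hjj : j = j' := by
    by_contra hne
    simp [hne, hj] at h0
  subst hjj
  refine ⟨rfl, zeta_pow_inj hl hl' ?_⟩
  simpa using h0

lemma zt_pow_ne_rf {r n : ℕ} {i i' j : Fin n} (hj : j ≠ i) (l l' : ℕ) :
    zt r i' ^ l ≠ rf r i j l' := fun h => by
  have h0 := congrFun (congrArg (fun g : V n ≃ₗ[ℂ] V n => g (yv i)) h) j
  simp only [rf_apply r hj, zt_pow_apply, hj, yv, if_true, if_false, Pi.single_eq_same, Pi.single_apply, mul_zero, mul_one, ite_self] at h0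
  exact inv_ne_zero (pow_ne_zero _ (zeta_ne_zero r)) h0.symm

/-- Only one summand of `param` survives: for `0 < l < r` the matrix `ζ_i^l` determines both `i` and
`l`. -/
lemma param_zt {r p n : ℕ} (c0 : ℂ) (c : ℕ → ℂ) {s : G r p n} {i : Fin n} {l : ℕ}
    (hl : l ∈ Finset.Ico 1 r) (hs : (s : V n ≃ₗ[ℂ] V n) = zt r i ^ l) :
    param r p n c0 c s = c l := by
  classical
  rw [param, if_pos ⟨l, hl, i, hs⟩, Finset.sum_eq_single_of_mem l hl, if_pos ⟨i, hs⟩]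
  intro l' hl' hne
  rw [if_neg]
  rintro ⟨i', h'⟩
  rw [Finset.mem_Ico] at hl hl'
  rw [hs] at h'
  rcases eq_or_ne i' i with rfl | hii
  · exact hne (zt_pow_inj (by omega) (by omega) h'.symm)
  · have := congrFun (congrArg (fun g : V n ≃ₗ[ℂ] V n => g (yv i)) h') i
    simp only [zt_pow_apply, if_true, yv, Pi.single_eq_same, mul_one, hii.symm, if_false] at this
    exact (isPrimitiveRoot_zeta (by omega)).pow_ne_one_of_pos_of_lt (by omega) hl.2 this

lemma param_rf {r p n : ℕ} (c0 : ℂ) (c : ℕ → ℂ) {s : G r p n} {i j : Fin n} (hj : j ≠ i) {l : ℕ}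
    (hs : (s : V n ≃ₗ[ℂ] V n) = rf r i j l) : param r p n c0 c s = c0 := by
  rw [param, if_neg]
  rintro ⟨l', -, i', h'⟩
  exact zt_pow_ne_rf hj l' l (h'.symm.trans hs)

lemma dualAct_apply {k h : Type} [Field k] [AddCommGroup h] [Module k h] (w : h ≃ₗ[k] h)
    (x : Module.Dual k h) (v : h) : dualAct w x v = x (w⁻¹ v) := rfl

/-- A sum over the reflections of `G(r,p,n)`, weighted by `⟨x - s x, y_i⟩`, as an explicit sum. -/
lemma reflection_sum {r p n : ℕ} (hr : 1 < r) (hp : p ∣ r) (c0 : ℂ) {c : ℕ → ℂ}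
    (hc : ∀ l : ℕ, ¬ p ∣ l → c l = 0) {M : Type*} [AddCommGroup M] [Module ℂ M]
    (F : (V n ≃ₗ[ℂ] V n) → M) (i : Fin n) (x : Module.Dual ℂ (V n)) :
    ∑ᶠ (s : G r p n) (_ : IsReflection (s : V n ≃ₗ[ℂ] V n)),
      (param r p n c0 c s * (x (yv i) - dualAct (s : V n ≃ₗ[ℂ] V n) x (yv i))) • F s =
    ∑ l ∈ Finset.Ico 1 r, (c l * (x (yv i) - dualAct (zt r i ^ l) x (yv i))) • F (zt r i ^ l) +
    ∑ j ∈ Finset.univ.erase i, ∑ l ∈ Finset.range r,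
      (c0 * (x (yv i) - dualAct (rf r i j l) x (yv i))) • F (rf r i j l) := by
  classical
  have := finite_G (r := r) (by omega) p n
  have := Fintype.ofFinite (G r p n)
  set g : G r p n → M := fun s =>
    (param r p n c0 c s * (x (yv i) - dualAct (s : V n ≃ₗ[ℂ] V n) x (yv i))) • F s with hg
  -- Each explicit term becomes a sum over the whole group of an indicator; after exchanging sums,
  -- the identity is checked for one group element at a time.
  have e1 : ∀ l ∈ Finset.Ico 1 r,
      (c l * (x (yv i) - dualAct (zt r i ^ l) x (yv i))) • F (zt r i ^ l) =
        ∑ s : G r p n, if (s : V n ≃ₗ[ℂ] V n) = zt r i ^ l then g s else 0 := by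
    intro l hl
    by_cases hpl : p ∣ l
    · obtain ⟨q, rfl⟩ := hpl
      have hmem : zt r i ^ (p * q) ∈ G r p n := by
        rw [pow_mul]; exact pow_mem (ztp_mem hp i) q
      rw [Finset.sum_eq_single (⟨_, hmem⟩ : G r p n), if_pos rfl, hg]
      · simp only; rw [param_zt c0 c hl (i := i) rfl]
      · intro s _ hs
        rw [if_neg fun e => hs (Subtype.ext e)]
      · simp
    · rw [hc l hpl, zero_mul, zero_smul]
      refine (Finset.sum_eq_zero fun s _ => ?_).symm
      split_ifs with hs
      · simp only [hg]
        rw [param_zt c0 c hl hs, hc l hpl, zero_mul, zero_smul]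
      · rfl
  have e2 : ∀ j ∈ Finset.univ.erase i, ∀ l ∈ Finset.range r,
      (c0 * (x (yv i) - dualAct (rf r i j l) x (yv i))) • F (rf r i j l) =
        ∑ s : G r p n, if (s : V n ≃ₗ[ℂ] V n) = rf r i j l then g s else 0 := by
    intro j hj l _
    rw [Finset.sum_eq_single (⟨rf r i j l, conj_mem r p i j l⟩ : G r p n), if_pos rfl, hg]
    · simp only; rw [param_rf c0 c (Finset.ne_of_mem_erase hj) (i := i) (l := l) rfl]
    · intro s _ hs
      rw [if_neg fun e => hs (Subtype.ext e)]
    · simp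
  rw [Finset.sum_congr rfl e1, Finset.sum_congr rfl fun j hj => Finset.sum_congr rfl (e2 j hj),
    Finset.sum_comm]
  simp_rw [Finset.sum_comm (s := Finset.range r) (t := Finset.univ)]
  rw [Finset.sum_comm (s := Finset.univ.erase i), ← Finset.sum_add_distrib,
    finsum_eq_sum_of_fintype]
  refine Finset.sum_congr rfl fun s _ => ?_
  rw [finsum_eq_if]
  by_cases hs : IsReflection (s : V n ≃ₗ[ℂ] V n)
  swap
  · rw [if_neg hs, Finset.sum_eq_zero, Finset.sum_eq_zero, add_zero]
    · intro j hj
      refine Finset.sum_eq_zero fun l _ => if_neg fun e => hs ?_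
      rw [e]; exact isReflection_rf r (Finset.ne_of_mem_erase hj) l
    · intro l hl
      rw [Finset.mem_Ico] at hl
      refine if_neg fun e => hs ?_
      rw [e]; exact isReflection_zt hr i hl.1 hl.2
  rw [if_pos hs]
  -- A reflection fixing `y_i` has weight zero; one that moves `y_i` occurs exactly once in the
  -- explicit list.
  by_cases hi : (s : V n ≃ₗ[ℂ] V n) (yv i) = yv i
  · have h0 : g s = 0 := by
      have : (s : V n ≃ₗ[ℂ] V n)⁻¹ (yv i) = yv i :=
        (LinearEquiv.symm_apply_eq _).2 hi.symm
      simp only [hg, dualAct_apply, this, sub_self, mul_zero, zero_smul]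
    simp only [h0, ite_self, Finset.sum_const_zero, add_zero]
    exact h0
  rcases reflection_cases hr hp s.2 hs hi with ⟨l, hl, -, e⟩ | ⟨j, hj, l, hl, e⟩
  · rw [Finset.sum_eq_single_of_mem l hl, if_pos e, Finset.sum_eq_zero, add_zero]
    · intro j hj
      refine Finset.sum_eq_zero fun l' _ => if_neg fun e' => ?_
      exact zt_pow_ne_rf (Finset.ne_of_mem_erase hj) l l' (e.symm.trans e')
    · intro l' hl' hne
      rw [Finset.mem_Ico] at hl hl'
      exact if_neg fun e' => hne (zt_pow_inj (by omega) (by omega) (e'.symm.trans e))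
  · rw [Finset.sum_eq_zero, zero_add, Finset.sum_eq_single_of_mem j (by simp [hj]),
      Finset.sum_eq_single_of_mem l (by simpa using hl), if_pos e]
    · intro l' hl' hne
      rw [Finset.mem_range] at hl'
      exact if_neg fun e' => hne (rf_inj hj hj hl' hl (e'.symm.trans e)).2
    · intro j' hj' hne
      refine Finset.sum_eq_zero fun l' hl' => if_neg fun e' => hne ?_
      rw [Finset.mem_range] at hl'
      exact (rf_inj (Finset.ne_of_mem_erase hj') hj hl' hl (e'.symm.trans e)).1
    · intro l' _
      exact if_neg fun e' => zt_pow_ne_rf hj l' l (e'.symm.trans e)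

/-- The parameter function is invariant under conjugation. -/
lemma param_conj {r p n : ℕ} (c0 : ℂ) (c : ℕ → ℂ) (w s : G r p n) :
    param r p n c0 c (w * s * w⁻¹) = param r p n c0 c s := by
  have key : ∀ (w s : G r p n) (l : ℕ), (∃ i : Fin n, (s : V n ≃ₗ[ℂ] V n) = zt r i ^ l) →
      ∃ i : Fin n, ((w * s * w⁻¹ : G r p n) : V n ≃ₗ[ℂ] V n) = zt r i ^ l := by
    rintro ⟨w, σ, a, h1, h2, h3⟩ s l ⟨i, hi⟩
    -- Conjugation by a monomial matrix with permutation part `σ` takes `ζ_i^l` to `ζ_{σ i}^l`.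
    refine ⟨σ i, ?_⟩
    have hinv : (σ⁻¹ : Equiv.Perm (Fin n)) (σ i) = i := σ.symm_apply_apply i
    have : w * zt r i ^ l = zt r (σ i) ^ l * w := by
      ext v m
      rw [LinearEquiv.mul_apply, LinearEquiv.mul_apply, h3, zt_pow_apply, zt_pow_apply, h3]
      rcases eq_or_ne m (σ i) with rfl | hm
      · rw [hinv, if_pos rfl, if_pos rfl]; ring
      · rw [if_neg hm, if_neg fun e => hm ?_]
        rw [← e]; exact (σ.apply_symm_apply m).symm
    simp only [Subgroup.coe_mul, InvMemClass.coe_inv, hi]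
    rw [this, mul_inv_cancel_right]
  have key' : ∀ l : ℕ, (∃ i : Fin n, ((w * s * w⁻¹ : G r p n) : V n ≃ₗ[ℂ] V n) = zt r i ^ l) ↔
      ∃ i : Fin n, (s : V n ≃ₗ[ℂ] V n) = zt r i ^ l := fun l => by
    refine ⟨fun h => ?_, key w s l⟩
    have := key w⁻¹ _ l h
    rwa [show w⁻¹ * (w * s * w⁻¹) * w⁻¹⁻¹ = s by group] at this
  have e1 : (∃ l ∈ Finset.Ico 1 r, ∃ i : Fin n,
      ((w * s * w⁻¹ : G r p n) : V n ≃ₗ[ℂ] V n) = zt r i ^ l) ↔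
      ∃ l ∈ Finset.Ico 1 r, ∃ i : Fin n, (s : V n ≃ₗ[ℂ] V n) = zt r i ^ l :=
    exists_congr fun l => and_congr_right fun _ => key' l
  unfold param
  by_cases h : ∃ l ∈ Finset.Ico 1 r, ∃ i : Fin n, (s : V n ≃ₗ[ℂ] V n) = zt r i ^ l
  · rw [if_pos h, if_pos (e1.2 h)]
    refine Finset.sum_congr rfl fun l _ => ?_
    by_cases h' : ∃ i : Fin n, (s : V n ≃ₗ[ℂ] V n) = zt r i ^ l
    · rw [if_pos h', if_pos ((key' l).2 h')]
    · rw [if_neg h', if_neg fun e => h' ((key' l).1 e)]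
  · rw [if_neg h, if_neg fun e => h (e1.1 e)]

/-! ### Dunkl operators on polynomials -/

/-- The polynomial ring in the coordinates `x_1, …, x_n`. -/
abbrev Pol (n : ℕ) : Type := MvPolynomial (Fin n) ℂ

/-- The coordinate `x_i` as a polynomial. -/
abbrev px {n : ℕ} (i : Fin n) : Pol n := MvPolynomial.X i

/-- A linear form as a polynomial of degree one. -/
def lin {n : ℕ} : Module.Dual ℂ (V n) →ₗ[ℂ] Pol n where
  toFun x := ∑ i, x (yv i) • px i
  map_add' x y := by simp [add_smul, Finset.sum_add_distrib]
  map_smul' a x := by simp [Finset.smul_sum, mul_smul]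

lemma lin_apply {n : ℕ} (x : Module.Dual ℂ (V n)) : lin x = ∑ i, x (yv i) • px i := rfl

lemma xv_yv {n : ℕ} (i j : Fin n) : xv i (yv j) = if i = j then 1 else 0 := by
  simp [xv, yv, Pi.single_apply]

@[simp] lemma lin_xv {n : ℕ} (i : Fin n) : lin (xv i) = px i := by
  simp [lin_apply, xv_yv]

lemma dual_eq_sum {n : ℕ} (x : Module.Dual ℂ (V n)) : x = ∑ i, x (yv i) • xv i := by
  refine LinearMap.pi_ext' fun i => LinearMap.ext_ring ?_
  have := xv_yv (n := n)
  simp only [yv] at this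
  simp [this, yv]

lemma vec_eq_sum {n : ℕ} (v : V n) : v = ∑ i, v i • yv i := by
  ext m
  simp [yv, Pi.single_apply]

lemma dualAct_mul {k h : Type} [Field k] [AddCommGroup h] [Module k h] (g w : h ≃ₗ[k] h)
    (x : Module.Dual k h) : dualAct (g * w) x = dualAct g (dualAct w x) := by
  ext v
  simp only [dualAct_apply, mul_inv_rev]
  rfl

/-- The action of a linear automorphism of `ℂⁿ` on polynomials. -/
def act {n : ℕ} (g : V n ≃ₗ[ℂ] V n) : Pol n →ₐ[ℂ] Pol n :=
  MvPolynomial.aeval fun i => lin (dualAct g (xv i))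

@[simp] lemma act_px {n : ℕ} (g : V n ≃ₗ[ℂ] V n) (i : Fin n) :
    act g (px i) = lin (dualAct g (xv i)) := by
  simp [act, px]

lemma act_lin {n : ℕ} (g : V n ≃ₗ[ℂ] V n) (x : Module.Dual ℂ (V n)) :
    act g (lin x) = lin (dualAct g x) := by
  rw [lin_apply, map_sum]
  conv_rhs => rw [dual_eq_sum x]
  simp only [map_smul, act_px]
  have : dualAct g (∑ i, x (yv i) • xv i) = ∑ i, x (yv i) • dualAct g (xv i) := by
    ext v
    simp [dualAct_apply]
  rw [this, map_sum]
  simp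

lemma act_mul {n : ℕ} (g w : V n ≃ₗ[ℂ] V n) (f : Pol n) : act (g * w) f = act g (act w f) := by
  have : act (g * w) = (act g).comp (act w) := by
    refine MvPolynomial.algHom_ext fun i => ?_
    rw [AlgHom.comp_apply, act_px, act_px, act_lin, dualAct_mul]
  rw [this]; rfl

@[simp] lemma act_one {n : ℕ} (f : Pol n) : act (1 : V n ≃ₗ[ℂ] V n) f = f := by
  have : act (1 : V n ≃ₗ[ℂ] V n) = AlgHom.id ℂ (Pol n) := by
    refine MvPolynomial.algHom_ext fun i => ?_
    rw [act_px]
    exact lin_xv i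
  rw [this]; rfl

lemma act_inv_act {n : ℕ} (g : V n ≃ₗ[ℂ] V n) (f : Pol n) : act g⁻¹ (act g f) = f := by
  rw [← act_mul, inv_mul_cancel, act_one]

lemma act_act_inv {n : ℕ} (g : V n ≃ₗ[ℂ] V n) (f : Pol n) : act g (act g⁻¹ f) = f := by
  rw [← act_mul, mul_inv_cancel, act_one]

lemma Pol.induction {n : ℕ} {P : Pol n → Prop} (hC : ∀ a, P (MvPolynomial.C a))
    (hadd : ∀ f g, P f → P g → P (f + g)) (hmul : ∀ i f, P f → P (px i * f)) (f : Pol n) : P f :=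
  MvPolynomial.induction_on f hC hadd fun f i h => by rw [mul_comm]; exact hmul i f h

/-- Divisibility passes from the variables to all polynomials by the twisted Leibniz rule `x f - g(x
f) = x (f - g f) + (x - g x) g f`. The quotient is linear because `α` can be cancelled. -/
lemma exists_ddiff {n : ℕ} (g : V n ≃ₗ[ℂ] V n) {α : Pol n} (hα : α ≠ 0)
    (h : ∀ m, α ∣ px m - act g (px m)) :
    ∃ Δ : Pol n →ₗ[ℂ] Pol n, ∀ f, α * Δ f = f - act g f := by
  have key : ∀ f, ∃ q, α * q = f - act g f := by
    refine Pol.induction (fun a => ⟨0, by simp [← MvPolynomial.algebraMap_eq]⟩) ?_ ?_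
    · rintro f f' ⟨q, hq⟩ ⟨q', hq'⟩
      exact ⟨q + q', by rw [mul_add, hq, hq', map_add]; ring⟩
    · rintro i f ⟨q, hq⟩
      obtain ⟨q', hq'⟩ := h i
      exact ⟨px i * q + q' * act g f, by rw [map_mul]; linear_combination px i * hq - act g f * hq'⟩
  choose Δ hΔ using key
  refine ⟨⟨⟨Δ, fun f f' => ?_⟩, fun a f => ?_⟩, hΔ⟩
  · refine mul_left_cancel₀ hα ?_
    rw [mul_add, hΔ, hΔ, hΔ, map_add]; ring
  · refine mul_left_cancel₀ hα ?_
    simp only [RingHom.id_apply]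
    rw [mul_smul_comm, hΔ, hΔ, map_smul, smul_sub]

open scoped Classical in
/-- The divided difference `f ↦ (f - g f) / α`. -/
def ddiff {n : ℕ} (g : V n ≃ₗ[ℂ] V n) (α : Pol n) : Pol n →ₗ[ℂ] Pol n :=
  if h : ∃ Δ : Pol n →ₗ[ℂ] Pol n, ∀ f, α * Δ f = f - act g f then h.choose else 0

lemma ddiff_spec {n : ℕ} {g : V n ≃ₗ[ℂ] V n} {α : Pol n} (hα : α ≠ 0) {q : Fin n → ℂ}
    (h : ∀ m, px m - act g (px m) = q m • α) (f : Pol n) : α * ddiff g α f = f - act g f := by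
  have := exists_ddiff g hα fun m => ⟨MvPolynomial.C (q m), by
    rw [h m, MvPolynomial.smul_eq_C_mul, mul_comm]⟩
  rw [ddiff, dif_pos this]
  exact this.choose_spec f

lemma ddiff_C {n : ℕ} {g : V n ≃ₗ[ℂ] V n} {α : Pol n} (hα : α ≠ 0) {q : Fin n → ℂ}
    (h : ∀ m, px m - act g (px m) = q m • α) (a : ℂ) : ddiff g α (MvPolynomial.C a) = 0 := by
  refine mul_left_cancel₀ hα ?_
  rw [ddiff_spec hα h]
  simp [← MvPolynomial.algebraMap_eq]

lemma ddiff_px_mul {n : ℕ} {g : V n ≃ₗ[ℂ] V n} {α : Pol n} (hα : α ≠ 0) {q : Fin n → ℂ}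
    (h : ∀ m, px m - act g (px m) = q m • α) (m : Fin n) (f : Pol n) :
    ddiff g α (px m * f) = px m * ddiff g α f + q m • act g f := by
  refine mul_left_cancel₀ hα ?_
  have h1 := h m
  rw [MvPolynomial.smul_eq_C_mul] at h1
  rw [ddiff_spec hα h, map_mul, mul_add, mul_left_comm, ddiff_spec hα h,
    MvPolynomial.smul_eq_C_mul]
  linear_combination (act g f) * h1

lemma dualAct_zt (r : ℕ) {n : ℕ} (i m : Fin n) (l : ℕ) :
    dualAct (zt r i ^ l) (xv m) = if m = i then ((zeta r : ℂ) ^ l)⁻¹ • xv i else xv m := by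
  ext v
  rw [LinearMap.comp_apply, LinearMap.comp_apply, dualAct_apply]
  simp only [xv, LinearMap.proj_apply, zt_pow_inv_apply]
  split_ifs with h
  · subst h; simp
  · simp

lemma dualAct_rf (r : ℕ) {n : ℕ} {i j : Fin n} (hij : j ≠ i) (m : Fin n) (l : ℕ) :
    dualAct (rf r i j l) (xv m) = if m = i then (zeta r : ℂ) ^ l • xv j else
      if m = j then ((zeta r : ℂ) ^ l)⁻¹ • xv i else xv m := by
  ext v
  rw [LinearMap.comp_apply, LinearMap.comp_apply, dualAct_apply]
  simp only [xv, LinearMap.proj_apply, rf_inv, rf_apply r hij]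
  split_ifs <;> simp

lemma px_ne_zero {n : ℕ} (i : Fin n) : px i ≠ 0 := MvPolynomial.X_ne_zero i

lemma px_sub_ne_zero {n : ℕ} {i j : Fin n} (hij : j ≠ i) (a : ℂ) : px i - a • px j ≠ 0 := by
  intro h
  have := congrArg (MvPolynomial.eval (Pi.single i (1 : ℂ))) h
  simp [MvPolynomial.smul_eval, hij] at this

lemma px_sub_act_zt (r : ℕ) {n : ℕ} (i : Fin n) (l : ℕ) (m : Fin n) :
    px m - act (zt r i ^ l) (px m) =
      (xv m (yv i) - dualAct (zt r i ^ l) (xv m) (yv i)) • px i := by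
  rw [act_px, dualAct_zt]
  split_ifs with h
  · subst h
    simp [xv_yv, sub_smul]
  · simp [xv_yv, h]

lemma px_sub_act_rf (r : ℕ) {n : ℕ} {i j : Fin n} (hij : j ≠ i) (l : ℕ) (m : Fin n) :
    px m - act (rf r i j l) (px m) =
      (xv m (yv i) - dualAct (rf r i j l) (xv m) (yv i)) • (px i - (zeta r : ℂ) ^ l • px j) := by
  rw [act_px, dualAct_rf r hij]
  split_ifs with h h'
  · subst h
    simp [xv_yv, hij]
  · subst h'
    have h1 : ((zeta r : ℂ) ^ l)⁻¹ * (zeta r : ℂ) ^ l = 1 :=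
      inv_mul_cancel₀ (pow_ne_zero _ (zeta_ne_zero r))
    simp only [xv_yv, hij, LinearMap.smul_apply, map_smul, lin_xv, smul_sub, smul_smul, zero_sub,
      if_true, if_false, smul_eq_mul, mul_one, neg_mul, h1, neg_smul, one_smul]
    abel
  · simp [xv_yv, h]

/-- The Dunkl operator attached to `y_i`. -/
def dunkl (r : ℕ) {n : ℕ} (c0 : ℂ) (c : ℕ → ℂ) (i : Fin n) : Pol n →ₗ[ℂ] Pol n :=
  (MvPolynomial.pderiv i).toLinearMap - ∑ l ∈ Finset.Ico 1 r, c l • ddiff (zt r i ^ l) (px i) -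
    c0 • ∑ j ∈ Finset.univ.erase i, ∑ l ∈ Finset.range r,
      ddiff (rf r i j l) (px i - (zeta r : ℂ) ^ l • px j)

lemma dunkl_C (r : ℕ) {n : ℕ} (c0 : ℂ) (c : ℕ → ℂ) (i : Fin n) (a : ℂ) :
    dunkl r c0 c i (MvPolynomial.C a) = 0 := by
  simp only [dunkl, LinearMap.sub_apply, LinearMap.sum_apply, LinearMap.smul_apply]
  rw [Finset.sum_eq_zero fun l _ => by
    rw [ddiff_C (px_ne_zero i) (px_sub_act_zt r i l), smul_zero],
    Finset.sum_eq_zero fun j hj => Finset.sum_eq_zero fun l _ => by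
      rw [ddiff_C (px_sub_ne_zero (Finset.ne_of_mem_erase hj) _)
        (px_sub_act_rf r (Finset.ne_of_mem_erase hj) l)]]
  simp

/-- The twisted Leibniz rule of each divided difference, summed up. The correction has the shape of
`reflection_sum`, so this is the commutation relation between `y_i` and `x_m` in coordinates. -/
lemma dunkl_px_mul (r : ℕ) {n : ℕ} (c0 : ℂ) (c : ℕ → ℂ) (i m : Fin n) (f : Pol n) :
    dunkl r c0 c i (px m * f) = px m * dunkl r c0 c i f + xv m (yv i) • f -
      (∑ l ∈ Finset.Ico 1 r, (c l * (xv m (yv i) - dualAct (zt r i ^ l) (xv m) (yv i))) •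
          act (zt r i ^ l) f +
        ∑ j ∈ Finset.univ.erase i, ∑ l ∈ Finset.range r,
          (c0 * (xv m (yv i) - dualAct (rf r i j l) (xv m) (yv i))) • act (rf r i j l) f) := by
  simp only [dunkl, LinearMap.sub_apply, LinearMap.sum_apply, LinearMap.smul_apply]
  have e1 : ∑ l ∈ Finset.Ico 1 r, c l • ddiff (zt r i ^ l) (px i) (px m * f) =
      px m * ∑ l ∈ Finset.Ico 1 r, c l • ddiff (zt r i ^ l) (px i) f +
      ∑ l ∈ Finset.Ico 1 r, (c l * (xv m (yv i) - dualAct (zt r i ^ l) (xv m) (yv i))) •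
          act (zt r i ^ l) f := by
    rw [Finset.mul_sum, ← Finset.sum_add_distrib]
    refine Finset.sum_congr rfl fun l _ => ?_
    rw [ddiff_px_mul (px_ne_zero i) (px_sub_act_zt r i l), smul_add, mul_smul_comm, mul_smul]
  have e2 : ∑ j ∈ Finset.univ.erase i, ∑ l ∈ Finset.range r,
      ddiff (rf r i j l) (px i - (zeta r : ℂ) ^ l • px j) (px m * f) =
      px m * ∑ j ∈ Finset.univ.erase i, ∑ l ∈ Finset.range r,
        ddiff (rf r i j l) (px i - (zeta r : ℂ) ^ l • px j) f +
      ∑ j ∈ Finset.univ.erase i, ∑ l ∈ Finset.range r,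
        (xv m (yv i) - dualAct (rf r i j l) (xv m) (yv i)) • act (rf r i j l) f := by
    simp only [Finset.mul_sum, ← Finset.sum_add_distrib]
    refine Finset.sum_congr rfl fun j hj => Finset.sum_congr rfl fun l _ => ?_
    rw [ddiff_px_mul (px_sub_ne_zero (Finset.ne_of_mem_erase hj) _)
        (px_sub_act_rf r (Finset.ne_of_mem_erase hj) l)]
  rw [e1, e2]
  have e3 : (MvPolynomial.pderiv i).toLinearMap (px m * f) =
      px m * (MvPolynomial.pderiv i).toLinearMap f + xv m (yv i) • f := by
    rw [xv_yv]
    simp only [Derivation.coeFn_coe, Derivation.leibniz,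
      MvPolynomial.pderiv_X, smul_eq_mul]
    congr 1
    rcases eq_or_ne i m with rfl | h
    · simp
    · simp [h.symm]
  rw [e3]
  have e4 : ∑ j ∈ Finset.univ.erase i, ∑ l ∈ Finset.range r,
      (c0 * (xv m (yv i) - dualAct (rf r i j l) (xv m) (yv i))) • act (rf r i j l) f =
      c0 • ∑ j ∈ Finset.univ.erase i, ∑ l ∈ Finset.range r,
        (xv m (yv i) - dualAct (rf r i j l) (xv m) (yv i)) • act (rf r i j l) f := by
    simp only [Finset.smul_sum, mul_smul]
  rw [e4, smul_add, mul_sub, mul_sub, mul_smul_comm]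
  abel

/-! ### Equivariance and commutativity of the Dunkl operators -/

section Relations

variable {r p n : ℕ}

open scoped Classical in
/-- The finite set of reflections of `G(r,p,n)`. -/
def refl (hr : 1 < r) (p n : ℕ) : Finset (G r p n) :=
  haveI := finite_G (r := r) (by omega) p n
  (Set.toFinite {s : G r p n | IsReflection (s : V n ≃ₗ[ℂ] V n)}).toFinset

lemma mem_refl (hr : 1 < r) (s : G r p n) :
    s ∈ refl hr p n ↔ IsReflection (s : V n ≃ₗ[ℂ] V n) := by
  simp [refl]

lemma finsum_refl (hr : 1 < r) {M : Type*} [AddCommMonoid M] (F : G r p n → M) :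
    ∑ᶠ (s : G r p n) (_ : IsReflection (s : V n ≃ₗ[ℂ] V n)), F s = ∑ s ∈ refl hr p n, F s := by
  rw [← finsum_mem_coe_finset]
  simp [mem_refl]

/-- The Dunkl operator attached to a vector. -/
def dunklV (r : ℕ) {n : ℕ} (c0 : ℂ) (c : ℕ → ℂ) : V n →ₗ[ℂ] Pol n →ₗ[ℂ] Pol n :=
  ∑ i, (xv i).smulRight (dunkl r c0 c i)

lemma dunklV_apply (c0 : ℂ) (c : ℕ → ℂ) (v : V n) (f : Pol n) :
    dunklV r c0 c v f = ∑ i, v i • dunkl r c0 c i f := by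
  simp [dunklV, xv]

lemma dunklV_yv (c0 : ℂ) (c : ℕ → ℂ) (i : Fin n) :
    dunklV r c0 c (yv i) = dunkl r c0 c i := by
  refine LinearMap.ext fun f => ?_
  simp [dunklV_apply, yv, Pi.single_apply]

lemma dunklV_C (c0 : ℂ) (c : ℕ → ℂ) (v : V n) (a : ℂ) :
    dunklV r c0 c v (MvPolynomial.C a) = 0 := by
  simp [dunklV_apply, dunkl_C]

lemma dual_apply (x : Module.Dual ℂ (V n)) (v : V n) : x v = ∑ i, v i * x (yv i) := by
  conv_lhs => rw [vec_eq_sum v, map_sum]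
  simp

/-- Once the explicit reflections are replaced by a sum over the group, the formula is linear in the
vector, and the sum can be reindexed by conjugation. Together with vanishing on constants it
determines the Dunkl operators, so later identities follow by induction on polynomials. -/
lemma dunklV_px_mul (hr : 1 < r) (hp : p ∣ r) (c0 : ℂ) {c : ℕ → ℂ}
    (hc : ∀ l : ℕ, ¬ p ∣ l → c l = 0) (v : V n) (m : Fin n) (f : Pol n) :
    dunklV r c0 c v (px m * f) = px m * dunklV r c0 c v f + xv m v • f -
      ∑ s ∈ refl hr p n, (param r p n c0 c s * (xv m v - dualAct (s : V n ≃ₗ[ℂ] V n) (xv m) v)) •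
        act (s : V n ≃ₗ[ℂ] V n) f := by
  have key : ∀ i, dunkl r c0 c i (px m * f) =
      px m * dunkl r c0 c i f + xv m (yv i) • f -
      ∑ s ∈ refl hr p n, (param r p n c0 c s *
        (xv m (yv i) - dualAct (s : V n ≃ₗ[ℂ] V n) (xv m) (yv i))) •
        act (s : V n ≃ₗ[ℂ] V n) f := by
    intro i
    rw [dunkl_px_mul, ← finsum_refl hr, reflection_sum hr hp c0 hc (fun s => act s f)]
  rw [dunklV_apply, dunklV_apply]
  simp only [key, smul_sub, smul_add, Finset.sum_sub_distrib, Finset.sum_add_distrib,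
    Finset.mul_sum, mul_smul_comm]
  congr 1
  · congr 1
    rw [dual_apply (xv m) v, Finset.sum_smul]
    simp only [mul_smul]
  · simp only [Finset.smul_sum]
    rw [Finset.sum_comm]
    refine Finset.sum_congr rfl fun s _ => ?_
    rw [dual_apply (xv m) v, dual_apply (dualAct _ (xv m)) v, ← Finset.sum_sub_distrib,
      Finset.mul_sum, Finset.sum_smul]
    refine Finset.sum_congr rfl fun i _ => ?_
    rw [smul_smul]
    congr 1
    ring

lemma dunklV_lin_mul (hr : 1 < r) (hp : p ∣ r) (c0 : ℂ) {c : ℕ → ℂ}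
    (hc : ∀ l : ℕ, ¬ p ∣ l → c l = 0) (v : V n) (x : Module.Dual ℂ (V n)) (f : Pol n) :
    dunklV r c0 c v (lin x * f) = lin x * dunklV r c0 c v f + x v • f -
      ∑ s ∈ refl hr p n, (param r p n c0 c s * (x v - dualAct (s : V n ≃ₗ[ℂ] V n) x v)) •
        act (s : V n ≃ₗ[ℂ] V n) f := by
  have hx : ∀ v, x v = ∑ m, x (yv m) * xv m v := fun v => by
    conv_lhs => rw [dual_eq_sum x]
    simp
  have hx' : ∀ (g : V n ≃ₗ[ℂ] V n) v, dualAct g x v = ∑ m, x (yv m) * dualAct g (xv m) v :=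
    fun g v => hx _
  rw [lin_apply, Finset.sum_mul, Finset.sum_mul, map_sum]
  simp only [smul_mul_assoc, map_smul, dunklV_px_mul hr hp c0 hc, smul_sub, smul_add,
    Finset.sum_sub_distrib, Finset.sum_add_distrib]
  congr 1
  · congr 1
    rw [hx v, Finset.sum_smul]
    simp only [mul_smul]
  · simp only [Finset.smul_sum]
    rw [Finset.sum_comm]
    refine Finset.sum_congr rfl fun s _ => ?_
    rw [hx v, hx', ← Finset.sum_sub_distrib, Finset.mul_sum, Finset.sum_smul]
    refine Finset.sum_congr rfl fun i _ => ?_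
    rw [smul_smul]
    congr 1
    ring

lemma sum_refl_conj (hr : 1 < r) (w : G r p n) {M : Type*} [AddCommMonoid M] (F : G r p n → M) :
    ∑ s ∈ refl hr p n, F (w * s * w⁻¹) = ∑ s ∈ refl hr p n, F s := by
  refine Finset.sum_bij' (fun s _ => w * s * w⁻¹) (fun s _ => w⁻¹ * s * w) ?_ ?_ ?_ ?_ ?_
  · intro s hs
    rw [mem_refl] at hs ⊢
    exact hs.conj _
  · intro s hs
    rw [mem_refl] at hs ⊢
    have := hs.conj ((w⁻¹ : G r p n) : V n ≃ₗ[ℂ] V n)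
    simpa using this
  · intro s _; group
  · intro s _; group
  · intro s _; rfl

/-- Dunkl operators are equivariant. -/
lemma act_dunklV (hr : 1 < r) (hp : p ∣ r) (c0 : ℂ) {c : ℕ → ℂ}
    (hc : ∀ l : ℕ, ¬ p ∣ l → c l = 0) (w : G r p n) (f : Pol n) :
    ∀ v : V n, act (w : V n ≃ₗ[ℂ] V n) (dunklV r c0 c v f) =
      dunklV r c0 c ((w : V n ≃ₗ[ℂ] V n) v) (act (w : V n ≃ₗ[ℂ] V n) f) := by
  induction f using Pol.induction with
  | hC a =>
    intro v
    rw [dunklV_C, ← MvPolynomial.algebraMap_eq, AlgHom.commutes, MvPolynomial.algebraMap_eq,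
      dunklV_C, map_zero]
  | hadd f g hf hg => intro v; simp only [map_add, hf, hg]
  | hmul i f hf =>
    intro v
    have hw : ∀ (x : Module.Dual ℂ (V n)) v,
        dualAct (w : V n ≃ₗ[ℂ] V n) x ((w : V n ≃ₗ[ℂ] V n) v) = x v := fun x v =>
      congrArg x ((w : V n ≃ₗ[ℂ] V n).symm_apply_apply v)
    rw [dunklV_px_mul hr hp c0 hc, map_mul, act_px, dunklV_lin_mul hr hp c0 hc]
    -- Reindex by `s ↦ w s w⁻¹`, under which the parameters are invariant.
    have key : ∑ s ∈ refl hr p n, (param r p n c0 c s *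
        (xv i v - dualAct (s : V n ≃ₗ[ℂ] V n) (xv i) v)) •
          act (w : V n ≃ₗ[ℂ] V n) (act (s : V n ≃ₗ[ℂ] V n) f) =
        ∑ s ∈ refl hr p n, (param r p n c0 c s *
        (xv i v - dualAct (s : V n ≃ₗ[ℂ] V n) (dualAct (w : V n ≃ₗ[ℂ] V n) (xv i))
          ((w : V n ≃ₗ[ℂ] V n) v))) •
          act (s : V n ≃ₗ[ℂ] V n) (act (w : V n ≃ₗ[ℂ] V n) f) := by
      refine Eq.trans ?_ (sum_refl_conj hr w _)
      refine Finset.sum_congr rfl fun s _ => ?_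
      have e1 : ((w * s * w⁻¹ : G r p n) : V n ≃ₗ[ℂ] V n) = w * s * (w : V n ≃ₗ[ℂ] V n)⁻¹ := by
        simp
      have e2 : dualAct ((w * s * w⁻¹ : G r p n) : V n ≃ₗ[ℂ] V n)
          (dualAct (w : V n ≃ₗ[ℂ] V n) (xv i)) =
          dualAct (w : V n ≃ₗ[ℂ] V n) (dualAct (s : V n ≃ₗ[ℂ] V n) (xv i)) := by
        rw [← dualAct_mul, ← dualAct_mul, e1, inv_mul_cancel_right]
      rw [e2, hw, e1, act_mul, act_mul, act_inv_act, param_conj]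
    rw [map_sub, map_add, map_mul, map_smul, map_sum, act_px, hf, hw, ← key]
    simp only [map_smul]

/-- The two sides of a reflection: `⟨x - s x, v⟩ (s v' - v')` is symmetric in `v` and `v'`. -/
lemma IsReflection.rank_one_symm {k h : Type} [Field k] [AddCommGroup h] [Module k h]
    {s : h ≃ₗ[k] h} (hs : IsReflection s) (x : Module.Dual k h) (v v' : h) :
    (x v - dualAct s x v) • (s v' - v') = (x v' - dualAct s x v') • (s v - v) := by
  obtain ⟨α, u, hα⟩ := hs.exists_rank_one
  have key : ∀ v, x v - dualAct s x v = α v * x (s⁻¹ u) := fun v => by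
    have h1 := congrArg ((s⁻¹ : h ≃ₗ[k] h) : h →ₗ[k] h) (hα v)
    rw [map_sub, map_smul] at h1
    simp only [LinearEquiv.coe_coe] at h1
    have h2 : s⁻¹ (s v) = v := s.symm_apply_apply v
    rw [h2] at h1
    rw [dualAct_apply, ← map_sub, h1, map_smul, smul_eq_mul]
  rw [key, key, hα, hα, smul_smul, smul_smul]
  congr 1
  ring

/-- Dunkl operators commute. -/
lemma dunklV_comm (hr : 1 < r) (hp : p ∣ r) (c0 : ℂ) {c : ℕ → ℂ}
    (hc : ∀ l : ℕ, ¬ p ∣ l → c l = 0) (v v' : V n) (f : Pol n) :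
    dunklV r c0 c v (dunklV r c0 c v' f) = dunklV r c0 c v' (dunklV r c0 c v f) := by
  induction f using Pol.induction with
  | hC a => simp only [dunklV_C, map_zero]
  | hadd f g hf hg => simp only [map_add, hf, hg]
  | hmul i f hf =>
    -- By equivariance `s (y_{v'} f) - y_{v'} (s f)` is the Dunkl operator of `s v' - v'` applied to
    -- `s f`. The sums agree term by term by the symmetry in `IsReflection.rank_one_symm`.
    have key : ∑ s ∈ refl hr p n, ((param r p n c0 c s *
          (xv i v - dualAct (s : V n ≃ₗ[ℂ] V n) (xv i) v)) •
          (act (s : V n ≃ₗ[ℂ] V n) (dunklV r c0 c v' f) -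
            dunklV r c0 c v' (act (s : V n ≃ₗ[ℂ] V n) f))) =
        ∑ s ∈ refl hr p n, ((param r p n c0 c s *
          (xv i v' - dualAct (s : V n ≃ₗ[ℂ] V n) (xv i) v')) •
          (act (s : V n ≃ₗ[ℂ] V n) (dunklV r c0 c v f) -
            dunklV r c0 c v (act (s : V n ≃ₗ[ℂ] V n) f))) := by
      refine Finset.sum_congr rfl fun s hs => ?_
      rw [mem_refl] at hs
      have e : ∀ (a : ℂ) (u u' : V n) (g : Pol n), a • (dunklV r c0 c u g - dunklV r c0 c u' g) =
          dunklV r c0 c (a • (u - u')) g := fun a u u' g => by simp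
      rw [act_dunklV hr hp c0 hc s, act_dunklV hr hp c0 hc s, e, e, mul_smul, mul_smul,
        hs.rank_one_symm]
    simp only [smul_sub, Finset.sum_sub_distrib] at key
    simp only [dunklV_px_mul hr hp c0 hc, map_sub, map_add, map_sum, map_smul, hf]
    rw [← sub_eq_zero] at key ⊢
    rw [← neg_eq_zero, ← key]
    abel

end Relations

/-! ### Relations in the rational Cherednik algebra -/

section RCARelations

variable {k h : Type} [Field k] [AddCommGroup h] [Module k h] (W : Subgroup (h ≃ₗ[k] h))
  (κ : k) (c : W → k)

lemma RCA.mk_rel {a b : FreeAlgebra k (Gen W)} (hab : Rel W κ c a b) :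
    RCA.mk W κ c a = RCA.mk W κ c b :=
  RingQuot.mkAlgHom_rel k hab

lemma X_add (x x' : Module.Dual k h) : X W κ c (x + x') = X W κ c x + X W κ c x' := by
  rw [X, RCA.mk_rel W κ c (Rel.x_add x x'), map_add]; rfl

lemma X_smul (a : k) (x : Module.Dual k h) : X W κ c (a • x) = a • X W κ c x := by
  rw [X, RCA.mk_rel W κ c (Rel.x_smul a x), map_smul]; rfl

lemma X_comm (x x' : Module.Dual k h) : X W κ c x * X W κ c x' = X W κ c x' * X W κ c x := by
  have := RCA.mk_rel W κ c (Rel.x_comm x x')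
  rwa [map_mul, map_mul] at this

lemma T_mul_X (w : W) (x : Module.Dual k h) :
    T W κ c w * X W κ c x = X W κ c (dualAct (w : h ≃ₗ[k] h) x) * T W κ c w := by
  have := RCA.mk_rel W κ c (Rel.t_x w x)
  rwa [map_mul, map_mul] at this

/-- The algebra is generated by the images of the generators. -/
lemma RCA.induction {P : RCA W κ c → Prop} (halg : ∀ a : k, P (algebraMap k _ a))
    (hX : ∀ x, P (X W κ c x)) (hY : ∀ v, P (Y W κ c v)) (hT : ∀ w, P (T W κ c w))
    (hmul : ∀ a b, P a → P b → P (a * b)) (hadd : ∀ a b, P a → P b → P (a + b))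
    (a : RCA W κ c) : P a := by
  obtain ⟨a, rfl⟩ := RingQuot.mkAlgHom_surjective k (Rel W κ c) a
  change P (RCA.mk W κ c a)
  induction a using FreeAlgebra.induction with
  | grade0 a =>
    have : RCA.mk W κ c (algebraMap k _ a) = algebraMap k _ a := AlgHom.commutes _ a
    rw [this]; exact halg a
  | grade1 g => cases g with
    | x x => exact hX x
    | y v => exact hY v
    | t w => exact hT w
  | mul a b ha hb => rw [map_mul]; exact hmul _ _ ha hb
  | add a b ha hb => rw [map_add]; exact hadd _ _ ha hb

end RCARelations

/-! ### The standard module as the polynomial representation -/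

section Rep

variable {r p n : ℕ}

/-- The images of the generators in the polynomial representation. -/
def genOp (r p n : ℕ) (c0 : ℂ) (c : ℕ → ℂ) : Gen (G r p n) → Module.End ℂ (Pol n)
  | .x x => LinearMap.mulLeft ℂ (lin x)
  | .y v => dunklV r c0 c v
  | .t w => (act (w : V n ≃ₗ[ℂ] V n)).toLinearMap

lemma genOp_rel (hr : 1 < r) (hp : p ∣ r) (c0 : ℂ) {c : ℕ → ℂ}
    (hc : ∀ l : ℕ, ¬ p ∣ l → c l = 0) {a b : FreeAlgebra ℂ (Gen (G r p n))}
    (hab : Rel (G r p n) 1 (param r p n c0 c) a b) :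
    FreeAlgebra.lift ℂ (genOp r p n c0 c) a = FreeAlgebra.lift ℂ (genOp r p n c0 c) b := by
  refine LinearMap.ext fun f => ?_
  cases hab with
  | x_add x x' => simp [fx, genOp, add_mul]
  | x_smul a x => simp [fx, genOp]
  | y_add v v' => simp [fy, genOp]
  | y_smul a v => simp [fy, genOp]
  | t_one => simp [ft, genOp]
  | t_mul w w' => simp [ft, genOp, act_mul]
  | t_x w x => simp [fx, ft, genOp, act_lin]
  | t_y w v => simpa [fy, ft, genOp] using act_dunklV hr hp c0 hc w f v
  | x_comm x x' => simp [fx, genOp, mul_left_comm]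
  | y_comm v v' => simpa [fy, genOp] using dunklV_comm hr hp c0 hc v v' f
  | cross v x =>
    rw [finsum_refl hr]
    have := dunklV_lin_mul hr hp c0 hc v x f
    simp only [fx, fy, ft, map_sub, map_mul, map_smul, map_sum, map_one, FreeAlgebra.lift_ι_apply,
      LinearMap.sub_apply, Module.End.mul_apply, LinearMap.smul_apply, LinearMap.sum_apply, genOp,
      LinearMap.mulLeft_apply, AlgHom.toLinearMap_apply, Module.End.one_apply, one_mul]
    rw [this]
    abel

/-- The polynomial representation. -/
def rho (hr : 1 < r) (hp : p ∣ r) (c0 : ℂ) {c : ℕ → ℂ} (hc : ∀ l : ℕ, ¬ p ∣ l → c l = 0) :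
    HH r p n c0 c →ₐ[ℂ] Module.End ℂ (Pol n) :=
  RingQuot.liftAlgHom ℂ ⟨FreeAlgebra.lift ℂ (genOp r p n c0 c),
    fun _ _ hab => genOp_rel hr hp c0 hc hab⟩

lemma rho_mk (hr : 1 < r) (hp : p ∣ r) (c0 : ℂ) {c : ℕ → ℂ}
    (hc : ∀ l : ℕ, ¬ p ∣ l → c l = 0) (a : FreeAlgebra ℂ (Gen (G r p n))) :
    rho hr hp c0 hc (RCA.mk _ _ _ a) = FreeAlgebra.lift ℂ (genOp r p n c0 c) a :=
  RingQuot.liftAlgHom_mkAlgHom_apply _ _ _ _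

lemma rho_X (hr : 1 < r) (hp : p ∣ r) (c0 : ℂ) {c : ℕ → ℂ}
    (hc : ∀ l : ℕ, ¬ p ∣ l → c l = 0) (x : Module.Dual ℂ (V n)) (f : Pol n) :
    rho hr hp c0 hc (X _ _ _ x) f = lin x * f := by
  rw [X, rho_mk, fx, FreeAlgebra.lift_ι_apply]; rfl

lemma rho_Y (hr : 1 < r) (hp : p ∣ r) (c0 : ℂ) {c : ℕ → ℂ}
    (hc : ∀ l : ℕ, ¬ p ∣ l → c l = 0) (v : V n) (f : Pol n) :
    rho hr hp c0 hc (Y _ _ _ v) f = dunklV r c0 c v f := by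
  rw [Y, rho_mk, fy, FreeAlgebra.lift_ι_apply]; rfl

lemma rho_T (hr : 1 < r) (hp : p ∣ r) (c0 : ℂ) {c : ℕ → ℂ}
    (hc : ∀ l : ℕ, ¬ p ∣ l → c l = 0) (w : G r p n) (f : Pol n) :
    rho hr hp c0 hc (T _ _ _ w) f = act (w : V n ≃ₗ[ℂ] V n) f := by
  rw [T, rho_mk, ft, FreeAlgebra.lift_ι_apply]; rfl

/-- Evaluation of polynomials needs a commutative target, so it goes through the subalgebra
generated by the commuting elements `x_i`. -/
lemma exists_polHom (r p n : ℕ) (c0 : ℂ) (c : ℕ → ℂ) :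
    ∃ q : Pol n →ₐ[ℂ] HH r p n c0 c, ∀ i, q (px i) = xi r p n c0 c i := by
  have hcomm : ∀ a ∈ Set.range (xi r p n c0 c), ∀ b ∈ Set.range (xi r p n c0 c),
      a * b = b * a := by
    rintro _ ⟨i, rfl⟩ _ ⟨j, rfl⟩
    exact X_comm _ _ _ _ _
  have hA := Algebra.isMulCommutative_adjoin ℂ hcomm
  let _ : CommRing (Algebra.adjoin ℂ (Set.range (xi r p n c0 c))) :=
    { (inferInstance : Ring (Algebra.adjoin ℂ (Set.range (xi r p n c0 c)))) with
      mul_comm := fun a b => hA.is_comm.comm a b }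
  refine ⟨(Algebra.adjoin ℂ (Set.range (xi r p n c0 c))).val.comp
    (MvPolynomial.aeval fun i => ⟨xi r p n c0 c i, Algebra.subset_adjoin ⟨i, rfl⟩⟩), fun i => ?_⟩
  simp [px]

/-- Polynomials as elements of the rational Cherednik algebra. -/
def polHom (r p n : ℕ) (c0 : ℂ) (c : ℕ → ℂ) : Pol n →ₐ[ℂ] HH r p n c0 c :=
  (exists_polHom r p n c0 c).choose

lemma polHom_px (c0 : ℂ) (c : ℕ → ℂ) (i : Fin n) :
    polHom r p n c0 c (px i) = xi r p n c0 c i :=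
  (exists_polHom r p n c0 c).choose_spec i

lemma polHom_lin (c0 : ℂ) (c : ℕ → ℂ) (x : Module.Dual ℂ (V n)) :
    polHom r p n c0 c (lin x) = X _ _ _ x := by
  rw [lin_apply, map_sum]
  simp only [map_smul, polHom_px]
  let L : Module.Dual ℂ (V n) →ₗ[ℂ] HH r p n c0 c :=
    { toFun := X _ _ _, map_add' := X_add _ _ _, map_smul' := X_smul _ _ _ }
  change _ = L x
  conv_rhs => rw [dual_eq_sum x, map_sum]
  simp only [map_smul]; rfl

lemma T_mul_polHom (c0 : ℂ) (c : ℕ → ℂ) (w : G r p n) (f : Pol n) :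
    T _ _ _ w * polHom r p n c0 c f = polHom r p n c0 c (act (w : V n ≃ₗ[ℂ] V n) f) * T _ _ _ w := by
  induction f using Pol.induction with
  | hC a =>
    rw [← MvPolynomial.algebraMap_eq, AlgHom.commutes, AlgHom.commutes, AlgHom.commutes]
    exact (Algebra.commutes _ _).symm
  | hadd f g hf hg => simp only [map_add, mul_add, add_mul, hf, hg]
  | hmul i f hf =>
    rw [map_mul, map_mul, map_mul, ← mul_assoc, polHom_px, xi, T_mul_X, mul_assoc, hf, act_px,
      polHom_lin, mul_assoc]

/-- The map from polynomials to the standard module. -/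
def toMM (r p n : ℕ) (c0 : ℂ) (c : ℕ → ℂ) : Pol n →ₗ[ℂ] MM r p n c0 c :=
  ((stdIdeal (G r p n) (1 : ℂ) (param r p n c0 c)).mkQ.restrictScalars ℂ) ∘ₗ
    (polHom r p n c0 c).toLinearMap

lemma toMM_apply (c0 : ℂ) (c : ℕ → ℂ) (f : Pol n) : toMM r p n c0 c f =
    (Submodule.Quotient.mk (polHom r p n c0 c f) : MM r p n c0 c) := rfl

lemma T_smul_toMM (c0 : ℂ) (c : ℕ → ℂ) (w : G r p n) (f : Pol n) :
    (T _ _ _ w : HH r p n c0 c) • toMM r p n c0 c f =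
      toMM r p n c0 c (act (w : V n ≃ₗ[ℂ] V n) f) := by
  rw [toMM_apply, toMM_apply, ← Submodule.Quotient.mk_smul, smul_eq_mul, T_mul_polHom,
    ← sub_eq_zero, ← Submodule.Quotient.mk_sub, Submodule.Quotient.mk_eq_zero]
  have := Submodule.smul_mem (stdIdeal (G r p n) (1 : ℂ) (param r p n c0 c))
    (polHom r p n c0 c (act (w : V n ≃ₗ[ℂ] V n) f))
    (Submodule.subset_span (Or.inr ⟨w, rfl⟩))
  rwa [smul_eq_mul, mul_sub, mul_one] at this

lemma X_smul_toMM (c0 : ℂ) (c : ℕ → ℂ) (x : Module.Dual ℂ (V n)) (f : Pol n) :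
    (X _ _ _ x : HH r p n c0 c) • toMM r p n c0 c f = toMM r p n c0 c (lin x * f) := by
  rw [toMM_apply, toMM_apply, map_mul, polHom_lin]
  rfl

lemma Y_mul_X (hr : 1 < r) (c0 : ℂ) (c : ℕ → ℂ) (v : V n) (x : Module.Dual ℂ (V n)) :
    (Y _ _ _ v : HH r p n c0 c) * X _ _ _ x = X _ _ _ x * Y _ _ _ v + x v • 1 -
      ∑ s ∈ refl hr p n, (param r p n c0 c s * (x v - dualAct (s : V n ≃ₗ[ℂ] V n) x v)) •
        T _ _ _ s := by
  have := RCA.mk_rel (G r p n) 1 (param r p n c0 c) (Rel.cross v x)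
  rw [finsum_refl hr] at this
  simp only [map_sub, map_mul, map_smul, map_one, map_sum, one_mul] at this
  rw [add_sub_assoc, ← sub_eq_iff_eq_add']
  exact this

/-- The vector is commuted to the right past one variable after another until it meets a constant,
where it lies in the left ideal. The terms produced on the way are those of `dunklV_px_mul`. -/
lemma Y_smul_toMM (hr : 1 < r) (hp : p ∣ r) (c0 : ℂ) {c : ℕ → ℂ}
    (hc : ∀ l : ℕ, ¬ p ∣ l → c l = 0) (v : V n) (f : Pol n) :
    (Y _ _ _ v : HH r p n c0 c) • toMM r p n c0 c f = toMM r p n c0 c (dunklV r c0 c v f) := by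
  induction f using Pol.induction with
  | hC a =>
    rw [dunklV_C, map_zero, toMM_apply, ← MvPolynomial.algebraMap_eq, AlgHom.commutes,
      ← Submodule.Quotient.mk_smul, smul_eq_mul, Submodule.Quotient.mk_eq_zero,
      ← Algebra.commutes]
    exact Submodule.smul_mem _ _ (Submodule.subset_span (Or.inl ⟨v, rfl⟩))
  | hadd f g hf hg => simp only [map_add, smul_add, hf, hg]
  | hmul i f hf =>
    rw [dunklV_px_mul hr hp c0 hc, ← lin_xv i, ← X_smul_toMM, smul_smul, Y_mul_X hr, sub_smul,
      add_smul, mul_smul, hf, Finset.sum_smul, X_smul_toMM, map_sub, map_add, map_sum]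
    simp only [smul_assoc, one_smul, T_smul_toMM, map_smul]

lemma smul_toMM (hr : 1 < r) (hp : p ∣ r) (c0 : ℂ) {c : ℕ → ℂ}
    (hc : ∀ l : ℕ, ¬ p ∣ l → c l = 0) (a : HH r p n c0 c) :
    ∀ f, a • toMM r p n c0 c f = toMM r p n c0 c (rho hr hp c0 hc a f) := by
  induction a using RCA.induction with
  | halg a => intro f; rw [AlgHom.commutes, algebraMap_smul, Module.algebraMap_end_apply, map_smul]
  | hX x => intro f; rw [X_smul_toMM, rho_X]
  | hY v => intro f; rw [Y_smul_toMM hr hp c0 hc, rho_Y]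
  | hT w => intro f; rw [T_smul_toMM, rho_T]
  | hmul a b ha hb => intro f; rw [mul_smul, hb, ha, map_mul]; rfl
  | hadd a b ha hb => intro f; rw [add_smul, hb, ha, map_add, LinearMap.add_apply, map_add]

lemma toMM_surjective (hr : 1 < r) (hp : p ∣ r) (c0 : ℂ) {c : ℕ → ℂ}
    (hc : ∀ l : ℕ, ¬ p ∣ l → c l = 0) : Function.Surjective (toMM r p n c0 c) := by
  intro m
  obtain ⟨a, rfl⟩ := Submodule.Quotient.mk_surjective _ m
  refine ⟨rho hr hp c0 hc a 1, ?_⟩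
  rw [← smul_toMM, toMM_apply, map_one, ← Submodule.Quotient.mk_smul, smul_eq_mul, mul_one]

/-- The constant polynomial is killed by the Dunkl operators and fixed by the group, hence killed by
the left ideal. Evaluation at it is therefore defined on the quotient and inverts `toMM`. -/
lemma rho_one_of_mem_stdIdeal (hr : 1 < r) (hp : p ∣ r) (c0 : ℂ) {c : ℕ → ℂ}
    (hc : ∀ l : ℕ, ¬ p ∣ l → c l = 0) {a : HH r p n c0 c}
    (ha : a ∈ stdIdeal (G r p n) (1 : ℂ) (param r p n c0 c)) : rho hr hp c0 hc a 1 = 0 := by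
  induction ha using Submodule.span_induction with
  | mem a h =>
    rcases h with ⟨v, rfl⟩ | ⟨w, rfl⟩
    · rw [rho_Y, ← MvPolynomial.C_1, dunklV_C]
    · simp only [map_sub, LinearMap.sub_apply, rho_T, map_one, Module.End.one_apply, sub_self]
  | zero => simp
  | add a b _ _ ha hb => rw [map_add, LinearMap.add_apply, ha, hb, add_zero]
  | smul b a _ ha => rw [smul_eq_mul, map_mul, Module.End.mul_apply, ha, map_zero]

lemma rho_polHom (hr : 1 < r) (hp : p ∣ r) (c0 : ℂ) {c : ℕ → ℂ}
    (hc : ∀ l : ℕ, ¬ p ∣ l → c l = 0) (f g : Pol n) :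
    rho hr hp c0 hc (polHom r p n c0 c f) g = f * g := by
  induction f using Pol.induction with
  | hC a =>
    rw [← MvPolynomial.algebraMap_eq, AlgHom.commutes, AlgHom.commutes,
      Module.algebraMap_end_apply, Algebra.smul_def]
  | hadd f f' hf hf' => rw [map_add, map_add, LinearMap.add_apply, hf, hf', add_mul]
  | hmul i f hf =>
    rw [map_mul, map_mul, Module.End.mul_apply, hf, polHom_px, xi, rho_X, lin_xv, mul_assoc]

/-- The standard module is the polynomial representation. -/
def equivMM (hr : 1 < r) (hp : p ∣ r) (c0 : ℂ) {c : ℕ → ℂ}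
    (hc : ∀ l : ℕ, ¬ p ∣ l → c l = 0) : Pol n ≃ₗ[ℂ] MM r p n c0 c :=
  LinearEquiv.ofBijective (toMM r p n c0 c) ⟨by
    rw [← LinearMap.ker_eq_bot, LinearMap.ker_eq_bot']
    intro f hf
    rw [toMM_apply, Submodule.Quotient.mk_eq_zero] at hf
    have := rho_one_of_mem_stdIdeal hr hp c0 hc hf
    rwa [rho_polHom, mul_one] at this, toMM_surjective hr hp c0 hc⟩

lemma smul_equivMM (hr : 1 < r) (hp : p ∣ r) (c0 : ℂ) {c : ℕ → ℂ}
    (hc : ∀ l : ℕ, ¬ p ∣ l → c l = 0) (a : HH r p n c0 c) (f : Pol n) :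
    a • equivMM hr hp c0 hc f = equivMM hr hp c0 hc (rho hr hp c0 hc a f) :=
  smul_toMM hr hp c0 hc a f

/-- The monomial `x^μ`. -/
def mono {n : ℕ} (μ : Fin n → ℕ) : Pol n := ∏ i, px i ^ μ i

lemma equivMM_mono (hr : 1 < r) (hp : p ∣ r) (c0 : ℂ) {c : ℕ → ℂ}
    (hc : ∀ l : ℕ, ¬ p ∣ l → c l = 0) (μ : Fin n → ℕ) :
    equivMM hr hp c0 hc (mono μ) = mon r p n c0 c μ := by
  change (Submodule.Quotient.mk _ : MM r p n c0 c) = Submodule.Quotient.mk _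
  congr 1
  rw [mono, ← List.prod_ofFn]
  simp only [AlgHom.toLinearMap_apply, map_list_prod, List.map_ofFn]
  congr 2
  ext1 i
  simp [polHom_px]

end Rep

/-! ### The order on exponents -/

section Order

variable {n : ℕ}

/-- `i` comes before `j` in the sorting of `μ` with ties broken from right to left. -/
def Prec (μ : Fin n → ℕ) (i j : Fin n) : Prop := μ i < μ j ∨ (μ i = μ j ∧ j < i)

instance (μ : Fin n → ℕ) (i j : Fin n) : Decidable (Prec μ i j) := by
  unfold Prec; infer_instance

lemma Prec.irrefl (μ : Fin n → ℕ) (i : Fin n) : ¬ Prec μ i i := by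
  simp [Prec]

lemma Prec.trans {μ : Fin n → ℕ} {i j m : Fin n} (h : Prec μ i j) (h' : Prec μ j m) :
    Prec μ i m := by
  unfold Prec at *; omega

lemma Prec.total (μ : Fin n → ℕ) {i j : Fin n} (h : i ≠ j) : Prec μ i j ∨ Prec μ j i := by
  unfold Prec; omega

/-- The position of `i` in the sorting of `μ`. -/
def rk (μ : Fin n → ℕ) (i : Fin n) : ℕ := (Finset.univ.filter fun j => Prec μ j i).card

lemma rk_lt_of_prec {μ : Fin n → ℕ} {i j : Fin n} (h : Prec μ i j) : rk μ i < rk μ j := by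
  refine Finset.card_lt_card ?_
  rw [Finset.ssubset_iff_of_subset fun m hm => ?_]
  · exact ⟨i, by simpa using h, by simpa using Prec.irrefl μ i⟩
  · simp only [Finset.mem_filter, Finset.mem_univ, true_and] at hm ⊢
    exact hm.trans h

lemma rk_lt_iff {μ : Fin n → ℕ} {i j : Fin n} : rk μ i < rk μ j ↔ Prec μ i j := by
  refine ⟨fun h => ?_, rk_lt_of_prec⟩
  rcases eq_or_ne i j with rfl | hij
  · exact absurd h (lt_irrefl _)
  · exact (Prec.total μ hij).resolve_right fun h' => lt_asymm h (rk_lt_of_prec h')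

lemma rk_lt (μ : Fin n → ℕ) (i : Fin n) : rk μ i < n := by
  have : (Finset.univ.filter fun j => Prec μ j i).card < (Finset.univ : Finset (Fin n)).card := by
    refine Finset.card_lt_card ?_
    rw [Finset.ssubset_iff_of_subset (Finset.subset_univ _)]
    exact ⟨i, by simp, by simpa using Prec.irrefl μ i⟩
  simpa [rk] using this

lemma rk_injective (μ : Fin n → ℕ) : Function.Injective (rk μ) := fun i j h => by
  by_contra hij
  rcases Prec.total μ hij with h' | h' <;> have := rk_lt_of_prec h' <;> omega

/-- The sorting permutation of maximal length. -/
def rkPerm (μ : Fin n → ℕ) : Equiv.Perm (Fin n) :=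
  Equiv.ofBijective (fun i => ⟨rk μ i, rk_lt μ i⟩) <| Finite.injective_iff_bijective.1 fun i j h =>
    rk_injective μ (by simpa using h)

lemma rkPerm_val (μ : Fin n → ℕ) (i : Fin n) : (rkPerm μ i : ℕ) = rk μ i := rfl

lemma rkPerm_lt_iff {μ : Fin n → ℕ} {i j : Fin n} : rkPerm μ i < rkPerm μ j ↔ Prec μ i j := by
  rw [Fin.lt_def, rkPerm_val, rkPerm_val, rk_lt_iff]

lemma perm_val_eq_card (w : Equiv.Perm (Fin n)) (a : Fin n) :
    (w a : ℕ) = (Finset.univ.filter fun b => w b < w a).card := by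
  have : (Finset.univ.filter fun b => w b < w a).map w.toEmbedding = Finset.Iio (w a) := by
    ext x
    simp only [Finset.mem_map, Finset.mem_filter, Finset.mem_univ, true_and, Finset.mem_Iio,
      Equiv.coe_toEmbedding]
    constructor
    · rintro ⟨b, hb, rfl⟩; exact hb
    · intro hx; exact ⟨w.symm x, by simpa using hx, by simp⟩
  rw [← Finset.card_map w.toEmbedding, this, Fin.card_Iio]

lemma perm_eq_of_lt_iff {w w' : Equiv.Perm (Fin n)} (h : ∀ a b, w a < w b ↔ w' a < w' b) :
    w = w' := by
  ext a
  rw [perm_val_eq_card, perm_val_eq_card]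
  simp only [h]

lemma monotone_comp_inv_iff {μ : Fin n → ℕ} {w : Equiv.Perm (Fin n)} :
    Monotone (μ ∘ (w⁻¹ : Equiv.Perm (Fin n))) ↔ ∀ a b, w a < w b → μ a ≤ μ b := by
  constructor
  · intro h a b hab
    have := h hab.le
    simpa using this
  · intro h x y hxy
    rcases hxy.eq_or_lt with rfl | hlt
    · exact le_rfl
    · exact h (w⁻¹ x) (w⁻¹ y) (by simpa using hlt)

lemma le_of_rkPerm_lt {μ : Fin n → ℕ} (a b : Fin n) (h : rkPerm μ a < rkPerm μ b) : μ a ≤ μ b := by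
  rw [rkPerm_lt_iff] at h
  unfold Prec at h; omega

/-- A sorting permutation can invert `a < b` only if `μ b ≤ μ a`, and breaking ties from right to
left inverts all such pairs. -/
lemma inversions_subset {μ : Fin n → ℕ} {w : Equiv.Perm (Fin n)}
    (h : ∀ a b, w a < w b → μ a ≤ μ b) :
    (Finset.univ.filter fun q : Fin n × Fin n => q.1 < q.2 ∧ w q.2 < w q.1) ⊆
      Finset.univ.filter fun q : Fin n × Fin n => q.1 < q.2 ∧ rkPerm μ q.2 < rkPerm μ q.1 := by
  intro q hq
  simp only [Finset.mem_filter, Finset.mem_univ, true_and] at hq ⊢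
  refine ⟨hq.1, rkPerm_lt_iff.2 ?_⟩
  have := h _ _ hq.2
  have := hq.1
  unfold Prec; omega

/-- Every sorting permutation has its inversions among those of `rkPerm μ`. Maximal length forces
equality of the inversion sets, and these determine a permutation. -/
lemma isMaxSort_iff {μ : Fin n → ℕ} {v : Equiv.Perm (Fin n)} : IsMaxSort μ v ↔ v = rkPerm μ := by
  have hmax : ∀ w : Equiv.Perm (Fin n), Monotone (μ ∘ (w⁻¹ : Equiv.Perm (Fin n))) →
      len w ≤ len (rkPerm μ) := fun w hw =>
    Finset.card_le_card (inversions_subset (monotone_comp_inv_iff.1 hw))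
  have hmono : Monotone (μ ∘ ((rkPerm μ)⁻¹ : Equiv.Perm (Fin n))) :=
    monotone_comp_inv_iff.2 le_of_rkPerm_lt
  constructor
  · rintro ⟨h1, h2⟩
    have heq := Finset.eq_of_subset_of_card_le (inversions_subset (monotone_comp_inv_iff.1 h1))
      (h2 _ hmono)
    have key : ∀ a b, a < b → (v b < v a ↔ rkPerm μ b < rkPerm μ a) := fun a b hab => by
      have := Finset.ext_iff.1 heq (a, b)
      simpa [hab] using this
    have hne : ∀ (w : Equiv.Perm (Fin n)) {a b}, a ≠ b → (w a < w b ↔ ¬ w b < w a) :=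
      fun w a b hab => by
        have := w.injective.ne hab
        rw [not_lt]
        exact ⟨le_of_lt, fun h => lt_of_le_of_ne h this⟩
    refine perm_eq_of_lt_iff fun a b => ?_
    rcases lt_trichotomy a b with hab | rfl | hab
    · rw [hne v hab.ne, hne _ hab.ne, key a b hab]
    · simp
    · exact key b a hab
  · rintro rfl
    exact ⟨hmono, hmax⟩

/-- Composing with a transposition that removes an inversion shortens a permutation. -/
lemma len_mul_swap_lt {w : Equiv.Perm (Fin n)} {i j : Fin n} (hij : i < j) (hw : w j < w i) :
    len (w * Equiv.swap i j) < len w := by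
  set s := Equiv.swap i j with hs
  have hss : ∀ x, s (s x) = x := fun x => Equiv.swap_apply_self i j x
  -- This injects the inversions of `w * s` into those of `w`: apply `s` to a pair whose order it
  -- keeps and leave the other pairs alone. The inversion `(i, j)` of `w` is missed.
  let φ : Fin n × Fin n → Fin n × Fin n := fun q => if s q.1 < s q.2 then (s q.1, s q.2) else q
  have hsi : s i = j := Equiv.swap_apply_left i j
  have hsj : s j = i := Equiv.swap_apply_right i j
  have hsx : ∀ x, x ≠ i → x ≠ j → s x = x := fun x => Equiv.swap_apply_of_ne_of_ne
  have hcross : ∀ a b, a < b → s b < s a → w (s b) < w (s a) → w b < w a ∧ (a, b) ≠ (i, j) := by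
    intro a b hab h1 h2
    by_cases hai : a = i
    · subst hai
      by_cases hbj : b = j
      · subst hbj
        rw [hsi, hsj] at h2
        exact absurd h2 (lt_asymm hw)
      · rw [hsx b hab.ne' hbj, hsi] at h2
        exact ⟨h2.trans hw, by simp [hbj]⟩
    · by_cases hbj : b = j
      · subst hbj
        by_cases haj : a = b
        · exact absurd haj hab.ne
        · rw [hsx a hai haj, hsj] at h2
          exact ⟨hw.trans h2, by simp [hai]⟩
      · exfalso
        by_cases haj : a = j
        · subst haj
          rw [hsj, hsx b (hij.trans hab).ne' hbj] at h1
          exact lt_asymm h1 (hij.trans hab)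
        · by_cases hbi : b = i
          · subst hbi
            rw [hsi, hsx a hai haj] at h1
            exact lt_asymm h1 (hab.trans hij)
          · rw [hsx a hai haj, hsx b hbi hbj] at h1
            exact lt_asymm h1 hab
  have hinv : ∀ q : Fin n × Fin n, q.1 < q.2 ∧ (w * s) q.2 < (w * s) q.1 →
      (φ q).1 < (φ q).2 ∧ w (φ q).2 < w (φ q).1 ∧ φ q ≠ (i, j) := by
    rintro ⟨a, b⟩ ⟨hab, h⟩
    simp only [φ]
    split_ifs with h1
    · refine ⟨h1, h, fun e => ?_⟩
      simp only [Prod.mk.injEq] at e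
      have h2 : a = j := by rw [← hss a, e.1, hsi]
      have h3 : b = i := by rw [← hss b, e.2, hsj]
      rw [h2, h3] at hab
      exact lt_asymm hab hij
    · have hne : s b ≠ s a := s.injective.ne hab.ne'
      have h1' : s b < s a := lt_of_le_of_ne (not_lt.1 h1) hne
      exact ⟨hab, hcross a b hab h1' h⟩
  have hinj : Set.InjOn φ
      (Finset.univ.filter fun q : Fin n × Fin n => q.1 < q.2 ∧ (w * s) q.2 < (w * s) q.1) := by
    rintro ⟨a, b⟩ hq ⟨a', b'⟩ hq' e
    simp only [Finset.coe_filter, Finset.mem_univ, true_and, Set.mem_ofPred_eq] at hq hq'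
    simp only [φ] at e
    split_ifs at e with h1 h2 h2
    · simp only [Prod.mk.injEq] at e
      rw [s.injective e.1, s.injective e.2]
    · simp only [Prod.mk.injEq] at e
      rw [← e.1, ← e.2, hss, hss] at h2
      exact absurd hq.1 h2
    · simp only [Prod.mk.injEq] at e
      rw [e.1, e.2, hss, hss] at h1
      exact absurd hq'.1 h1
    · exact e
  rw [len, len, ← Finset.card_image_of_injOn hinj]
  refine Finset.card_lt_card ?_
  rw [Finset.ssubset_iff_of_subset]
  · refine ⟨(i, j), by simp [hij, hw], fun h => ?_⟩
    rw [Finset.mem_image] at h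
    obtain ⟨q, hq, e⟩ := h
    simp only [Finset.mem_filter, Finset.mem_univ, true_and] at hq
    exact (hinv q hq).2.2 e
  · intro y hy
    rw [Finset.mem_image] at hy
    obtain ⟨q, hq, rfl⟩ := hy
    simp only [Finset.mem_filter, Finset.mem_univ, true_and] at hq ⊢
    exact ⟨(hinv q hq).1, (hinv q hq).2.1⟩

lemma BruhatLT.len_lt {u v : Equiv.Perm (Fin n)} (h : BruhatLT u v) : len u < len v := by
  induction h with
  | single h => exact h.2
  | tail _ h ih => exact ih.trans h.2

/-- Positions enter `Prec` only between equal values, so it is enough that `s` keeps the order of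
tied positions. -/
lemma rk_comp_equiv {μ : Fin n → ℕ} (s : Equiv.Perm (Fin n))
    (h : ∀ x y, x ≠ y → μ (s x) = μ (s y) → (x < y ↔ s x < s y)) (x : Fin n) :
    rk (μ ∘ s) x = rk μ (s x) := by
  rw [rk, rk, ← Finset.card_map s.toEmbedding]
  congr 1
  ext z
  simp only [Finset.mem_map, Finset.mem_filter, Finset.mem_univ, true_and, Equiv.coe_toEmbedding]
  have key : ∀ y, Prec (μ ∘ s) y x ↔ Prec μ (s y) (s x) := fun y => by
    unfold Prec
    simp only [Function.comp_apply]
    rcases eq_or_ne x y with rfl | hxy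
    · simp
    · by_cases e : μ (s x) = μ (s y)
      · rw [h x y hxy e]
      · have e' : ¬ μ (s y) = μ (s x) := fun h => e h.symm
        simp only [e', false_and, or_false]
  constructor
  · rintro ⟨y, hy, rfl⟩; exact (key y).1 hy
  · intro hz; exact ⟨s.symm z, (key _).2 (by simpa using hz), by simp⟩

lemma rk_comp_swap {μ : Fin n → ℕ} {i j : Fin n} (hij : i < j) (hμ : μ i ≠ μ j)
    (h : ∀ m, i < m → m < j → μ m ≠ μ i ∧ μ m ≠ μ j) (x : Fin n) :
    rk (μ ∘ Equiv.swap i j) x = rk μ (Equiv.swap i j x) := by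
  refine rk_comp_equiv _ (fun x y hxy e => ?_) x
  have hx := h x
  have hy := h y
  by_cases hxi : x = i
  · subst hxi
    rw [Equiv.swap_apply_left] at e ⊢
    by_cases hyj : y = j
    · subst hyj; rw [Equiv.swap_apply_right] at e; exact absurd e.symm hμ
    · rw [Equiv.swap_apply_of_ne_of_ne hxy.symm hyj] at e ⊢
      constructor
      · intro h1
        by_contra h2
        exact (hy h1 (lt_of_le_of_ne (not_lt.1 h2) hyj)).2 e.symm
      · intro h1; exact hij.trans h1
  · by_cases hxj : x = j
    · subst hxj
      rw [Equiv.swap_apply_right] at e ⊢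
      by_cases hyi : y = i
      · subst hyi; rw [Equiv.swap_apply_left] at e; exact absurd e hμ
      · rw [Equiv.swap_apply_of_ne_of_ne hyi hxy.symm] at e ⊢
        constructor
        · intro h1; exact hij.trans h1
        · intro h1
          by_contra h2
          exact (hy h1 (lt_of_le_of_ne (not_lt.1 h2) hxy.symm)).1 e.symm
    · rw [Equiv.swap_apply_of_ne_of_ne hxi hxj] at e ⊢
      by_cases hyi : y = i
      · subst hyi
        rw [Equiv.swap_apply_left] at e ⊢
        constructor
        · intro h1; exact h1.trans hij
        · intro h1
          by_contra h2
          exact (hx (lt_of_le_of_ne (not_lt.1 h2) (Ne.symm hxi)) h1).2 e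
      · by_cases hyj : y = j
        · subst hyj
          rw [Equiv.swap_apply_right] at e ⊢
          constructor
          · intro h1
            by_contra h2
            exact (hx (lt_of_le_of_ne (not_lt.1 h2) (Ne.symm hxi)) h1).1 e
          · intro h1; exact h1.trans hij
        · rw [Equiv.swap_apply_of_ne_of_ne hyi hyj]

/-- Induction on the distance. If no entry strictly between `i` and `j` equals one of the two
exchanged values, no ties are reordered, and `rkPerm` changes by the transposition itself, which
removes an inversion. Otherwise an intermediate entry with one of these values factors the exchange
into two shorter ones. -/
lemma bruhatLT_comp_swap : ∀ (d : ℕ) (μ : Fin n → ℕ) (i j : Fin n), (j : ℕ) - i ≤ d → i < j →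
    μ j < μ i → BruhatLT (rkPerm (μ ∘ Equiv.swap i j)) (rkPerm μ) := by
  intro d
  induction d with
  | zero => intro μ i j h hij; rw [Fin.lt_def] at hij; omega
  | succ d ih =>
    intro μ i j hd hij hμ
    by_cases hm : ∃ m, i < m ∧ m < j ∧ (μ m = μ i ∨ μ m = μ j)
    · obtain ⟨m, him, hmj, hm⟩ := hm
      rw [Fin.lt_def] at hij him hmj
      have hmi : m ≠ i := fun e => by rw [e] at him; omega
      have hmj' : m ≠ j := fun e => by rw [e] at hmj; omega
      have hji : j ≠ i := fun e => by rw [e] at hij; omega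
      rcases hm with hm | hm
      -- Since `μ m = μ i`, the smaller value can travel from `j` to `m` and then from `m` to `i`.
      · have e : μ ∘ Equiv.swap i j = (μ ∘ Equiv.swap m j) ∘ Equiv.swap i m := by
          ext x
          simp only [Function.comp_apply]
          by_cases hx : x = i
          · rw [hx, Equiv.swap_apply_left, Equiv.swap_apply_left, Equiv.swap_apply_left]
          · by_cases hx' : x = m
            · rw [hx', Equiv.swap_apply_of_ne_of_ne hmi hmj', Equiv.swap_apply_right,
                Equiv.swap_apply_of_ne_of_ne hmi.symm hji.symm, hm]
            · rw [Equiv.swap_apply_of_ne_of_ne hx hx']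
              by_cases hx'' : x = j
              · rw [hx'', Equiv.swap_apply_right, Equiv.swap_apply_right, hm]
              · rw [Equiv.swap_apply_of_ne_of_ne hx hx'', Equiv.swap_apply_of_ne_of_ne hx' hx'']
        rw [e]
        refine Relation.TransGen.trans (ih _ _ _ (by omega) him ?_)
          (ih _ _ _ (by omega) hmj (by omega))
        simp only [Function.comp_apply, Equiv.swap_apply_left]
        rwa [Equiv.swap_apply_of_ne_of_ne hmi.symm hji.symm]
      · have e : μ ∘ Equiv.swap i j = (μ ∘ Equiv.swap i m) ∘ Equiv.swap m j := by
          ext x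
          simp only [Function.comp_apply]
          by_cases hx : x = j
          · rw [hx, Equiv.swap_apply_right, Equiv.swap_apply_right, Equiv.swap_apply_right]
          · by_cases hx' : x = m
            · rw [hx', Equiv.swap_apply_of_ne_of_ne hmi hmj', Equiv.swap_apply_left,
                Equiv.swap_apply_of_ne_of_ne hji hmj'.symm, hm]
            · rw [Equiv.swap_apply_of_ne_of_ne hx' hx]
              by_cases hx'' : x = i
              · rw [hx'', Equiv.swap_apply_left, Equiv.swap_apply_left, hm]
              · rw [Equiv.swap_apply_of_ne_of_ne hx'' hx, Equiv.swap_apply_of_ne_of_ne hx'' hx']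
        rw [e]
        refine Relation.TransGen.trans (ih _ _ _ (by omega) hmj ?_)
          (ih _ _ _ (by omega) him (by omega))
        simp only [Function.comp_apply, Equiv.swap_apply_right]
        rwa [Equiv.swap_apply_of_ne_of_ne hji hmj'.symm]
    · push Not at hm
      have e : rkPerm (μ ∘ Equiv.swap i j) = rkPerm μ * Equiv.swap i j := by
        ext x
        rw [rkPerm_val, Equiv.Perm.mul_apply, rkPerm_val]
        exact rk_comp_swap hij hμ.ne' hm x
      refine Relation.TransGen.single ⟨⟨i, j, hij.ne, ?_⟩, ?_⟩
      · rw [e, mul_assoc, Equiv.swap_mul_self, mul_one]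
      · rw [e]
        exact len_mul_swap_lt hij (rkPerm_lt_iff.2 (Or.inl hμ))

end Order

/-! ### Dominance, and well-foundedness of the order on exponents -/

section Dominance

variable {n : ℕ}

lemma DomLE.trans {a b d : Fin n → ℕ} (h : DomLE a b) (h' : DomLE b d) : DomLE a d :=
  ⟨fun m => (h.1 m).trans (h'.1 m), h.2.trans h'.2⟩

lemma DomLE.antisymm {a b : Fin n → ℕ} (h : DomLE a b) (h' : DomLE b a) : a = b := by
  have key : ∀ m : Fin n, a m = b m := by
    intro m
    induction m using WellFoundedLT.induction with
    | ind m ih =>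
      have h1 := le_antisymm (h.1 m) (h'.1 m)
      rw [← Finset.Iio_insert, Finset.sum_insert (by simp), Finset.sum_insert (by simp),
        Finset.sum_congr rfl fun x hx => ih x (Finset.mem_Iio.1 hx)] at h1
      exact Nat.add_right_cancel h1
  exact funext key

/-- The permutation sorting `μ` into non-increasing order. -/
def plusPerm (μ : Fin n → ℕ) : Equiv.Perm (Fin n) := Fin.revPerm.trans (Tuple.sort μ)

lemma plus_eq (μ : Fin n → ℕ) : plus μ = μ ∘ plusPerm μ := rfl

lemma plus_antitone (μ : Fin n → ℕ) : Antitone (plus μ) := fun _ _ hij =>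
  Tuple.monotone_sort μ (Fin.rev_le_rev.2 hij)

lemma sum_plus (μ : Fin n → ℕ) (φ : ℕ → ℕ) : ∑ i, φ (plus μ i) = ∑ i, φ (μ i) := by
  rw [plus_eq]
  exact Equiv.sum_comp (plusPerm μ) fun i => φ (μ i)

/-- Cancel the common indices: those left over in `A` lie beyond `m` and carry values at most `f m`,
those left over in the initial segment carry values at least `f m`, and there are equally many. -/
lemma sum_le_sum_Iic {f : Fin n → ℕ} (hf : Antitone f) (m : Fin n) {A : Finset (Fin n)}
    (hA : A.card = (Finset.Iic m).card) : ∑ i ∈ A, f i ≤ ∑ i ∈ Finset.Iic m, f i := by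
  classical
  rw [← Finset.sum_inter_add_sum_sdiff A (Finset.Iic m) f,
    ← Finset.sum_inter_add_sum_sdiff (Finset.Iic m) A f, Finset.inter_comm]
  refine Nat.add_le_add_left ?_ _
  have hcard : (A \ Finset.Iic m).card = (Finset.Iic m \ A).card := by
    have h1 := Finset.card_sdiff_add_card_inter A (Finset.Iic m)
    have h2 := Finset.card_sdiff_add_card_inter (Finset.Iic m) A
    rw [Finset.inter_comm] at h2
    omega
  calc ∑ i ∈ A \ Finset.Iic m, f i ≤ (A \ Finset.Iic m).card • f m :=
        Finset.sum_le_card_nsmul _ _ _ fun i hi => hf (by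
          simp only [Finset.mem_sdiff, Finset.mem_Iic, not_le] at hi; exact hi.2.le)
    _ = (Finset.Iic m \ A).card • f m := by rw [hcard]
    _ ≤ _ := Finset.card_nsmul_le_sum _ _ _ fun i hi => hf (by
          simp only [Finset.mem_sdiff, Finset.mem_Iic] at hi; exact hi.1)

lemma sum_le_sum_plus (μ : Fin n → ℕ) (m : Fin n) {A : Finset (Fin n)}
    (hA : A.card = (Finset.Iic m).card) : ∑ i ∈ A, μ i ≤ ∑ i ∈ Finset.Iic m, plus μ i := by
  have := sum_le_sum_Iic (plus_antitone μ) m (A := A.map (plusPerm μ).symm.toEmbedding)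
    (by rw [Finset.card_map, hA])
  rw [Finset.sum_map] at this
  simpa [plus_eq] using this

/-- A partial sum of the sorted exponent is the largest sum over subsets of that size, so dominance
can be tested on subsets without sorting anything. -/
lemma domLE_plus {ν μ : Fin n → ℕ} (hsum : ∑ i, ν i = ∑ i, μ i)
    (h : ∀ A : Finset (Fin n), ∃ B : Finset (Fin n), B.card = A.card ∧
      ∑ i ∈ A, ν i ≤ ∑ i ∈ B, μ i) : DomLE (plus ν) (plus μ) := by
  refine ⟨fun m => ?_, (sum_plus ν id).trans (hsum.trans (sum_plus μ id).symm)⟩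
  obtain ⟨B, hB, hle⟩ := h ((Finset.Iic m).map (plusPerm ν).toEmbedding)
  rw [Finset.card_map] at hB
  rw [Finset.sum_map] at hle
  exact hle.trans (sum_le_sum_plus μ m hB)

lemma plus_comp_equiv (μ : Fin n → ℕ) (s : Equiv.Perm (Fin n)) : plus (μ ∘ s) = plus μ := by
  refine DomLE.antisymm (domLE_plus (Equiv.sum_comp s μ) fun A => ⟨A.map s.toEmbedding, by simp, ?_⟩)
    (domLE_plus (Equiv.sum_comp s μ).symm fun A => ⟨A.map s.symm.toEmbedding, by simp, ?_⟩)
  · simp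
  · simp

/-- Move `t` units from the entry `i` to the entry `j`. -/
def shift (μ : Fin n → ℕ) (i j : Fin n) (t : ℕ) : Fin n → ℕ :=
  Function.update (Function.update μ i (μ i - t)) j (μ j + t)

lemma shift_apply {μ : Fin n → ℕ} {i j : Fin n} (t : ℕ) (x : Fin n) :
    shift μ i j t x = if x = j then μ j + t else if x = i then μ i - t else μ x := by
  simp [shift, Function.update_apply]

/-- Applied to the identity this shows that the degree is unchanged; applied to the square it gives
strictness in `expLT_shift`. -/
lemma sum_shift {M : Type*} [AddCommMonoid M] (φ : ℕ → M) (μ : Fin n → ℕ) {i j : Fin n}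
    (hij : j ≠ i) (t : ℕ) : ∃ R : M, ∑ x, φ (μ x) = φ (μ i) + (φ (μ j) + R) ∧
      ∑ x, φ (shift μ i j t x) = φ (μ i - t) + (φ (μ j + t) + R) := by
  have hj : j ∈ Finset.univ.erase i := by simp [hij]
  refine ⟨∑ x ∈ (Finset.univ.erase i).erase j, φ (μ x), ?_, ?_⟩
  · rw [Finset.add_sum_erase _ (fun x => φ (μ x)) hj,
      Finset.add_sum_erase _ (fun x => φ (μ x)) (Finset.mem_univ i)]
  · rw [← Finset.add_sum_erase _ _ (Finset.mem_univ i), ← Finset.add_sum_erase _ _ hj,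
      Finset.sum_congr (g := fun x => φ (μ x)) rfl fun x hx => ?_]
    · simp [shift_apply, hij.symm]
    · simp only [Finset.mem_erase] at hx
      simp [shift_apply, hx.1, hx.2.1]

/-- The new values at `i` and `j` lie strictly between the old ones and have the same sum, so the
exponent goes down in dominance, strictly because the sum of squares drops. -/
lemma expLT_shift {μ : Fin n → ℕ} {i j : Fin n} (hij : j ≠ i) {t : ℕ} (h0 : 0 < t)
    (ht : μ j + t < μ i) : ExpLT (shift μ i j t) μ := by
  have hsum : ∑ x, shift μ i j t x = ∑ x, μ x := by
    obtain ⟨R, h1, h2⟩ := sum_shift id μ hij t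
    simp only [id_eq] at h1 h2
    omega
  left
  refine ⟨domLE_plus hsum fun A => ?_, fun e => ?_⟩
  · by_cases hA : j ∈ A ∧ i ∉ A
    -- Trading `j` for `i` compensates the gain at `j`, since `μ j + t` is still below `μ i`.
    · refine ⟨A.map (Equiv.swap i j).toEmbedding, by simp, ?_⟩
      rw [Finset.sum_map]
      refine Finset.sum_le_sum fun x hx => ?_
      have hxi : x ≠ i := fun e => hA.2 (e ▸ hx)
      rw [shift_apply, if_neg hxi]
      split_ifs with hxj
      · subst hxj; simp; omega
      · simp [Equiv.swap_apply_of_ne_of_ne hxi hxj]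
    · refine ⟨A, rfl, ?_⟩
      by_cases hj : j ∈ A
      · have hi : i ∈ A := by tauto
        have hj' : j ∈ A.erase i := by simp [hij, hj]
        rw [← Finset.add_sum_erase _ _ hi, ← Finset.add_sum_erase _ _ hj',
          ← Finset.add_sum_erase _ μ hi, ← Finset.add_sum_erase _ μ hj',
          Finset.sum_congr (g := μ) rfl fun x hx => ?_]
        rotate_left
        · simp only [Finset.mem_erase] at hx
          rw [shift_apply, if_neg hx.1, if_neg hx.2.1]
        · rw [shift_apply, shift_apply, if_neg hij.symm, if_pos rfl, if_pos rfl]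
          have : μ i - t + (μ j + t) = μ i + μ j := by omega
          exact (by rw [← add_assoc, this, add_assoc] : _ = _).le
      · refine Finset.sum_le_sum fun x hx => ?_
        have hxj : x ≠ j := fun e => hj (e ▸ hx)
        rw [shift_apply, if_neg hxj]
        split_ifs with h
        · subst h; omega
        · exact le_rfl
  · have h1 := sum_plus (shift μ i j t) fun x => x ^ 2
    rw [e, sum_plus μ fun x => x ^ 2] at h1
    obtain ⟨R, h2, h3⟩ := sum_shift (fun x => x ^ 2) μ hij t
    rw [h2, h3] at h1
    obtain ⟨d, hd⟩ : ∃ d, μ i = μ j + t + d + 1 := ⟨μ i - (μ j + t + 1), by omega⟩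
    rw [hd, show μ j + t + d + 1 - t = μ j + d + 1 by omega] at h1
    nlinarith

lemma expLT_swap {μ : Fin n → ℕ} {i j : Fin n} (hij : i < j) (h : μ j < μ i) :
    ExpLT (μ ∘ Equiv.swap i j) μ :=
  Or.inr ⟨plus_comp_equiv μ _, _, _, isMaxSort_iff.2 rfl, isMaxSort_iff.2 rfl,
    bruhatLT_comp_swap _ μ i j le_rfl hij h⟩

lemma ExpLT.irrefl (μ : Fin n → ℕ) : ¬ ExpLT μ μ := by
  rintro (h | ⟨-, u, v, hu, hv, h⟩)
  · exact h.2 rfl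
  · rw [isMaxSort_iff] at hu hv
    subst hu hv
    exact lt_irrefl _ h.len_lt

lemma ExpLT.trans {ν μ l : Fin n → ℕ} (h : ExpLT ν μ) (h' : ExpLT μ l) : ExpLT ν l := by
  rcases h with ⟨h1, h2⟩ | ⟨h1, u, v, hu, hv, h2⟩ <;>
    rcases h' with ⟨h1', h2'⟩ | ⟨h1', u', v', hu', hv', h2'⟩
  · refine Or.inl ⟨h1.trans h1', fun e => h2 ?_⟩
    exact h1.antisymm (e ▸ h1')
  · exact Or.inl ⟨h1' ▸ h1, h1' ▸ h2⟩
  · exact Or.inl ⟨h1 ▸ h1', h1 ▸ h2'⟩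
  · rw [isMaxSort_iff] at hv hu'
    subst hv hu'
    exact Or.inr ⟨h1.trans h1', u, v', hu, hv', Relation.TransGen.trans h2 h2'⟩

lemma ExpLT.sum_eq {ν μ : Fin n → ℕ} (h : ExpLT ν μ) : ∑ i, ν i = ∑ i, μ i := by
  have h1 : ∑ i, plus ν i = ∑ i, plus μ i := by
    rcases h with h | h
    · exact h.1.2
    · rw [h.1]
  exact (sum_plus ν id).symm.trans (h1.trans (sum_plus μ id))

lemma finite_sum_eq (n d : ℕ) : Finite {μ : Fin n → ℕ // ∑ i, μ i = d} := by
  have : {μ : Fin n → ℕ | ∑ i, μ i = d} ⊆ ↑(Finset.Iic fun _ : Fin n => d) := fun μ hμ => by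
    simp only [Finset.coe_Iic, Set.mem_Iic]
    intro i
    rw [← show ∑ i, μ i = d from hμ]
    exact Finset.single_le_sum (fun _ _ => Nat.zero_le _) (Finset.mem_univ i)
  exact ((Finset.finite_toSet _).subset this).to_subtype

/-- Comparable exponents have equal degree, and there are finitely many of each degree, so
transitivity and irreflexivity suffice. -/
lemma ExpLT.wellFounded (n : ℕ) : WellFounded (ExpLT (n := n)) := by
  refine ⟨fun μ => ?_⟩
  have := finite_sum_eq n (∑ i, μ i)
  let R : {ν : Fin n → ℕ // ∑ i, ν i = ∑ i, μ i} → {ν : Fin n → ℕ // ∑ i, ν i = ∑ i, μ i} → Prop :=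
    fun a b => ExpLT a.1 b.1
  have : IsTrans _ R := ⟨fun _ _ _ => ExpLT.trans⟩
  have : Std.Irrefl R := ⟨fun a => ExpLT.irrefl a.1⟩
  have hwf : WellFounded R := Finite.wellFounded_of_trans_of_irrefl R
  have key : ∀ a, Acc R a → Acc ExpLT a.1 := by
    intro a ha
    induction ha with
    | intro a _ ih =>
      exact ⟨_, fun ν hν => ih ⟨ν, hν.sum_eq.trans a.2⟩ hν⟩
  exact key ⟨μ, rfl⟩ (hwf.apply _)

end Dominance

/-! ### Triangularity of the operators `z_i` -/

section Triangular

variable {n : ℕ}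

lemma mono_eq_monomial (μ : Fin n → ℕ) :
    mono μ = MvPolynomial.monomial (Finsupp.equivFunOnFinite.symm μ) (1 : ℂ) := by
  rw [MvPolynomial.monomial_eq, Finsupp.prod_fintype _ _ (by simp)]
  simp [mono]

/-- The basis of monomials. -/
def monoBasis (n : ℕ) : Module.Basis (Fin n → ℕ) ℂ (Pol n) :=
  (MvPolynomial.basisMonomials (Fin n) ℂ).reindex Finsupp.equivFunOnFinite

@[simp] lemma monoBasis_apply (μ : Fin n → ℕ) : monoBasis n μ = mono μ := by
  rw [monoBasis, Module.Basis.reindex_apply, MvPolynomial.coe_basisMonomials, mono_eq_monomial]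

/-- The span of the monomials below `x^μ`. -/
def lower (μ : Fin n → ℕ) : Submodule ℂ (Pol n) := Submodule.span ℂ (mono '' {ν | ExpLT ν μ})

lemma mono_mem_lower {ν μ : Fin n → ℕ} (h : ExpLT ν μ) : mono ν ∈ lower μ :=
  Submodule.subset_span ⟨ν, h, rfl⟩

lemma act_smul_px {g : V n ≃ₗ[ℂ] V n} {a : ℂ} {i j : Fin n} (h : dualAct g (xv i) = a • xv j) :
    act g (px i) = a • px j := by
  rw [act_px, h, map_smul, lin_xv]

lemma act_mono_of_monomial {g : V n ≃ₗ[ℂ] V n} {a : Fin n → ℂ} {σ : Equiv.Perm (Fin n)}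
    (h : ∀ i, dualAct g (xv i) = a i • xv (σ i)) (μ : Fin n → ℕ) :
    act g (mono μ) = (∏ i, a i ^ μ i) • mono (μ ∘ σ.symm) := by
  rw [mono, map_prod]
  have e : mono (μ ∘ σ.symm) = ∏ i, px (σ i) ^ μ i := by
    rw [mono, ← Equiv.prod_comp σ]
    simp only [Function.comp_apply, Equiv.symm_apply_apply]
  rw [e]
  simp only [map_pow, act_smul_px (h _), smul_pow]
  rw [Finset.prod_smul]

lemma dualAct_dg (a : Fin n → ℂˣ) (m : Fin n) :
    dualAct (dg a) (xv m) = ((a m : ℂ)⁻¹) • xv m := by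
  ext v
  rw [LinearMap.comp_apply, LinearMap.comp_apply, dualAct_apply, dg_inv]
  simp [xv, dg_apply]

lemma act_dg_mono (a : Fin n → ℂˣ) (μ : Fin n → ℕ) :
    act (dg a) (mono μ) = (∏ i, ((a i : ℂ)⁻¹) ^ μ i) • mono μ :=
  act_mono_of_monomial (σ := 1) (dualAct_dg a) μ

lemma act_zt_mono (r : ℕ) (i : Fin n) (l : ℕ) (μ : Fin n → ℕ) :
    act (zt r i ^ l) (mono μ) = (((zeta r : ℂ) ^ l)⁻¹) ^ μ i • mono μ := by
  rw [zt, dg_pow, act_dg_mono, Finset.prod_eq_single i]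
  · simp
  · intro m _ hm
    simp [Pi.mulSingle_eq_of_ne hm]
  · simp

lemma act_rf_mono (r : ℕ) {i j : Fin n} (hij : j ≠ i) (l : ℕ) (μ : Fin n → ℕ) :
    act (rf r i j l) (mono μ) =
      (((zeta r : ℂ) ^ l) ^ μ i * (((zeta r : ℂ) ^ l)⁻¹) ^ μ j) • mono (μ ∘ Equiv.swap i j) := by
  have h : ∀ m, dualAct (rf r i j l) (xv m) = (if m = i then (zeta r : ℂ) ^ l else
      if m = j then ((zeta r : ℂ) ^ l)⁻¹ else 1) • xv (Equiv.swap i j m) := fun m => by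
    rw [dualAct_rf r hij]
    split_ifs with h1 h2
    · rw [h1, Equiv.swap_apply_left]
    · rw [h2, Equiv.swap_apply_right]
    · rw [Equiv.swap_apply_of_ne_of_ne h1 h2, one_smul]
  rw [act_mono_of_monomial h, Equiv.symm_swap]
  congr 1
  rw [← Finset.mul_prod_erase _ _ (Finset.mem_univ i),
    ← Finset.mul_prod_erase _ _ (show j ∈ Finset.univ.erase i by simp [hij]),
    Finset.prod_eq_one fun x hx => ?_]
  · simp [hij]
  · simp only [Finset.mem_erase] at hx
    simp [hx.1, hx.2.1]

/-- The part of a monomial without `x_i` and `x_j`. -/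
def monoRest (i j : Fin n) (μ : Fin n → ℕ) : Pol n :=
  ∏ x ∈ (Finset.univ.erase i).erase j, px x ^ μ x

lemma mono_split {i j : Fin n} (hij : j ≠ i) {μ ν : Fin n → ℕ}
    (h : ∀ x, x ≠ i → x ≠ j → ν x = μ x) :
    mono ν = px i ^ ν i * px j ^ ν j * monoRest i j μ := by
  rw [mono, ← Finset.mul_prod_erase _ _ (Finset.mem_univ i),
    ← Finset.mul_prod_erase _ _ (show j ∈ Finset.univ.erase i by simp [hij]), mul_assoc, monoRest,
    Finset.prod_congr rfl fun x hx => ?_]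
  simp only [Finset.mem_erase] at hx
  rw [h x hx.2.1 hx.1]

lemma sub_mul_geom {R : Type*} [CommRing R] (x y : R) (d : ℕ) :
    (x - y) * ∑ t ∈ Finset.range d, y ^ t * x ^ (d - 1 - t) = x ^ d - y ^ d := by
  have := geom_sum₂_mul y x d
  linear_combination -this

lemma ddiff_eq {g : V n ≃ₗ[ℂ] V n} {α : Pol n} (hα : α ≠ 0) {q : Fin n → ℂ}
    (h : ∀ m, px m - act g (px m) = q m • α) {f u : Pol n} (hu : α * u = f - act g f) :
    ddiff g α f = u :=
  mul_left_cancel₀ hα ((ddiff_spec hα h f).trans hu.symm)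

lemma ddiff_zt_mono (r : ℕ) (i : Fin n) (l : ℕ) (μ : Fin n → ℕ) :
    ddiff (zt r i ^ l) (px i) (px i * mono μ) =
      (1 - (((zeta r : ℂ) ^ l)⁻¹) ^ (μ i + 1)) • mono μ := by
  refine ddiff_eq (px_ne_zero i) (px_sub_act_zt r i l) ?_
  rw [map_mul, act_zt_mono, act_px, dualAct_zt, if_pos rfl, map_smul, lin_xv, pow_succ]
  simp only [MvPolynomial.smul_eq_C_mul, map_sub, map_mul, map_one, map_pow]
  ring

/-- With `(x_i x_j) ^ μ j` factored out, what remains is a difference of `(μ i + 1 - μ j)`-th powers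
of `x_i` and `ζ^l x_j`, whose quotient is a geometric sum. -/
lemma ddiff_rf_mono_of_le (r : ℕ) {i j : Fin n} (hij : j ≠ i) (l : ℕ) {μ : Fin n → ℕ}
    (h : μ j ≤ μ i) :
    ddiff (rf r i j l) (px i - (zeta r : ℂ) ^ l • px j) (px i * mono μ) =
      ∑ t ∈ Finset.range (μ i + 1 - μ j), (((zeta r : ℂ) ^ l) ^ t) • mono (shift μ i j t) := by
  refine ddiff_eq (px_sub_ne_zero hij _) (px_sub_act_rf r hij l) ?_
  obtain ⟨d, hd⟩ := Nat.exists_eq_add_of_le h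
  have e1 : ∀ t ∈ Finset.range (μ i + 1 - μ j), (((zeta r : ℂ) ^ l) ^ t) • mono (shift μ i j t) =
      px i ^ μ j * px j ^ μ j * monoRest i j μ *
        (((zeta r : ℂ) ^ l • px j) ^ t * px i ^ (d + 1 - 1 - t)) := by
    intro t ht
    rw [Finset.mem_range] at ht
    rw [mono_split hij (μ := μ) (ν := shift μ i j t) fun x hx hx' => by simp [shift_apply, hx, hx']]
    rw [shift_apply, shift_apply, if_neg hij.symm, if_pos rfl, if_pos rfl,
      show μ i - t = μ j + (d + 1 - 1 - t) by omega]
    simp only [MvPolynomial.smul_eq_C_mul, map_pow]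
    ring
  rw [Finset.sum_congr rfl e1, ← Finset.mul_sum, mul_left_comm,
    show μ i + 1 - μ j = d + 1 by omega, sub_mul_geom, map_mul, act_rf_mono r hij,
    mono_split hij (μ := μ) (ν := μ) (by simp), mono_split hij (μ := μ) (ν := μ ∘ Equiv.swap i j)
      fun x hx hx' => by simp [Equiv.swap_apply_of_ne_of_ne hx hx'], act_px, dualAct_rf r hij,
    if_pos rfl, map_smul, lin_xv]
  have h1 : (MvPolynomial.C (((zeta r : ℂ) ^ l)⁻¹) : Pol n) ^ μ j *
      (MvPolynomial.C ((zeta r : ℂ) ^ l)) ^ μ j = 1 := by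
    rw [← mul_pow, ← map_mul, inv_mul_cancel₀ (pow_ne_zero _ (zeta_ne_zero r)), map_one, one_pow]
  simp only [Function.comp_apply, Equiv.swap_apply_left, Equiv.swap_apply_right,
    MvPolynomial.smul_eq_C_mul, map_mul, map_pow] at h1 ⊢
  rw [hd]
  linear_combination (-(monoRest i j μ) * px i ^ μ j * px j ^ (μ j + d + 1) *
    (MvPolynomial.C (zeta r : ℂ) ^ l) ^ (d + 1)) * (-h1)

/-- Now `x_j` has the higher power after multiplication by `x_i`, or the powers are equal and the
sum is empty. The common factor is `(x_i x_j) ^ (μ i + 1)`, and the geometric sum appears with a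
minus sign. -/
lemma ddiff_rf_mono_of_lt (r : ℕ) {i j : Fin n} (hij : j ≠ i) (l : ℕ) {μ : Fin n → ℕ}
    (h : μ i < μ j) :
    ddiff (rf r i j l) (px i - (zeta r : ℂ) ^ l • px j) (px i * mono μ) =
      ∑ t ∈ Finset.range (μ j - (μ i + 1)), (-((((zeta r : ℂ) ^ l)⁻¹) ^ (μ j - (μ i + 1)) *
        ((zeta r : ℂ) ^ l) ^ t)) • mono (shift μ j i (μ j - (μ i + 1) - t)) := by
  refine ddiff_eq (px_sub_ne_zero hij _) (px_sub_act_rf r hij l) ?_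
  obtain ⟨d, hd⟩ : ∃ d, μ j = μ i + 1 + d := Nat.exists_eq_add_of_le h
  have hd' : μ j - (μ i + 1) = d := by omega
  rw [hd']
  have e1 : ∀ t ∈ Finset.range d, (-((((zeta r : ℂ) ^ l)⁻¹) ^ d *
        ((zeta r : ℂ) ^ l) ^ t)) • mono (shift μ j i (d - t)) =
      -(MvPolynomial.C (((zeta r : ℂ) ^ l)⁻¹)) ^ d * px i ^ (μ i + 1) * px j ^ (μ i + 1) *
        monoRest i j μ * (((zeta r : ℂ) ^ l • px j) ^ t * px i ^ (d - 1 - t)) := by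
    intro t ht
    rw [Finset.mem_range] at ht
    rw [mono_split hij (μ := μ) (ν := shift μ j i (d - t)) fun x hx hx' => by
      simp [shift_apply, hx, hx']]
    rw [shift_apply, shift_apply, if_neg hij, if_pos rfl, if_pos rfl,
      show μ j - (d - t) = μ i + 1 + t by omega, show μ i + (d - t) = μ i + 1 + (d - 1 - t) by omega]
    simp only [MvPolynomial.smul_eq_C_mul, map_pow, map_neg, map_mul]
    ring
  rw [Finset.sum_congr rfl e1, ← Finset.mul_sum, mul_left_comm, sub_mul_geom, map_mul,
    act_rf_mono r hij,
    mono_split hij (μ := μ) (ν := μ) (by simp), mono_split hij (μ := μ) (ν := μ ∘ Equiv.swap i j)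
      fun x hx hx' => by simp [Equiv.swap_apply_of_ne_of_ne hx hx'], act_px, dualAct_rf r hij,
    if_pos rfl, map_smul, lin_xv]
  have h1 : ∀ k, (MvPolynomial.C (((zeta r : ℂ) ^ l)⁻¹) : Pol n) ^ k *
      (MvPolynomial.C ((zeta r : ℂ) ^ l)) ^ k = 1 := fun k => by
    rw [← mul_pow, ← map_mul, inv_mul_cancel₀ (pow_ne_zero _ (zeta_ne_zero r)), map_one, one_pow]
  have h2 := h1 d
  have h3 := h1 (μ i + 1)
  simp only [Function.comp_apply, Equiv.swap_apply_left, Equiv.swap_apply_right,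
    MvPolynomial.smul_eq_C_mul, map_mul, map_pow] at h2 h3 ⊢
  rw [hd]
  linear_combination (monoRest i j μ * px i ^ (μ i + 1) * px j ^ (μ i + 1 + d)) * h2 +
    (monoRest i j μ * px i ^ (μ i + 1 + d) * px j ^ (μ i + 1) *
      (MvPolynomial.C (((zeta r : ℂ) ^ l)⁻¹)) ^ d) * h3

/-- The leading terms of a divided difference, corrected by the reflection when `j < i`. -/
lemma ddiff_rf_mono_sub_mem (r : ℕ) {i j : Fin n} (hij : j ≠ i) (l : ℕ) (μ : Fin n → ℕ) :
    ddiff (rf r i j l) (px i - (zeta r : ℂ) ^ l • px j) (px i * mono μ) -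
      (if j < i then act (rf r i j l) (mono μ) else 0) -
      (if Prec μ j i then mono μ else 0) ∈ lower μ := by
  rcases lt_or_ge (μ i) (μ j) with h | h
  -- All shifts occurring here are strictly inside, and the reflected monomial subtracted for `j <
  -- i` is lower because it removes an inversion.
  · have hP : ¬ Prec μ j i := by unfold Prec; omega
    rw [if_neg hP, sub_zero, ddiff_rf_mono_of_lt r hij l h]
    refine sub_mem (Submodule.sum_mem _ fun t ht => Submodule.smul_mem _ _ (mono_mem_lower ?_)) ?_
    · rw [Finset.mem_range] at ht
      exact expLT_shift hij.symm (by omega) (by omega)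
    · split_ifs with hlt
      · rw [act_rf_mono r hij, Equiv.swap_comm]
        exact Submodule.smul_mem _ _ (mono_mem_lower (expLT_swap hlt h))
      · exact zero_mem _
  · rw [ddiff_rf_mono_of_le r hij l h]
    rcases h.eq_or_lt with h' | h'
    -- In a tie the divided difference is `x^μ` itself. It is cancelled by the reflection when `j <
    -- i` and counted in the rank when `i < j`, which is why ties are broken from right to left.
    · have hsw : μ ∘ Equiv.swap i j = μ := by
        ext x
        simp only [Function.comp_apply, Equiv.swap_apply_def]
        split_ifs with h1 h2
        · rw [h1, h']
        · rw [h2, h']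
        · rfl
      have hw : ((zeta r : ℂ) ^ l) ≠ 0 := pow_ne_zero _ (zeta_ne_zero r)
      have hsh : shift μ i j 0 = μ := by
        ext x; simp [shift_apply]; split_ifs with h1 h2 <;> simp [*]
      rw [act_rf_mono r hij, hsw, h', ← mul_pow, mul_inv_cancel₀ hw, one_pow, one_smul,
        show μ i + 1 - μ i = 1 by omega]
      simp only [Finset.range_one, Finset.sum_singleton, hsh, pow_zero, one_smul]
      rcases lt_or_gt_of_ne hij with hlt | hlt
      · have hP : ¬ Prec μ j i := by unfold Prec; omega
        rw [if_pos hlt, if_neg hP]; simp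
      · have hP : Prec μ j i := by unfold Prec; omega
        rw [if_neg (by omega), if_pos hP]; simp
    -- The first term of the geometric sum is `x^μ`, the last one is the reflected monomial, and
    -- those in between are strictly inside. The reflected monomial is cancelled when `j < i` and is
    -- lower when `i < j`.
    · have hP : Prec μ j i := Or.inl h'
      have hsh : shift μ i j 0 = μ := by
        ext x; simp [shift_apply]; split_ifs with h1 h2 <;> simp [*]
      have hsw : shift μ i j (μ i - μ j) = μ ∘ Equiv.swap i j := by
        ext x
        rw [shift_apply, Function.comp_apply, Equiv.swap_apply_def]
        split_ifs with h1 h2 h2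
        · exact absurd (h1.symm.trans h2) hij
        · omega
        · omega
        · rfl
      have hw : ((zeta r : ℂ) ^ l) ≠ 0 := pow_ne_zero _ (zeta_ne_zero r)
      have hact : act (rf r i j l) (mono μ) =
          ((zeta r : ℂ) ^ l) ^ (μ i - μ j) • mono (shift μ i j (μ i - μ j)) := by
        rw [act_rf_mono r hij, hsw, pow_sub₀ _ hw h, inv_pow]
      obtain ⟨d, hd⟩ : ∃ d, μ i = μ j + (d + 1) := ⟨μ i - μ j - 1, by omega⟩
      rw [if_pos hP, show μ i + 1 - μ j = d + 1 + 1 by omega, Finset.sum_range_succ,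
        Finset.sum_range_succ', show d + 1 = μ i - μ j by omega, ← hact, hsh, pow_zero, one_smul]
      have key : ∑ t ∈ Finset.range d, ((zeta r : ℂ) ^ l) ^ (t + 1) • mono (shift μ i j (t + 1)) ∈
          lower μ := by
        refine Submodule.sum_mem _ fun t ht => Submodule.smul_mem _ _ (mono_mem_lower ?_)
        rw [Finset.mem_range] at ht
        exact expLT_shift hij (by omega) (by omega)
      split_ifs with hlt
      · convert key using 1; abel
      · have hact' : act (rf r i j l) (mono μ) ∈ lower μ := by
          rw [act_rf_mono r hij]
          exact Submodule.smul_mem _ _ (mono_mem_lower (expLT_swap (by omega) h'))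
        convert add_mem key hact' using 1; abel

/-- The operator `z_i` on polynomials. -/
def zOp (r : ℕ) (c0 : ℂ) (c : ℕ → ℂ) (i : Fin n) : Pol n →ₗ[ℂ] Pol n :=
  dunkl r c0 c i ∘ₗ LinearMap.mulLeft ℂ (px i) +
    c0 • ∑ j ∈ Finset.Iio i, ∑ l ∈ Finset.range r, (act (rf r i j l)).toLinearMap

lemma zOp_apply (r : ℕ) (c0 : ℂ) (c : ℕ → ℂ) (i : Fin n) (f : Pol n) :
    zOp r c0 c i f = dunkl r c0 c i (px i * f) +
      c0 • ∑ j ∈ Finset.Iio i, ∑ l ∈ Finset.range r, act (rf r i j l) f := by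
  simp [zOp, LinearMap.sum_apply]

/-- The eigenvalue of `z_i` attached to `μ`. -/
def wtz (r : ℕ) (c0 : ℂ) (c : ℕ → ℂ) (μ : Fin n → ℕ) (i : Fin n) : ℂ :=
  (μ i : ℂ) + 1 - (dpar r c 0 - dpar r c (-((μ i : ℤ) + 1))) - r * c0 * rk μ i

lemma dpar_sub (r : ℕ) (c : ℕ → ℂ) (m : ℕ) : dpar r c 0 - dpar r c (-((m : ℤ) + 1)) =
    ∑ l ∈ Finset.Ico 1 r, c l * (1 - (((zeta r : ℂ) ^ l)⁻¹) ^ (m + 1)) := by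
  rw [dpar, dpar, ← Finset.sum_sub_distrib]
  refine Finset.sum_congr rfl fun l _ => ?_
  have : (zeta r : ℂ) ^ ((l : ℤ) * -((m : ℤ) + 1)) = (((zeta r : ℂ) ^ l)⁻¹) ^ (m + 1) := by
    rw [zpow_mul, zpow_natCast, zpow_neg, ← inv_zpow]
    exact_mod_cast zpow_natCast (((zeta r : ℂ) ^ l)⁻¹) (m + 1)
  rw [this, mul_zero, zpow_zero]
  ring

/-- The derivative and the reflections `ζ_i^l` act diagonally. Modulo lower terms, the reflections
involving `j`, after the correction by `φ_i`, contribute `r c_0` exactly when `j` precedes `i`; the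
count of such `j` is the rank. -/
lemma zOp_mono_sub_mem (r : ℕ) (c0 : ℂ) (c : ℕ → ℂ) (i : Fin n) (μ : Fin n → ℕ) :
    zOp r c0 c i (mono μ) - wtz r c0 c μ i • mono μ ∈ lower μ := by
  have h1 : MvPolynomial.pderiv i (px i * mono μ) = ((μ i : ℂ) + 1) • mono μ := by
    have e : px i * mono μ = MvPolynomial.monomial
        (Finsupp.single i 1 + Finsupp.equivFunOnFinite.symm μ) (1 : ℂ) := by
      rw [mono_eq_monomial, px, MvPolynomial.X, MvPolynomial.monomial_mul, one_mul]
    rw [e, MvPolynomial.pderiv_monomial, mono_eq_monomial, MvPolynomial.smul_monomial]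
    simp [add_comm]
  have h2 : ∑ l ∈ Finset.Ico 1 r, c l • ddiff (zt r i ^ l) (px i) (px i * mono μ) =
      (dpar r c 0 - dpar r c (-((μ i : ℤ) + 1))) • mono μ := by
    rw [dpar_sub, Finset.sum_smul]
    exact Finset.sum_congr rfl fun l _ => by rw [ddiff_zt_mono, smul_smul]
  have h3 : ∑ j ∈ Finset.Iio i, ∑ l ∈ Finset.range r, act (rf r i j l) (mono μ) =
      ∑ j ∈ Finset.univ.erase i, ∑ l ∈ Finset.range r,
        if j < i then act (rf r i j l) (mono μ) else 0 := by
    refine (Finset.sum_congr rfl fun j hj => Finset.sum_congr rfl fun l _ => ?_).trans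
      (Finset.sum_subset (fun x hx => ?_) ?_)
    · rw [if_pos (Finset.mem_Iio.1 hj)]
    · simpa using (Finset.mem_Iio.1 hx).ne
    · intro j _ hj
      refine Finset.sum_eq_zero fun l _ => if_neg ?_
      simpa using hj
  have h4 : ((r : ℂ) * rk μ i) • mono μ = ∑ j ∈ Finset.univ.erase i, ∑ l ∈ Finset.range r,
      if Prec μ j i then mono μ else 0 := by
    have : Finset.univ.filter (fun j => Prec μ j i) =
        (Finset.univ.erase i).filter (fun j => Prec μ j i) := by
      ext j
      simp only [Finset.mem_filter, Finset.mem_univ, true_and, Finset.mem_erase, and_true]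
      refine ⟨fun h => ⟨?_, h⟩, fun h => h.2⟩
      rintro rfl
      exact Prec.irrefl μ _ h
    simp only [Finset.sum_const, Finset.card_range]
    rw [← Finset.smul_sum, ← Finset.sum_filter, Finset.sum_const, rk, this, mul_smul,
      Nat.cast_smul_eq_nsmul, Nat.cast_smul_eq_nsmul]
  have key : zOp r c0 c i (mono μ) - wtz r c0 c μ i • mono μ =
      -c0 • ∑ j ∈ Finset.univ.erase i, ∑ l ∈ Finset.range r,
        (ddiff (rf r i j l) (px i - (zeta r : ℂ) ^ l • px j) (px i * mono μ) -
          (if j < i then act (rf r i j l) (mono μ) else 0) -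
          (if Prec μ j i then mono μ else 0)) := by
    simp only [Finset.sum_sub_distrib]
    rw [← h3, ← h4, zOp_apply, dunkl, wtz]
    simp only [LinearMap.sub_apply, LinearMap.sum_apply, LinearMap.smul_apply, h2,
      Derivation.coeFn_coe, h1]
    module
  rw [key]
  refine Submodule.smul_mem _ _ (Submodule.sum_mem _ fun j hj => Submodule.sum_mem _ fun l _ => ?_)
  exact ddiff_rf_mono_sub_mem r (Finset.ne_of_mem_erase hj) l μ

end Triangular

/-! ### Families of triangular operators -/

section TriangularFamily

variable {I K E : Type*} [AddCommGroup E] [Module ℂ E]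

/-- The operators `op κ` are triangular in the basis `b` with respect to the relation `lt`, with
diagonal entries `wt κ`. -/
def IsTriangular (b : Module.Basis I ℂ E) (lt : I → I → Prop) (op : K → E →ₗ[ℂ] E)
    (wt : K → I → ℂ) : Prop :=
  ∀ κ μ, op κ (b μ) - wt κ μ • b μ ∈ Submodule.span ℂ (b '' {ν | lt ν μ})

/-- `f` is a joint eigenvector with eigenvalues `l`. -/
def IsEigen (op : K → E →ₗ[ℂ] E) (l : K → ℂ) (f : E) : Prop := ∀ κ, op κ f = l κ • f

variable {b : Module.Basis I ℂ E} {lt : I → I → Prop} {op : K → E →ₗ[ℂ] E} {wt : K → I → ℂ}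

lemma repr_eq_zero_of_mem_lower {μ ν : I} {x : E} (hx : x ∈ Submodule.span ℂ (b '' {ν | lt ν μ}))
    (h : ¬ lt ν μ) : b.repr x ν = 0 := by
  rw [Module.Basis.mem_span_image] at hx
  by_contra h0
  exact h (hx (Finsupp.mem_support_iff.2 h0))

/-- At an exponent that lies below nothing in the support of `f`, only the diagonal entry
contributes. -/
lemma IsTriangular.repr_op (ht : IsTriangular b lt op wt) {f : E} {ν : I}
    (hν : ∀ x, b.repr f x ≠ 0 → ¬ lt ν x) (κ : K) :
    b.repr (op κ f) ν = wt κ ν * b.repr f ν := by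
  classical
  have e : op κ f = (b.repr f).sum fun x a => a • op κ (b x) := by
    conv_lhs => rw [← b.linearCombination_repr f, Finsupp.linearCombination_apply, Finsupp.sum,
      map_sum]
    simp only [map_smul, Finsupp.sum]
  have h1 : ∀ x, b.repr f x ≠ 0 → b.repr (op κ (b x)) ν = wt κ x * b.repr (b x) ν := fun x hx => by
    have := repr_eq_zero_of_mem_lower (ht κ x) (hν x hx)
    rw [map_sub, map_smul] at this
    rwa [Finsupp.sub_apply, Finsupp.smul_apply, smul_eq_mul, sub_eq_zero] at this
  rw [e, Finsupp.sum, map_sum, Finset.sum_apply', Finset.sum_congr rfl fun x hx => by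
    rw [map_smul, Finsupp.smul_apply, h1 x (Finsupp.mem_support_iff.1 hx), Module.Basis.repr_self]]
  by_cases h0 : b.repr f ν = 0
  · rw [h0, mul_zero]
    refine Finset.sum_eq_zero fun x hx => ?_
    have : x ≠ ν := fun e => (Finsupp.mem_support_iff.1 hx) (e ▸ h0)
    simp [this]
  · rw [Finset.sum_eq_single_of_mem ν (Finsupp.mem_support_iff.2 h0)]
    · simp [mul_comm]
    · intro x _ hx
      simp [hx]

lemma exists_maximal_repr (htrans : ∀ x y z, lt x y → lt y z → lt x z) (hirr : ∀ μ, ¬ lt μ μ)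
    {f : E} {ν : I} (hν : b.repr f ν ≠ 0) :
    ∃ x, b.repr f x ≠ 0 ∧ (x = ν ∨ lt ν x) ∧ ∀ y, b.repr f y ≠ 0 → ¬ lt x y := by
  let R : (b.repr f).support → (b.repr f).support → Prop := fun x y => lt y.1 x.1
  have : IsTrans _ R := ⟨fun _ _ _ h h' => htrans _ _ _ h' h⟩
  have : Std.Irrefl R := ⟨fun x => hirr x.1⟩
  have hwf : WellFounded R := Finite.wellFounded_of_trans_of_irrefl R
  obtain ⟨x, hx, hmax⟩ := hwf.has_min {x | x.1 = ν ∨ lt ν x.1}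
    ⟨⟨ν, Finsupp.mem_support_iff.2 hν⟩, Or.inl rfl⟩
  refine ⟨x.1, Finsupp.mem_support_iff.1 x.2, hx, fun y hy hxy => ?_⟩
  refine hmax ⟨y, Finsupp.mem_support_iff.2 hy⟩ (Or.inr ?_) hxy
  rcases hx with hx | hx
  · exact hx ▸ hxy
  · exact htrans _ _ _ hx hxy

/-- Above every exponent in the support there is a maximal one, and at a maximal one the eigenvalues
must be the diagonal entries. -/
lemma IsTriangular.exists_weight (ht : IsTriangular b lt op wt)
    (htrans : ∀ x y z, lt x y → lt y z → lt x z) (hirr : ∀ μ, ¬ lt μ μ) {f : E} {l : K → ℂ}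
    (hf : IsEigen op l f) {ν : I} (hν : b.repr f ν ≠ 0) :
    ∃ x, b.repr f x ≠ 0 ∧ (x = ν ∨ lt ν x) ∧ ∀ κ, wt κ x = l κ := by
  obtain ⟨x, hx, hxν, hmax⟩ := exists_maximal_repr htrans hirr hν
  refine ⟨x, hx, hxν, fun κ => ?_⟩
  have := ht.repr_op hmax κ
  rw [hf κ, map_smul, Finsupp.smul_apply, smul_eq_mul] at this
  exact (mul_right_cancel₀ hx this).symm

lemma IsEigen.sub_smul {f g : E} {l : K → ℂ} (hf : IsEigen op l f) (hg : IsEigen op l g) (a : ℂ) :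
    IsEigen op l (f - a • g) := fun κ => by
  rw [map_sub, map_smul, hf κ, hg κ, smul_sub, smul_comm]

/-- A joint eigenspace whose eigenvalues occur only once on the diagonal is a line. -/
lemma IsTriangular.eq_smul (ht : IsTriangular b lt op wt)
    (htrans : ∀ x y z, lt x y → lt y z → lt x z) (hirr : ∀ μ, ¬ lt μ μ) {f g : E} {l : K → ℂ}
    {μ : I} (huniq : ∀ ν, (∀ κ, wt κ ν = l κ) → ν = μ) (hf : IsEigen op l f) (hg : IsEigen op l g)
    (hfμ : b.repr f μ = 1) : g = b.repr g μ • f := by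
  rw [← sub_eq_zero]
  by_contra h
  have h' : b.repr (g - b.repr g μ • f) ≠ 0 := fun e => h (b.repr.map_eq_zero_iff.1 e)
  obtain ⟨ν, hν⟩ := Finsupp.ne_iff.1 h'
  obtain ⟨x, hx, -, hw⟩ := ht.exists_weight htrans hirr (hg.sub_smul hf _) hν
  rw [huniq x hw] at hx
  simp [hfμ] at hx

lemma IsTriangular.repr_ne_zero (ht : IsTriangular b lt op wt)
    (htrans : ∀ x y z, lt x y → lt y z → lt x z) (hirr : ∀ μ, ¬ lt μ μ) {f : E} {l : K → ℂ}
    {μ : I} (huniq : ∀ ν, (∀ κ, wt κ ν = l κ) → ν = μ) (hf : IsEigen op l f) (h0 : f ≠ 0) :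
    b.repr f μ ≠ 0 := by
  have h' : b.repr f ≠ 0 := fun e => h0 (b.repr.map_eq_zero_iff.1 e)
  obtain ⟨ν, hν⟩ := Finsupp.ne_iff.1 h'
  obtain ⟨x, hx, -, hw⟩ := ht.exists_weight htrans hirr hf hν
  rwa [huniq x hw] at hx

lemma sub_mem_lower_iff {f : E} {μ : I} (hirr : ∀ μ, ¬ lt μ μ) :
    f - b μ ∈ Submodule.span ℂ (b '' {ν | lt ν μ}) ↔
      b.repr f μ = 1 ∧ ∀ ν, b.repr f ν ≠ 0 → ν = μ ∨ lt ν μ := by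
  classical
  have hne : ∀ ν, ν ≠ μ → b.repr (f - b μ) ν = b.repr f ν := fun ν hν => by
    simp [hν.symm]
  constructor
  · intro h
    constructor
    · have := repr_eq_zero_of_mem_lower h (hirr μ)
      simpa [sub_eq_zero] using this
    · intro ν hν
      by_contra! hcon
      have := repr_eq_zero_of_mem_lower h hcon.2
      rw [hne ν hcon.1] at this
      exact hν this
  · rintro ⟨h1, h2⟩
    rw [Module.Basis.mem_span_image]
    intro ν hν
    rw [Finset.mem_coe, Finsupp.mem_support_iff] at hν
    rcases eq_or_ne ν μ with rfl | hνμ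
    · simp [h1] at hν
    · rw [hne ν hνμ] at hν
      exact (h2 ν hν).resolve_left hνμ

/-- Every exponent in the support lies below one with the weight of the eigenvector, and `μ` is the
only such exponent. Thus the leading-term form needs no separate computation. -/
lemma IsTriangular.sub_mem_lower (ht : IsTriangular b lt op wt)
    (htrans : ∀ x y z, lt x y → lt y z → lt x z) (hirr : ∀ μ, ¬ lt μ μ) {f : E} {l : K → ℂ}
    {μ : I} (huniq : ∀ ν, (∀ κ, wt κ ν = l κ) → ν = μ) (hf : IsEigen op l f)
    (h1 : b.repr f μ = 1) : f - b μ ∈ Submodule.span ℂ (b '' {ν | lt ν μ}) := by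
  refine (sub_mem_lower_iff hirr).2 ⟨h1, fun ν hν => ?_⟩
  obtain ⟨x, -, hxν, hw⟩ := ht.exists_weight htrans hirr hf hν
  rw [huniq x hw] at hxν
  exact hxν.imp Eq.symm id

lemma IsTriangular.weight_of_sub_mem (ht : IsTriangular b lt op wt)
    (htrans : ∀ x y z, lt x y → lt y z → lt x z) (hirr : ∀ μ, ¬ lt μ μ) {f : E} {μ : I}
    (hf : f - b μ ∈ Submodule.span ℂ (b '' {ν | lt ν μ})) {κ : K} {e : ℂ}
    (he : op κ f = e • f) : e = wt κ μ := by
  rw [sub_mem_lower_iff hirr] at hf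
  have := ht.repr_op (ν := μ) (f := f) (fun x hx hμx => by
    rcases hf.2 x hx with rfl | h
    · exact hirr _ hμx
    · exact hirr _ (htrans _ _ _ h hμx)) κ
  rw [he, map_smul, Finsupp.smul_apply, hf.1] at this
  simpa using this

lemma span_eq_top_of_triangular (hwf : WellFounded lt) {f : I → E}
    (hf : ∀ μ, f μ - b μ ∈ Submodule.span ℂ (b '' {ν | lt ν μ})) :
    Submodule.span ℂ (Set.range f) = ⊤ := by
  rw [eq_top_iff, ← b.span_eq, Submodule.span_le]
  rintro _ ⟨μ, rfl⟩
  induction μ using hwf.induction with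
  | h μ ih =>
    have h1 : Submodule.span ℂ (b '' {ν | lt ν μ}) ≤ Submodule.span ℂ (Set.range f) := by
      rw [Submodule.span_le]
      rintro _ ⟨ν, hν, rfl⟩
      exact ih ν hν
    have := sub_mem (Submodule.subset_span (R := ℂ) (Set.mem_range_self (f := f) μ)) (h1 (hf μ))
    simpa using this

/-- Components of an element of an invariant subspace along joint eigenvectors lie in it. -/
lemma smul_mem_of_sum_mem {f : I → E} (hf : ∀ μ, IsEigen op (fun κ => wt κ μ) (f μ))
    (hinj : ∀ μ ν, (∀ κ, wt κ μ = wt κ ν) → μ = ν) {N : Submodule ℂ E}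
    (hN : ∀ κ, ∀ x ∈ N, op κ x ∈ N) (S : Finset I) :
    ∀ (a : I → ℂ), ∑ ν ∈ S, a ν • f ν ∈ N → ∀ μ ∈ S, a μ • f μ ∈ N := by
  classical
  have key : ∀ (S : Finset I) (μ : I), μ ∉ S → ∀ (e : ℂ) (a : I → ℂ),
      e • f μ + ∑ ν ∈ S, a ν • f ν ∈ N → e • f μ ∈ N := by
    intro S μ
    induction S using Finset.induction_on with
    | empty => intro _ e a h; simpa using h
    | insert ν S hν ih =>
      intro hμ e a h
      rw [Finset.mem_insert, not_or] at hμ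
      -- Choose an operator that separates `μ` from `ν`: subtracting its eigenvalue at `ν` kills the
      -- component along `f ν` and scales the one along `f μ` by a nonzero factor.
      obtain ⟨κ, hκ⟩ : ∃ κ, wt κ μ ≠ wt κ ν := by
        by_contra! hcon
        exact hμ.1 (hinj _ _ hcon)
      have h1 := sub_mem (hN κ _ h) (N.smul_mem (wt κ ν) h)
      have h2 : op κ (e • f μ + ∑ x ∈ insert ν S, a x • f x) -
          wt κ ν • (e • f μ + ∑ x ∈ insert ν S, a x • f x) =
          ((wt κ μ - wt κ ν) * e) • f μ + ∑ x ∈ S, ((wt κ x - wt κ ν) * a x) • f x := by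
        rw [Finset.sum_insert hν, map_add, map_add, map_smul, map_smul, map_sum, hf μ κ, hf ν κ]
        simp only [map_smul, hf _ κ, smul_add, Finset.smul_sum, sub_mul, sub_smul,
          Finset.sum_sub_distrib, mul_smul]
        simp only [smul_comm (wt κ _) (a _)]
        rw [smul_comm e (wt κ μ), smul_comm (a ν) (wt κ ν)]
        abel
      rw [h2] at h1
      have h3 := ih hμ.2 _ _ h1
      have h4 := N.smul_mem (wt κ μ - wt κ ν)⁻¹ h3
      rwa [smul_smul, ← mul_assoc, inv_mul_cancel₀ (sub_ne_zero.2 hκ), one_mul] at h4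
  intro a h μ hμ
  refine key (S.erase μ) μ (Finset.notMem_erase μ S) (a μ) a ?_
  rwa [Finset.add_sum_erase S (fun x => a x • f x) hμ]

lemma eq_span_of_stable {f : I → E} (hf : ∀ μ, IsEigen op (fun κ => wt κ μ) (f μ))
    (hinj : ∀ μ ν, (∀ κ, wt κ μ = wt κ ν) → μ = ν) (hspan : Submodule.span ℂ (Set.range f) = ⊤)
    {N : Submodule ℂ E} (hN : ∀ κ, ∀ x ∈ N, op κ x ∈ N) :
    N = Submodule.span ℂ (f '' {μ | f μ ∈ N}) := by
  refine le_antisymm (fun x hx => ?_) ?_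
  · have hx' : x ∈ Submodule.span ℂ (Set.range f) := hspan ▸ Submodule.mem_top
    obtain ⟨a, rfl⟩ := (Finsupp.mem_span_range_iff_exists_finsupp).1 hx'
    rw [Finsupp.sum] at hx ⊢
    refine Submodule.sum_mem _ fun μ hμ => Submodule.smul_mem _ _ (Submodule.subset_span ⟨μ, ?_, rfl⟩)
    have h1 := smul_mem_of_sum_mem hf hinj hN a.support a hx μ hμ
    have h2 := N.smul_mem (a μ)⁻¹ h1
    rwa [smul_smul, inv_mul_cancel₀ (Finsupp.mem_support_iff.1 hμ), one_smul] at h2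
  · rw [Submodule.span_le]
    rintro _ ⟨μ, hμ, rfl⟩
    exact hμ

lemma mem_of_mem_span {f : I → E} (hf : ∀ μ, IsEigen op (fun κ => wt κ μ) (f μ))
    (hinj : ∀ μ ν, (∀ κ, wt κ μ = wt κ ν) → μ = ν) (h0 : ∀ μ, f μ ≠ 0) {S : Set I} {μ : I}
    (hμ : f μ ∈ Submodule.span ℂ (f '' S)) : μ ∈ S := by
  classical
  by_contra hS
  obtain ⟨a, ha, hsum⟩ := (Finsupp.mem_span_image_iff_linearCombination ℂ).1 hμ
  rw [Finsupp.mem_supported] at ha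
  have hμa : μ ∉ a.support := fun h => hS (ha h)
  -- A linear relation is a sum lying in the zero subspace, so each of its components vanishes.
  have h1 : ∑ ν ∈ insert μ a.support, (if ν = μ then 1 else -a ν) • f ν ∈ (⊥ : Submodule ℂ E) := by
    rw [Finset.sum_insert hμa, if_pos rfl, one_smul, ← hsum, Finsupp.linearCombination_apply,
      Finsupp.sum, ← Finset.sum_add_distrib, Submodule.mem_bot]
    refine Finset.sum_eq_zero fun ν hν => ?_
    rw [if_neg (fun e => hμa (e ▸ hν) : ¬ ν = μ)]
    simp
  have h2 := smul_mem_of_sum_mem hf hinj (N := ⊥) (fun κ x hx => by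
    rw [Submodule.mem_bot] at hx ⊢; rw [hx, map_zero]) _ _ h1 μ (Finset.mem_insert_self _ _)
  rw [if_pos rfl, one_smul, Submodule.mem_bot] at h2
  exact h0 μ h2

end TriangularFamily

/-! ### Weights determine exponents -/

section Weights

/-- As `c` is supported on multiples of `p`, only `p * j` modulo `r` matters. -/
lemma dpar_congr {r p : ℕ} (hr : r ≠ 0) {c : ℕ → ℂ} (hc : ∀ l : ℕ, ¬ p ∣ l → c l = 0) {j j' : ℤ}
    (h : (r : ℤ) ∣ p * (j - j')) : dpar r c j = dpar r c j' := by
  refine Finset.sum_congr rfl fun l _ => ?_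
  by_cases hl : p ∣ l
  · obtain ⟨q, rfl⟩ := hl
    congr 1
    rw [← sub_add_cancel j j', mul_add, zpow_add₀ (zeta_ne_zero r)]
    have : (zeta r : ℂ) ^ (((p * q : ℕ) : ℤ) * (j - j')) = 1 := by
      rw [(isPrimitiveRoot_zeta hr).zpow_eq_one_iff_dvd]
      push_cast
      rw [mul_right_comm]
      exact Dvd.dvd.mul_right h _
    rw [this, one_mul]
  · rw [hc l hl, mul_zero, mul_zero]

variable {n : ℕ}

/-- Compare positions from the top down. At the first disagreement `x`, let `a` and `b` be the
indices placed there by `v` and `u`. Sorting and the sign hypotheses give the cycle `μ b ≤ μ a < ν a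
≤ ν b < μ b`. -/
lemma perm_eq_of_sorted {μ ν : Fin n → ℕ} {u v : Equiv.Perm (Fin n)}
    (hv : ∀ a b, v a < v b → μ a ≤ μ b) (hu : ∀ a b, u a < u b → ν a ≤ ν b)
    (h1 : ∀ i, u i < v i → μ i < ν i) (h2 : ∀ i, v i < u i → ν i < μ i) : u = v := by
  have key : ∀ x, u.symm x = v.symm x := by
    intro x
    induction x using WellFoundedGT.induction with
    | ind x ih =>
      have hge : ∀ {w w' : Equiv.Perm (Fin n)}, (∀ y, x < y → w.symm y = w'.symm y) →
          w (w'.symm x) ≤ x := by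
        intro w w' hw
        by_contra hcon
        have h := hw _ (not_le.1 hcon)
        rw [Equiv.symm_apply_apply] at h
        have : x = w (w'.symm x) := w'.symm.injective h
        omega
      have hui : u (v.symm x) ≤ x := hge ih
      have hvi : v (u.symm x) ≤ x := hge fun y hy => (ih y hy).symm
      by_contra hne
      have hui' : u (v.symm x) < x := lt_of_le_of_ne hui fun e => hne (by
        rw [Equiv.symm_apply_eq]; exact e.symm)
      have hvi' : v (u.symm x) < x := lt_of_le_of_ne hvi fun e => hne (by
        rw [Equiv.eq_symm_apply]; exact e)
      have e1 := h1 (v.symm x) (by simpa using hui')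
      have e2 := h2 (u.symm x) (by simpa using hvi')
      have e3 := hv (u.symm x) (v.symm x) (by simpa using hvi')
      have e4 := hu (v.symm x) (u.symm x) (by simpa using hui')
      omega
  exact Equiv.symm_bijective.injective (Equiv.ext key)

/-- Genericity of the parameters: they lie on no hyperplane other than `H_{k,1}`. -/
structure Generic (r n : ℕ) (c0 : ℂ) (c : ℕ → ℂ) (k : ℕ) : Prop where
  onH : OnH r n c0 c k 1
  not_onH : ∀ j l : ℕ, 0 < j → ¬ r ∣ j → 1 ≤ l → l ≤ n → (j, l) ≠ (k, 1) → ¬ OnH r n c0 c j l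
  c0_ne : ∀ q m : ℕ, 1 ≤ q → q ≤ n → 1 ≤ m → c0 ≠ (m : ℂ) / (q : ℂ)

lemma Generic.ne_of_mul_eq {r k : ℕ} {c0 : ℂ} {c : ℕ → ℂ} (hg : Generic r n c0 c k) {q m : ℕ}
    (hq : 1 ≤ q) (hqn : q ≤ n) (hm : 1 ≤ m) : (m : ℂ) ≠ c0 * q := fun e =>
  hg.c0_ne q m hq hqn hm (by
    have : (q : ℂ) ≠ 0 := by exact_mod_cast (by omega : q ≠ 0)
    rw [e, mul_div_cancel_right₀ _ this])

/-- A non-zero difference of exponents is never a positive multiple of `r c_0`, except on the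
distinguished hyperplane. -/
lemma Generic.eq_of_diff {r p k : ℕ} (hr : 1 < r) {c0 : ℂ} {c : ℕ → ℂ}
    (hc : ∀ l : ℕ, ¬ p ∣ l → c l = 0) (hg : Generic r n c0 c k) {D q : ℕ} (hD : 0 < D) (hq : 0 < q)
    (hqn : q < n) (hmod : r ∣ p * D) (h : (D : ℂ) = r * c0 * q) :
    ¬ r ∣ D ∧ D = k ∧ q + 1 = n := by
  have hr0 : (r : ℂ) ≠ 0 := by exact_mod_cast (by omega : r ≠ 0)
  have hrD : ¬ r ∣ D := by
    rintro ⟨m, rfl⟩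
    refine hg.ne_of_mul_eq (q := q) (m := m) hq hqn.le (Nat.pos_of_mul_pos_left hD) ?_
    push_cast at h
    rw [mul_assoc] at h
    exact mul_left_cancel₀ hr0 h
  refine ⟨hrD, ?_⟩
  by_contra hcon
  -- As `r` divides `p * D`, the terms `d_0` and `d_{-D}` cancel, and `D = r c_0 q` becomes the
  -- equation of `H_{D, n - q}`.
  refine hg.not_onH D (n - q) hD hrD (by omega) (by omega) (fun e => hcon ?_) ?_
  · simp only [Prod.mk.injEq] at e
    omega
  · have hd : dpar r c (-(D : ℤ)) = dpar r c 0 := by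
      refine dpar_congr (p := p) (by omega) hc ?_
      obtain ⟨e, he⟩ := hmod
      refine ⟨-e, ?_⟩
      have : (p : ℤ) * D = r * e := by exact_mod_cast he
      linear_combination -this
    rw [OnH, hd, Nat.cast_sub hqn.le, h]
    ring

/-- This is where genericity separates weights. If some difference `μ i - ν i` is nonzero with the
sign of the rank difference, then `r c_0` is positive, so all pairs of differences have equal signs.
The hyperplane conditions then leave only the differences `k` and `-k`, with `i` moving between the
first and last positions; the congruences exclude zero differences, which forces `n = 2` and finally
the excluded value `c_0 = m / 2`. If no such index exists, `c_0 = 0` makes the claim immediate, and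
otherwise the signs are opposite and `perm_eq_of_sorted` applies. -/
lemma Generic.sorted_eq {r p k : ℕ} (hr : 1 < r) {c0 : ℂ} {c : ℕ → ℂ}
    (hc : ∀ l : ℕ, ¬ p ∣ l → c l = 0) (hg : Generic r n c0 c k)
    {μ ν : Fin n → ℕ} {u v : Equiv.Perm (Fin n)}
    (hv : ∀ a b, v a < v b → μ a ≤ μ b) (hu : ∀ a b, u a < u b → ν a ≤ ν b)
    (hmod : ∀ i j, (r : ℤ) ∣ ((μ i : ℤ) - ν i) - ((μ j : ℤ) - ν j))
    (hmod' : ∀ i, (r : ℤ) ∣ p * ((μ i : ℤ) - ν i))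
    (h : ∀ i, (μ i : ℂ) - ν i = r * c0 * ((v i : ℕ) - (u i : ℕ))) :
    μ = ν ∧ (c0 = 0 ∨ u = v) := by
  have hr0 : (r : ℂ) ≠ 0 := by exact_mod_cast (by omega : r ≠ 0)
  -- differences with the sign of the rank differences
  have hpos : ∀ i, ν i < μ i → u i < v i → ¬ (r : ℤ) ∣ (μ i : ℤ) - ν i ∧ (μ i : ℤ) - ν i = k ∧
      (v i : ℕ) + 1 = n ∧ (u i : ℕ) = 0 := by
    intro i h1 h2
    rw [Fin.lt_def] at h2
    have h3 := hg.eq_of_diff hr hc (D := μ i - ν i) (q := (v i : ℕ) - u i) (by omega) (by omega)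
      (by omega) (by
        have := hmod' i
        rw [← Nat.cast_sub h1.le] at this
        exact_mod_cast this) (by
        rw [Nat.cast_sub h1.le, Nat.cast_sub h2.le]; exact h i)
    refine ⟨?_, by omega, by omega, by omega⟩
    rw [← Nat.cast_sub h1.le]
    exact_mod_cast h3.1
  have hneg : ∀ i, μ i < ν i → v i < u i → ¬ (r : ℤ) ∣ (μ i : ℤ) - ν i ∧ (μ i : ℤ) - ν i = -k ∧
      (u i : ℕ) + 1 = n ∧ (v i : ℕ) = 0 := by
    intro i h1 h2
    rw [Fin.lt_def] at h2
    have h3 := hg.eq_of_diff hr hc (D := ν i - μ i) (q := (u i : ℕ) - v i) (by omega) (by omega)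
      (by omega) (by
        have := hmod' i
        rw [← Int.dvd_neg, ← mul_neg, neg_sub, ← Nat.cast_sub h1.le] at this
        exact_mod_cast this) (by
        rw [Nat.cast_sub h1.le, Nat.cast_sub h2.le]; linear_combination -h i)
    refine ⟨?_, by omega, by omega, by omega⟩
    rw [← Int.dvd_neg, neg_sub, ← Nat.cast_sub h1.le]
    exact_mod_cast h3.1
  have hD0 : ∀ i, u i = v i → μ i = ν i := fun i e => by
    have := h i
    rw [e, sub_self, mul_zero, sub_eq_zero] at this
    exact_mod_cast this
  by_cases hex : ∃ i, (ν i < μ i ∧ u i < v i) ∨ (μ i < ν i ∧ v i < u i)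
  · exfalso
    -- the ratio `r c_0` is positive
    have hratio : ∃ D q : ℕ, 0 < D ∧ 0 < q ∧ (D : ℂ) = r * c0 * q := by
      obtain ⟨i, ⟨h1, h2⟩ | ⟨h1, h2⟩⟩ := hex
      · rw [Fin.lt_def] at h2
        refine ⟨μ i - ν i, v i - u i, by omega, by omega, ?_⟩
        rw [Nat.cast_sub h1.le, Nat.cast_sub h2.le]; exact h i
      · rw [Fin.lt_def] at h2
        refine ⟨ν i - μ i, u i - v i, by omega, by omega, ?_⟩
        rw [Nat.cast_sub h1.le, Nat.cast_sub h2.le]; linear_combination -h i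
    obtain ⟨D, q, hD, hq, hDq⟩ := hratio
    -- With `r c_0 = D / q` the weight equations become integral, and signs can be compared.
    have hint : ∀ i, ((μ i : ℤ) - ν i) * q = D * ((v i : ℕ) - (u i : ℕ) : ℤ) := fun i => by
      have : ((μ i : ℂ) - ν i) * q = D * ((v i : ℕ) - (u i : ℕ) : ℂ) := by
        rw [h i, hDq]; ring
      exact_mod_cast this
    have hsame : ∀ i, (u i < v i → ν i < μ i) ∧ (v i < u i → μ i < ν i) := fun i => by
      have := hint i
      constructor
      · intro h1
        rw [Fin.lt_def] at h1
        have h2 : (0 : ℤ) < D * ((v i : ℕ) - (u i : ℕ) : ℤ) := by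
          apply mul_pos <;> omega
        rw [← this] at h2
        have := pos_of_mul_pos_left h2 (by omega : (0 : ℤ) ≤ q)
        omega
      · intro h1
        rw [Fin.lt_def] at h1
        have h2 : (0 : ℤ) < D * ((u i : ℕ) - (v i : ℕ) : ℤ) := by
          apply mul_pos <;> omega
        have h3 : (0 : ℤ) < ((ν i : ℤ) - μ i) * q := by
          linarith
        have := pos_of_mul_pos_left h3 (by omega : (0 : ℤ) ≤ q)
        omega
    -- All differences are congruent modulo `r`, and one of them is not divisible by `r`; in
    -- particular none is zero.
    have hnd : ∀ i, ¬ (r : ℤ) ∣ (μ i : ℤ) - ν i := by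
      obtain ⟨i, hi⟩ := hex
      have h0 : ¬ (r : ℤ) ∣ (μ i : ℤ) - ν i := by
        rcases hi with ⟨h1, h2⟩ | ⟨h1, h2⟩
        · exact (hpos i h1 h2).1
        · exact (hneg i h1 h2).1
      intro j hj
      exact h0 ((dvd_sub_left hj).1 (hmod i j))
    have hall : ∀ i, ((μ i : ℤ) - ν i = k ∧ (v i : ℕ) + 1 = n ∧ (u i : ℕ) = 0 ∧ 1 < n) ∨
        ((μ i : ℤ) - ν i = -k ∧ (u i : ℕ) + 1 = n ∧ (v i : ℕ) = 0 ∧ 1 < n) := by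
      intro i
      rcases lt_trichotomy (u i) (v i) with h1 | h1 | h1
      · have h2 := hpos i ((hsame i).1 h1) h1
        rw [Fin.lt_def] at h1
        exact Or.inl ⟨h2.2.1, h2.2.2.1, h2.2.2.2, by omega⟩
      · exact absurd (by rw [hD0 i h1, sub_self]; exact dvd_zero _) (hnd i)
      · have h2 := hneg i ((hsame i).2 h1) h1
        rw [Fin.lt_def] at h1
        exact Or.inr ⟨h2.2.1, h2.2.2.1, h2.2.2.2, by omega⟩
    obtain ⟨i, -⟩ := hex
    have hn1 : 1 < n := by rcases hall i with h | h <;> exact h.2.2.2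
    -- Every index must occupy the first or the last position of the sorting `v`, so there is no
    -- room for a third one.
    have hn2 : n = 2 := by
      by_contra hn
      have := hall (v.symm ⟨1, hn1⟩)
      simp only [Equiv.apply_symm_apply] at this
      omega
    subst hn2
    have h0 : (μ (v.symm 0) : ℤ) - ν (v.symm 0) = -k := by
      have := hall (v.symm 0)
      simp only [Equiv.apply_symm_apply] at this
      simp at this
      exact this.1
    have h1 : (μ (v.symm 1) : ℤ) - ν (v.symm 1) = k ∧ ((u (v.symm 1) : Fin 2) : ℕ) = 0 := by
      have := hall (v.symm 1)
      simp only [Equiv.apply_symm_apply] at this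
      simp at this
      exact ⟨this.1, by simp [this.2]⟩
    have h2 := hmod (v.symm 1) (v.symm 0)
    rw [h0, h1.1] at h2
    obtain ⟨m, hm⟩ := h2
    have h3 := h (v.symm 1)
    rw [Equiv.apply_symm_apply, h1.2] at h3
    have h4 : ((μ (v.symm 1) : ℂ) - ν (v.symm 1)) = k := by exact_mod_cast h1.1
    rw [h4] at h3
    simp at h3
    have hk0 : 0 < k := by
      rcases Nat.eq_zero_or_pos k with rfl | hk
      · exact absurd (by rw [h0]; simp) (hnd (v.symm 0))
      · exact hk
    have hm0 : 0 < m := by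
      have : (0 : ℤ) < r * m := by omega
      exact pos_of_mul_pos_right this (by omega)
    obtain ⟨m, rfl⟩ := Int.eq_ofNat_of_zero_le hm0.le
    -- The two differences `k` and `-k` are congruent modulo `r`, so `2 k = r m`; combined with `k =
    -- r c_0` this gives `m = 2 c_0`.
    refine hg.ne_of_mul_eq (q := 2) (m := m) (by omega) le_rfl (by omega) ?_
    have hm' : (2 : ℂ) * k = r * m := by
      have : (2 : ℤ) * k = r * m := by simpa [two_mul] using hm
      exact_mod_cast this
    refine mul_left_cancel₀ hr0 ?_
    rw [← hm', h3]; push_cast; ring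
  · push Not at hex
    by_cases hc0 : c0 = 0
    · refine ⟨funext fun i => ?_, Or.inl hc0⟩
      have := h i
      rw [hc0, mul_zero, zero_mul, sub_eq_zero] at this
      exact_mod_cast this
    · have hq0 : ∀ i, μ i = ν i → u i = v i := fun i e => by
        have := h i
        rw [e, sub_self] at this
        have h1 := (mul_eq_zero.1 this.symm).resolve_left (mul_ne_zero hr0 hc0)
        rw [sub_eq_zero] at h1
        exact Fin.ext (by exact_mod_cast h1.symm)
      have huv : u = v := by
        refine perm_eq_of_sorted hv hu (fun i hi => ?_) fun i hi => ?_
        · by_contra hcon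
          rcases (not_lt.1 hcon).eq_or_lt with h1 | h1
          · exact hi.ne (hq0 i h1.symm)
          · exact absurd hi (not_lt.2 ((hex i).1 h1))
        · by_contra hcon
          rcases (not_lt.1 hcon).eq_or_lt with h1 | h1
          · exact hi.ne' (hq0 i h1)
          · exact absurd hi (not_lt.2 ((hex i).2 h1))
      exact ⟨funext fun i => hD0 i (by rw [huv]), Or.inr huv⟩

end Weights

/-! ### Intertwining relations -/

section Intertwining

variable {r p n : ℕ}

/-- The permutation matrix of `σ`. -/
def pm (σ : Equiv.Perm (Fin n)) : V n ≃ₗ[ℂ] V n := LinearEquiv.funCongrLeft ℂ ℂ σ.symm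

lemma pm_apply (σ : Equiv.Perm (Fin n)) (v : V n) (m : Fin n) : pm σ v m = v (σ.symm m) := rfl

lemma pm_mem (r p : ℕ) (σ : Equiv.Perm (Fin n)) : pm σ ∈ G r p n :=
  ⟨σ, fun _ => 1, by simp, by simp, fun v m => by simp [pm_apply]⟩

lemma sw_eq_pm (i j : Fin n) : sw i j = pm (Equiv.swap i j) := by
  ext v m
  rw [sw_apply, pm_apply, Equiv.symm_swap]

lemma pm_mul (σ τ : Equiv.Perm (Fin n)) : pm (σ * τ) = pm σ * pm τ := by
  ext v m
  simp [pm_apply, Equiv.Perm.mul_def]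

lemma pm_one : pm (1 : Equiv.Perm (Fin n)) = 1 := rfl

lemma pm_inv (σ : Equiv.Perm (Fin n)) : (pm σ)⁻¹ = pm σ⁻¹ := by
  rw [inv_eq_iff_mul_eq_one, ← pm_mul, mul_inv_cancel, pm_one]

lemma dg_mul_pm (a : Fin n → ℂˣ) (σ : Equiv.Perm (Fin n)) : dg a * pm σ = pm σ * dg (a ∘ σ) := by
  ext v m
  simp [pm_apply, dg_apply]

lemma pm_yv (σ : Equiv.Perm (Fin n)) (j : Fin n) : pm σ (yv j) = yv (σ j) := by
  ext m
  simp [pm_apply, yv, Pi.single_apply, Equiv.symm_apply_eq]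

lemma dualAct_pm (σ : Equiv.Perm (Fin n)) (j : Fin n) : dualAct (pm σ) (xv j) = xv (σ j) := by
  ext v
  rw [LinearMap.comp_apply, LinearMap.comp_apply, dualAct_apply, pm_inv]
  rfl

lemma act_pm_px (σ : Equiv.Perm (Fin n)) (j : Fin n) : act (pm σ) (px j) = px (σ j) := by
  rw [act_px, dualAct_pm, lin_xv]

lemma pm_mul_rf (σ : Equiv.Perm (Fin n)) {i j : Fin n} (hij : j ≠ i) (l : ℕ) :
    pm σ * rf r i j l = rf r (σ i) (σ j) l * pm σ := by
  ext v m
  simp only [LinearEquiv.mul_apply, pm_apply, rf_apply r hij, rf_apply r (σ.injective.ne hij),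
    Equiv.symm_apply_eq, Equiv.symm_apply_apply]

/-- The operator `y_i x_i` on polynomials. -/
def yxOp (r : ℕ) (c0 : ℂ) (c : ℕ → ℂ) (i : Fin n) (f : Pol n) : Pol n :=
  dunkl r c0 c i (px i * f)

/-- A sum of reflections `ζ_i^l s_{ij} ζ_i^{-l}` over `j ∈ A`. -/
def rfSum (r : ℕ) (i : Fin n) (A : Finset (Fin n)) (f : Pol n) : Pol n :=
  ∑ j ∈ A, ∑ l ∈ Finset.range r, act (rf r i j l) f

lemma zOp_eq (c0 : ℂ) (c : ℕ → ℂ) (i : Fin n) (f : Pol n) :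
    zOp r c0 c i f = yxOp r c0 c i f + c0 • rfSum r i (Finset.Iio i) f :=
  zOp_apply r c0 c i f

lemma act_pm_rfSum (σ : Equiv.Perm (Fin n)) {i : Fin n} {A : Finset (Fin n)} (hA : i ∉ A)
    (f : Pol n) : act (pm σ) (rfSum r i A f) =
      rfSum r (σ i) (A.map σ.toEmbedding) (act (pm σ) f) := by
  rw [rfSum, rfSum, Finset.sum_map, map_sum]
  refine Finset.sum_congr rfl fun j hj => ?_
  rw [map_sum]
  refine Finset.sum_congr rfl fun l _ => ?_
  rw [← act_mul, pm_mul_rf σ ((fun e => hA (e ▸ hj) : j ≠ i)), act_mul]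
  rfl

lemma act_dunkl (hr : 1 < r) (hp : p ∣ r) (c0 : ℂ) {c : ℕ → ℂ}
    (hc : ∀ l : ℕ, ¬ p ∣ l → c l = 0) (σ : Equiv.Perm (Fin n)) (i : Fin n) (f : Pol n) :
    act (pm σ) (dunkl r c0 c i f) = dunkl r c0 c (σ i) (act (pm σ) f) := by
  have := act_dunklV hr hp c0 hc ⟨pm σ, pm_mem r p σ⟩ f (yv i)
  rwa [pm_yv, dunklV_yv, dunklV_yv] at this

lemma act_pm_yxOp (hr : 1 < r) (hp : p ∣ r) (c0 : ℂ) {c : ℕ → ℂ}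
    (hc : ∀ l : ℕ, ¬ p ∣ l → c l = 0) (σ : Equiv.Perm (Fin n)) (i : Fin n) (f : Pol n) :
    act (pm σ) (yxOp r c0 c i f) = yxOp r c0 c (σ i) (act (pm σ) f) := by
  rw [yxOp, yxOp, act_dunkl hr hp c0 hc, map_mul, act_pm_px]

/-- The transposition carries `y_i x_i` to `y_j x_j` and fixes each index below `i`. Since `j` is
the successor of `i`, the sums `φ_i` and `φ_j` then differ only by the reflections involving both
`i` and `j`. -/
lemma zOp_act_swap_right (hr : 1 < r) (hp : p ∣ r) (c0 : ℂ) {c : ℕ → ℂ}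
    (hc : ∀ l : ℕ, ¬ p ∣ l → c l = 0) {i j : Fin n} (hij : (i : ℕ) + 1 = j) (f : Pol n) :
    zOp r c0 c j (act (sw i j) f) = act (sw i j) (zOp r c0 c i f) +
      c0 • ∑ l ∈ Finset.range r, act (rf r j i l) (act (sw i j) f) := by
  have h1 : (Finset.Iio i).map (Equiv.swap i j).toEmbedding = Finset.Iio i := by
    rw [← Finset.coe_inj, Finset.coe_map]
    have : ∀ x ∈ Finset.Iio i, Equiv.swap i j x = x := fun x hx => by
      rw [Finset.mem_Iio, Fin.lt_def] at hx
      exact Equiv.swap_apply_of_ne_of_ne (fun e => by rw [e] at hx; omega)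
        fun e => by rw [e] at hx; omega
    exact (Set.image_congr fun x hx => this x hx).trans (Set.image_id _)
  have h2 : Finset.Iio j = insert i (Finset.Iio i) := by
    ext x; simp only [Finset.mem_Iio, Finset.mem_insert, Fin.lt_def, Fin.ext_iff]; omega
  rw [zOp_eq, zOp_eq, map_add, map_smul, sw_eq_pm, act_pm_yxOp hr hp c0 hc, act_pm_rfSum _ (by simp),
    h1, h2, Equiv.swap_apply_left, add_assoc, ← smul_add]
  congr 2
  rw [rfSum, Finset.sum_insert (by simp), add_comm]
  rfl

lemma act_sw_sw (i j : Fin n) (f : Pol n) : act (sw i j) (act (sw i j) f) = f := by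
  have : sw i j * sw i j = 1 := by
    rw [sw_eq_pm, ← pm_mul, Equiv.swap_mul_self, pm_one]
  rw [← act_mul, this, act_one]

lemma zOp_act_swap_left (hr : 1 < r) (hp : p ∣ r) (c0 : ℂ) {c : ℕ → ℂ}
    (hc : ∀ l : ℕ, ¬ p ∣ l → c l = 0) {i j : Fin n} (hij : (i : ℕ) + 1 = j) (f : Pol n) :
    zOp r c0 c i (act (sw i j) f) = act (sw i j) (zOp r c0 c j f) -
      c0 • ∑ l ∈ Finset.range r, act (sw i j) (act (rf r j i l) f) := by
  have h := zOp_act_swap_right hr hp c0 hc hij (act (sw i j) f)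
  rw [act_sw_sw] at h
  rw [h, map_add, act_sw_sw, map_smul, map_sum, add_sub_cancel_right]

/-- The adjacent indices `i` and `j` lie on the same side of `m`, so the summation range of `φ_m` is
preserved. -/
lemma zOp_act_swap_of_ne (hr : 1 < r) (hp : p ∣ r) (c0 : ℂ) {c : ℕ → ℂ}
    (hc : ∀ l : ℕ, ¬ p ∣ l → c l = 0) {i j m : Fin n} (hij : (i : ℕ) + 1 = j) (hi : m ≠ i)
    (hj : m ≠ j) (f : Pol n) :
    zOp r c0 c m (act (sw i j) f) = act (sw i j) (zOp r c0 c m f) := by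
  have h1 : (Finset.Iio m).map (Equiv.swap i j).toEmbedding = Finset.Iio m := by
    refine Finset.map_eq_of_subset fun x hx => ?_
    rw [Finset.mem_map] at hx
    obtain ⟨y, hy, rfl⟩ := hx
    rw [Finset.mem_Iio, Fin.lt_def] at hy
    have hi' : (m : ℕ) ≠ i := fun e => hi (Fin.ext e)
    have hj' : (m : ℕ) ≠ j := fun e => hj (Fin.ext e)
    rw [Equiv.coe_toEmbedding, Equiv.swap_apply_def, Finset.mem_Iio, Fin.lt_def]
    split_ifs with h1 h2
    · rw [h1] at hy; omega
    · rw [h2] at hy; omega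
    · exact hy
  rw [zOp_eq, zOp_eq, map_add, map_smul, sw_eq_pm, act_pm_yxOp hr hp c0 hc, act_pm_rfSum _ (by simp),
    h1, Equiv.swap_apply_of_ne_of_ne hi hj]

/-- Moving `x_m` to the left of `y_i x_i`, for `m ≠ i`. -/
lemma yxOp_px_mul (c0 : ℂ) (c : ℕ → ℂ) {i m : Fin n} (hm : m ≠ i) (f : Pol n) :
    yxOp r c0 c i (px m * f) = px m * (yxOp r c0 c i f + c0 • rfSum r i {m} f) := by
  have hpow : ∀ l, (zeta r : ℂ) ^ l ≠ 0 := fun l => pow_ne_zero _ (zeta_ne_zero r)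
  rw [yxOp, mul_left_comm, dunkl_px_mul, ← yxOp, xv_yv, if_neg hm, zero_smul, add_zero]
  rw [Finset.sum_eq_zero fun l _ => ?_, zero_add, Finset.sum_eq_single m]
  · rw [rfSum, Finset.sum_singleton, mul_add, sub_eq_add_neg, mul_smul_comm, Finset.mul_sum,
      Finset.smul_sum, ← Finset.sum_neg_distrib]
    congr 1
    refine Finset.sum_congr rfl fun l _ => ?_
    rw [dualAct_rf r hm, if_neg hm, if_pos rfl, map_mul, act_px, dualAct_rf r hm, if_pos rfl]
    simp only [LinearMap.smul_apply, xv_yv, if_true, map_smul, lin_xv, smul_eq_mul, mul_one,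
      zero_sub, smul_mul_assoc, smul_smul]
    rw [← neg_smul]
    congr 1
    have := hpow l
    field_simp
  · intro j hj hjm
    refine Finset.sum_eq_zero fun l _ => ?_
    rw [dualAct_rf r (Finset.ne_of_mem_erase hj), if_neg hm, if_neg hjm.symm, xv_yv, if_neg hm]
    simp
  · intro h
    simp [hm] at h
  · rw [dualAct_zt, if_neg hm, xv_yv, if_neg hm]
    simp

/-- The element `∑_l c_l (1 - ζ^{-l}) ζ_i^l`. -/
def ztSum (r : ℕ) (c : ℕ → ℂ) (i : Fin n) (f : Pol n) : Pol n :=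
  ∑ l ∈ Finset.Ico 1 r, (c l * (1 - ((zeta r : ℂ) ^ l)⁻¹)) • act (zt r i ^ l) f

lemma dunkl_px_mul_self (c0 : ℂ) (c : ℕ → ℂ) (i : Fin n) (f : Pol n) :
    dunkl r c0 c i (px i * f) = px i * dunkl r c0 c i f + f - ztSum r c i f -
      c0 • rfSum r i (Finset.univ.erase i) f := by
  rw [dunkl_px_mul, sub_sub, xv_yv, if_pos rfl, one_smul, rfSum, Finset.smul_sum]
  congr 2
  · refine Finset.sum_congr rfl fun l _ => ?_
    rw [dualAct_zt, if_pos rfl]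
    simp [xv_yv]
  · refine Finset.sum_congr rfl fun j hj => ?_
    rw [Finset.smul_sum]
    refine Finset.sum_congr rfl fun l _ => ?_
    rw [dualAct_rf r (Finset.ne_of_mem_erase hj), if_pos rfl]
    simp [xv_yv, Finset.ne_of_mem_erase hj]

end Intertwining

/-! ### The raising and lowering operators -/

section Cyclic

variable {r p m : ℕ}

/-- For the last index `φ` runs over all other indices and cancels the `c_0` part of the commutator
of `y` and `x`. This is why the raising operator multiplies by the last variable. -/
lemma zOp_last (c0 : ℂ) (c : ℕ → ℂ) (f : Pol (m + 1)) :
    zOp r c0 c (Fin.last m) f =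
      px (Fin.last m) * dunkl r c0 c (Fin.last m) f + f - ztSum r c (Fin.last m) f := by
  have : Finset.univ.erase (Fin.last m) = Finset.Iio (Fin.last m) := by
    ext x; rw [Finset.mem_Iio, Fin.lt_last_iff_ne_last]; simp
  rw [zOp_eq, yxOp, dunkl_px_mul_self, this, sub_add_cancel]

/-- The cyclic permutation `i + 1 ↦ i`. -/
def cyc (m : ℕ) : Equiv.Perm (Fin (m + 1)) := (finRotate (m + 1)).symm

lemma cyc_symm (i : Fin (m + 1)) : (cyc m).symm i = i + 1 := by
  rw [cyc, Equiv.symm_symm, finRotate_apply]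

lemma cyc_add_one (i : Fin (m + 1)) : cyc m (i + 1) = i := by
  rw [← cyc_symm, Equiv.apply_symm_apply]

lemma cyc_zero : cyc m 0 = Fin.last m := by
  rw [← Fin.last_add_one m, cyc_add_one]

/-- The raising operator. -/
def raise (f : Pol (m + 1)) : Pol (m + 1) := px (Fin.last m) * act (pm (cyc m)) f

/-- The lowering operator. -/
def lowerOp (r : ℕ) (c0 : ℂ) (c : ℕ → ℂ) (f : Pol (m + 1)) : Pol (m + 1) :=
  act (pm (cyc m))⁻¹ (dunkl r c0 c (Fin.last m) f)

/-- Raising is also multiplication by the first variable followed by the cyclic permutation. Undoing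
the permutation therefore leaves `y_1 x_1`, which is `z_1` because `φ_1` is an empty sum. -/
lemma lowerOp_raise (hr : 1 < r) (hp : p ∣ r) (c0 : ℂ) {c : ℕ → ℂ}
    (hc : ∀ l : ℕ, ¬ p ∣ l → c l = 0) (f : Pol (m + 1)) :
    lowerOp r c0 c (raise f) = zOp r c0 c 0 f := by
  have h : dunkl r c0 c (Fin.last m) (raise f) = act (pm (cyc m)) (yxOp r c0 c 0 f) := by
    rw [act_pm_yxOp hr hp c0 hc, cyc_zero]; rfl
  rw [lowerOp, h, act_inv_act, zOp_eq, rfSum, show Finset.Iio (0 : Fin (m + 1)) = ∅ from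
    by ext x; simp, Finset.sum_empty, smul_zero, add_zero]

lemma raise_lowerOp (c0 : ℂ) (c : ℕ → ℂ) (f : Pol (m + 1)) :
    raise (lowerOp r c0 c f) = zOp r c0 c (Fin.last m) f - f + ztSum r c (Fin.last m) f := by
  rw [raise, lowerOp, act_act_inv, zOp_last]
  abel

lemma zOp_last_raise (hr : 1 < r) (hp : p ∣ r) (c0 : ℂ) {c : ℕ → ℂ}
    (hc : ∀ l : ℕ, ¬ p ∣ l → c l = 0) (f : Pol (m + 1)) :
    zOp r c0 c (Fin.last m) (raise f) =
      raise (zOp r c0 c 0 f) + raise f - ztSum r c (Fin.last m) (raise f) := by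
  rw [zOp_last, ← lowerOp_raise hr hp c0 hc f]
  conv_rhs => rw [raise, lowerOp, act_act_inv]

/-- Moving the last variable past `y_i x_i` produces the reflections linking `i` to the last index.
They are the images of the reflections linking `i + 1` to the first index, so `φ_{i+1}` is
reproduced in full. -/
lemma zOp_raise (hr : 1 < r) (hp : p ∣ r) (c0 : ℂ) {c : ℕ → ℂ}
    (hc : ∀ l : ℕ, ¬ p ∣ l → c l = 0) {i : Fin (m + 1)} (hi : i ≠ Fin.last m) (f : Pol (m + 1)) :
    zOp r c0 c i (raise f) = raise (zOp r c0 c (i + 1) f) := by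
  have hlt : (i : ℕ) < m := Fin.val_lt_last hi
  have hi1 : ((i + 1 : Fin (m + 1)) : ℕ) = i + 1 := Fin.val_add_one_of_lt' (by omega)
  -- The first index wraps around to the last, and every other index drops by one.
  have h1 : (Finset.Iio (i + 1)).map (cyc m).toEmbedding = insert (Fin.last m) (Finset.Iio i) := by
    ext x
    rw [Finset.mem_map_equiv, cyc_symm, Finset.mem_insert, Finset.mem_Iio, Finset.mem_Iio,
      Fin.lt_def, Fin.lt_def, hi1]
    by_cases hx : x = Fin.last m
    · simp [hx]
    · have := Fin.val_lt_last hx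
      rw [Fin.val_add_one_of_lt' (by omega)]
      simp [hx]
  have hnot : Fin.last m ∉ Finset.Iio i := by simp [Fin.le_last]
  have h2 : rfSum r i (Finset.Iio i) (raise f) =
      px (Fin.last m) * rfSum r i (Finset.Iio i) (act (pm (cyc m)) f) := by
    rw [rfSum, rfSum, Finset.mul_sum]
    refine Finset.sum_congr rfl fun j hj => ?_
    rw [Finset.mul_sum]
    refine Finset.sum_congr rfl fun l _ => ?_
    have hj' : j ≠ i := (Finset.mem_Iio.1 hj).ne
    rw [raise, map_mul, act_px, dualAct_rf r hj', if_neg hi.symm,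
      if_neg (fun e => hnot (e ▸ hj) : ¬ Fin.last m = j), lin_xv]
  rw [zOp_eq, zOp_eq, h2, raise, raise, yxOp_px_mul c0 c hi.symm, map_add, map_smul,
    act_pm_yxOp hr hp c0 hc, act_pm_rfSum _ (by simp), cyc_add_one, h1, ← mul_smul_comm, ← mul_add,
    add_assoc, ← smul_add]
  congr 3
  rw [rfSum, rfSum, rfSum, Finset.sum_insert hnot, Finset.sum_singleton]

end Cyclic

/-! ### Joint eigenvectors -/

section Eigen

variable {r p n : ℕ}

/-- The eigenvalue of a diagonal matrix on `x^μ`. -/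
def tw (a : Fin n → ℂˣ) (μ : Fin n → ℕ) : ℂ := ∏ i, ((a i : ℂ)⁻¹) ^ μ i

lemma tw_mul (a b : Fin n → ℂˣ) (μ : Fin n → ℕ) : tw (a * b) μ = tw a μ * tw b μ := by
  simp only [tw, Pi.mul_apply, Units.val_mul, mul_inv, mul_pow, Finset.prod_mul_distrib]

lemma tw_inv (a : Fin n → ℂˣ) (μ : Fin n → ℕ) : tw a⁻¹ μ = (tw a μ)⁻¹ := by
  simp [tw]

lemma tw_pow (a : Fin n → ℂˣ) (l : ℕ) (μ : Fin n → ℕ) : tw (a ^ l) μ = tw a μ ^ l := by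
  induction l with
  | zero => simp [tw]
  | succ l ih => rw [pow_succ, tw_mul, ih, pow_succ]

lemma tw_mulSingle (i : Fin n) (z : ℂˣ) (μ : Fin n → ℕ) :
    tw (Pi.mulSingle i z) μ = ((z : ℂ)⁻¹) ^ μ i := by
  rw [tw, Finset.prod_eq_single i]
  · simp
  · intro m _ hm
    simp [Pi.mulSingle_eq_of_ne hm]
  · simp

lemma tw_comp (a : Fin n → ℂˣ) (μ : Fin n → ℕ) (σ : Equiv.Perm (Fin n)) :
    tw (a ∘ σ) (μ ∘ σ) = tw a μ :=
  Equiv.prod_comp σ fun i => ((a i : ℂ)⁻¹) ^ μ i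

lemma pow_eq_one_of_dg_mem {a : Fin n → ℂˣ} (ha : dg a ∈ G r p n) (i : Fin n) :
    (a i : ℂ) ^ r = 1 := by
  obtain ⟨σ, b, h1, -, h3⟩ := ha
  have := h3 (fun _ => 1) i
  rw [dg_apply, mul_one, mul_one] at this
  rw [this, h1]

lemma tw_congr {a : Fin n → ℂˣ} (ha : dg a ∈ G r p n) {μ ν : Fin n → ℕ}
    (h : ∀ i, μ i ≡ ν i [MOD r]) : tw a μ = tw a ν := by
  refine Finset.prod_congr rfl fun i _ => ?_
  exact pow_eq_pow_of_modEq (h i) (by rw [inv_pow, pow_eq_one_of_dg_mem ha, inv_one])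

lemma dg_comp_mem {a : Fin n → ℂˣ} (ha : dg a ∈ G r p n) (σ : Equiv.Perm (Fin n)) :
    dg (a ∘ σ) ∈ G r p n := by
  have : dg (a ∘ σ) = (pm σ)⁻¹ * dg a * pm σ := by
    rw [mul_assoc, dg_mul_pm, inv_mul_cancel_left]
  rw [this]
  exact mul_mem (mul_mem (inv_mem (pm_mem r p σ)) ha) (pm_mem r p σ)

lemma act_dg_act_pm (a : Fin n → ℂˣ) (σ : Equiv.Perm (Fin n)) (f : Pol n) :
    act (dg a) (act (pm σ) f) = act (pm σ) (act (dg (a ∘ σ)) f) := by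
  rw [← act_mul, dg_mul_pm, act_mul]

/-- The index set of the commuting operators: the `z_i` and the diagonal matrices. -/
abbrev Idx (r p n : ℕ) : Type := Fin n ⊕ {a : Fin n → ℂˣ // dg a ∈ G r p n}

/-- The commuting operators. -/
def opK (r p n : ℕ) (c0 : ℂ) (c : ℕ → ℂ) : Idx r p n → Pol n →ₗ[ℂ] Pol n :=
  Sum.elim (zOp r c0 c) fun a => (act (dg a.1)).toLinearMap

/-- The eigenvalues attached to an exponent `μ` and a position function `v`. -/
def gwt (r p : ℕ) {n : ℕ} (c0 : ℂ) (c : ℕ → ℂ) (μ : Fin n → ℕ) (v : Fin n → ℕ) :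
    Idx r p n → ℂ :=
  Sum.elim (fun i => (μ i : ℂ) + 1 - (dpar r c 0 - dpar r c (-((μ i : ℤ) + 1))) - r * c0 * v i)
    fun a => tw a.1 μ

/-- The eigenvalues attached to an exponent `μ`. -/
def wtK (r p n : ℕ) (c0 : ℂ) (c : ℕ → ℂ) (κ : Idx r p n) (μ : Fin n → ℕ) : ℂ :=
  gwt r p c0 c μ (rk μ) κ

lemma isTriangular_opK (r p n : ℕ) (c0 : ℂ) (c : ℕ → ℂ) :
    IsTriangular (monoBasis n) ExpLT (opK r p n c0 c) (wtK r p n c0 c) := by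
  have e : ∀ μ, Submodule.span ℂ (monoBasis n '' {ν | ExpLT ν μ}) = lower μ := fun μ => by
    rw [lower]
    congr 1
    exact Set.image_congr fun x _ => monoBasis_apply x
  rintro (i | a) μ
  · rw [e, monoBasis_apply]
    exact zOp_mono_sub_mem r c0 c i μ
  · rw [monoBasis_apply]
    have : opK r p n c0 c (Sum.inr a) (mono μ) = wtK r p n c0 c (Sum.inr a) μ • mono μ :=
      act_dg_mono a.1 μ
    rw [this, sub_self]
    exact zero_mem _

/-- The operators that generate `𝔱`. -/
def IsGen (r p n : ℕ) : Idx r p n → Prop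
  | .inl _ => True
  | .inr a => (∃ i j : Fin n, (i : ℕ) + 1 = j ∧
      a.1 = Pi.mulSingle i (zeta r) * (Pi.mulSingle j (zeta r))⁻¹) ∨
      ∃ i : Fin n, a.1 = Pi.mulSingle i (zeta r) ^ p

lemma zt_mul_inv_eq_dg (r : ℕ) (i j : Fin n) :
    zt r i * (zt r j)⁻¹ = dg (Pi.mulSingle i (zeta r) * (Pi.mulSingle j (zeta r))⁻¹) := by
  rw [zt, zt, dg_inv, dg_mul]

lemma zt_pow_eq_dg (r : ℕ) (i : Fin n) (l : ℕ) :
    zt r i ^ l = dg (Pi.mulSingle i (zeta r) ^ l) := by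
  rw [zt, dg_pow]

/-- An exponent and its position function are determined by the eigenvalues of the generators
of `𝔱`, among all sortings of exponents. -/
lemma Generic.gwt_unique (hr : 1 < r) (hp : p ∣ r) {c0 : ℂ} {c : ℕ → ℂ}
    (hc : ∀ l : ℕ, ¬ p ∣ l → c l = 0) {k : ℕ} (hg : Generic r n c0 c k)
    {μ ν : Fin n → ℕ} {v : Equiv.Perm (Fin n)} (hv : ∀ a b, v a < v b → μ a ≤ μ b)
    (h : ∀ κ, IsGen r p n κ → wtK r p n c0 c κ ν = gwt r p c0 c μ (fun i => v i) κ) :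
    ν = μ := by
  have hζ : IsPrimitiveRoot ((zeta r : ℂ)⁻¹) r := (isPrimitiveRoot_zeta (by omega)).inv
  have hζ0 : ((zeta r : ℂ)⁻¹) ≠ 0 := inv_ne_zero (zeta_ne_zero r)
  -- The eigenvalue of `ζ_i ζ_{i+1}⁻¹` compares neighbouring differences modulo `r`; that of `ζ_i^p`
  -- determines each difference modulo `r / p`.
  have hadj : ∀ i j : Fin n, (i : ℕ) + 1 = j →
      (r : ℤ) ∣ ((μ i : ℤ) - ν i) - ((μ j : ℤ) - ν j) := by
    intro i j hij
    have hmem : dg (Pi.mulSingle i (zeta r) * (Pi.mulSingle j (zeta r))⁻¹) ∈ G r p n := by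
      rw [← zt_mul_inv_eq_dg]; exact quot_mem r p i j
    have := h (Sum.inr ⟨_, hmem⟩) (Or.inl ⟨i, j, hij, rfl⟩)
    simp only [wtK, gwt, Sum.elim_inr, tw_mul, tw_inv, tw_mulSingle] at this
    rw [← hζ.zpow_eq_one_iff_dvd, zpow_sub₀ hζ0, zpow_sub₀ hζ0, zpow_sub₀ hζ0]
    simp only [zpow_natCast]
    rw [← div_eq_mul_inv, ← div_eq_mul_inv, div_eq_div_iff (pow_ne_zero _ hζ0)
      (pow_ne_zero _ hζ0)] at this
    rw [div_div_div_eq, div_eq_one_iff_eq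
      (mul_ne_zero (pow_ne_zero _ hζ0) (pow_ne_zero _ hζ0)), ← this, mul_comm]
  have hmod' : ∀ i, (r : ℤ) ∣ p * ((μ i : ℤ) - ν i) := by
    intro i
    have hmem : dg (Pi.mulSingle i (zeta r) ^ p) ∈ G r p n := by
      rw [← zt_pow_eq_dg]; exact ztp_mem hp i
    have := h (Sum.inr ⟨_, hmem⟩) (Or.inr ⟨i, rfl⟩)
    simp only [wtK, gwt, Sum.elim_inr, tw_pow, tw_mulSingle] at this
    rw [← hζ.zpow_eq_one_iff_dvd, mul_sub, zpow_sub₀ hζ0, div_eq_one_iff_eq (zpow_ne_zero _ hζ0)]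
    rw [← pow_mul, ← pow_mul, mul_comm, mul_comm (μ i)] at this
    exact_mod_cast this.symm
  have hmod0 : ∀ (i j : Fin n), (i : ℕ) ≤ j → (r : ℤ) ∣ ((μ i : ℤ) - ν i) - ((μ j : ℤ) - ν j) := by
    rintro i ⟨j, hj⟩ hij
    simp only at hij
    induction j, hij using Nat.le_induction with
    | base => rw [show (⟨i, hj⟩ : Fin n) = i from rfl, sub_self]; exact dvd_zero _
    | succ j hij ih =>
      have h1 := ih (by omega)
      have h2 := hadj ⟨j, by omega⟩ ⟨j + 1, hj⟩ rfl
      have := dvd_add h1 h2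
      rwa [sub_add_sub_cancel] at this
  have hmod : ∀ i j : Fin n, (r : ℤ) ∣ ((μ i : ℤ) - ν i) - ((μ j : ℤ) - ν j) := by
    intro i j
    rcases le_total (i : ℕ) j with hij | hij
    · exact hmod0 i j hij
    · rw [← neg_sub, Int.dvd_neg]
      exact hmod0 j i hij
  refine (hg.sorted_eq hr hc hv (u := rkPerm ν) le_of_rkPerm_lt hmod hmod' fun i => ?_).1.symm
  have h1 := h (Sum.inl i) trivial
  -- The congruence from `ζ_i^p` makes the `d`-terms agree, so the eigenvalues of `z_i` compare only
  -- exponents and ranks.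
  have hd : dpar r c (-((μ i : ℤ) + 1)) = dpar r c (-((ν i : ℤ) + 1)) := by
    refine dpar_congr (p := p) (by omega) hc ?_
    have := hmod' i
    rw [← Int.dvd_neg] at this
    convert this using 1
    ring
  simp only [wtK, gwt, Sum.elim_inl, hd] at h1
  rw [rkPerm_val]
  linear_combination -h1

lemma Generic.wtK_injective (hr : 1 < r) (hp : p ∣ r) {c0 : ℂ} {c : ℕ → ℂ}
    (hc : ∀ l : ℕ, ¬ p ∣ l → c l = 0) {k : ℕ} (hg : Generic r n c0 c k) {μ ν : Fin n → ℕ}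
    (h : ∀ κ, IsGen r p n κ → wtK r p n c0 c κ ν = wtK r p n c0 c κ μ) : ν = μ :=
  hg.gwt_unique hr hp hc (v := rkPerm μ) le_of_rkPerm_lt h

/-- The sum of the `l`-th powers of a power of `ζ`. -/
lemma sum_zeta_pow (hr : 1 < r) (a b : ℕ) :
    ∑ l ∈ Finset.range r, ((zeta r : ℂ) ^ a * ((zeta r : ℂ)⁻¹) ^ b) ^ l =
      if a ≡ b [MOD r] then (r : ℂ) else 0 := by
  have hζ := isPrimitiveRoot_zeta (r := r) (by omega)
  have hζ0 := zeta_ne_zero r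
  have h1 : (zeta r : ℂ) ^ a * ((zeta r : ℂ)⁻¹) ^ b = 1 ↔ a ≡ b [MOD r] := by
    have h2 : (zeta r : ℂ) ^ a = zeta r ^ b ↔ zeta r ^ a = zeta r ^ b := by
      rw [← Units.val_inj]; simp
    rw [inv_pow, mul_inv_eq_one₀ (pow_ne_zero _ hζ0), h2, pow_eq_pow_iff_modEq,
      ← orderOf_units, ← hζ.eq_orderOf]
  split_ifs with h
  · rw [h1.2 h]; simp
  · have hne : (zeta r : ℂ) ^ a * ((zeta r : ℂ)⁻¹) ^ b - 1 ≠ 0 := sub_ne_zero.2 fun e => h (h1.1 e)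
    refine mul_right_cancel₀ hne ?_
    rw [geom_sum_mul, zero_mul, mul_pow, pow_right_comm, hζ.pow_eq_one, one_pow, one_mul,
      pow_right_comm, inv_pow, hζ.pow_eq_one]
    simp

end Eigen

/-! ### Adjacent transpositions -/

/-- The parameters considered in the theorem. -/
structure Special (r p n : ℕ) (c0 : ℂ) (c : ℕ → ℂ) (k : ℕ) : Prop extends Generic r n c0 c k where
  one_lt : 1 < r
  dvd : p ∣ r
  supp : ∀ l : ℕ, ¬ p ∣ l → c l = 0
  pos : 0 < k

section Swap

variable {r p n k : ℕ} {c0 : ℂ} {c : ℕ → ℂ}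

lemma sw_mul_zt_inv (i j : Fin n) (l : ℕ) :
    sw i j * (zt r j ^ l)⁻¹ = (zt r i ^ l)⁻¹ * sw i j := by
  rw [zt, zt, dg_pow, dg_pow, dg_inv, dg_inv, sw_eq_pm, dg_mul_pm]
  congr 2
  funext x
  simp only [Pi.inv_apply, Pi.pow_apply, Function.comp_apply, Pi.mulSingle_apply,
    Equiv.swap_apply_eq_iff, Equiv.swap_apply_left]

lemma sw_mul_zt (i j : Fin n) (l : ℕ) : sw i j * zt r j ^ l = zt r i ^ l * sw i j := by
  rw [zt, zt, dg_pow, dg_pow, sw_eq_pm, dg_mul_pm]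
  congr 2
  funext x
  simp only [Pi.pow_apply, Function.comp_apply, Pi.mulSingle_apply,
    Equiv.swap_apply_eq_iff, Equiv.swap_apply_left]

lemma sw_mul_self (i j : Fin n) : sw i j * sw i j = 1 := by
  rw [sw_eq_pm, ← pm_mul, Equiv.swap_mul_self, pm_one]

/-- The diagonal matrix `ζ_i ζ_j⁻¹`. -/
def quotDg (r : ℕ) (i j : Fin n) : Fin n → ℂˣ :=
  Pi.mulSingle i (zeta r) * (Pi.mulSingle j (zeta r))⁻¹

lemma dg_quotDg_pow (i j : Fin n) (l : ℕ) :
    dg (quotDg r i j ^ l) = zt r i ^ l * (zt r j ^ l)⁻¹ := by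
  rw [zt, zt, dg_pow, dg_pow, dg_inv, dg_mul, quotDg, mul_pow, inv_pow]

lemma dg_quotDg_pow_mem (r p : ℕ) (i j : Fin n) (l : ℕ) : dg (quotDg r i j ^ l) ∈ G r p n := by
  rw [← dg_pow, quotDg, ← zt_mul_inv_eq_dg]
  exact pow_mem (quot_mem r p i j) l

lemma tw_quotDg_pow (i j : Fin n) (l : ℕ) (μ : Fin n → ℕ) :
    tw (quotDg r i j ^ l) μ = ((zeta r : ℂ) ^ μ j * ((zeta r : ℂ)⁻¹) ^ μ i) ^ l := by
  rw [tw_pow, quotDg, tw_mul, tw_inv, tw_mulSingle, tw_mulSingle, inv_pow, inv_pow, inv_inv,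
    mul_comm]

lemma rf_mul_sw (i j : Fin n) (l : ℕ) : rf r j i l * sw i j = dg (quotDg r j i ^ l) := by
  have h : sw j i = sw i j := by rw [sw_eq_pm, sw_eq_pm, Equiv.swap_comm]
  rw [dg_quotDg_pow, rf, h, mul_assoc _ (sw i j), sw_mul_zt_inv, mul_assoc, mul_assoc,
    sw_mul_self, mul_one]

lemma sw_mul_rf (i j : Fin n) (l : ℕ) : sw i j * rf r j i l = dg (quotDg r i j ^ l) := by
  have h : sw j i = sw i j := by rw [sw_eq_pm, sw_eq_pm, Equiv.swap_comm]
  rw [dg_quotDg_pow, rf, h, ← mul_assoc, ← mul_assoc, sw_mul_zt, mul_assoc (_ ^ l), sw_mul_self,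
    mul_one]

lemma IsEigen.act_dg {l : Idx r p n → ℂ} {f : Pol n} (hf : IsEigen (opK r p n c0 c) l f)
    {a : Fin n → ℂˣ} (ha : dg a ∈ G r p n) : act (dg a) f = l (Sum.inr ⟨a, ha⟩) • f :=
  hf (Sum.inr ⟨a, ha⟩)

lemma IsEigen.zOp {l : Idx r p n → ℂ} {f : Pol n} (hf : IsEigen (opK r p n c0 c) l f)
    (i : Fin n) : zOp r c0 c i f = l (Sum.inl i) • f :=
  hf (Sum.inl i)

lemma IsEigen.sum_quotDg (hr : 1 < r) {μ : Fin n → ℕ} {f : Pol n}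
    (hf : IsEigen (opK r p n c0 c) (fun κ => wtK r p n c0 c κ μ) f) (i j : Fin n) :
    ∑ l ∈ Finset.range r, act (dg (quotDg r i j ^ l)) f =
      (if μ j ≡ μ i [MOD r] then (r : ℂ) else 0) • f := by
  rw [← sum_zeta_pow hr, Finset.sum_smul]
  refine Finset.sum_congr rfl fun l _ => ?_
  rw [hf.act_dg (dg_quotDg_pow_mem r p i j l)]
  congr 1
  exact tw_quotDg_pow i j l μ

/-- Commuting `z_i` or `z_j` past the transposition leaves `c_0` times a sum of powers of `ζ_i
ζ_j⁻¹` or its inverse, which acts on `f` by `r` or `0` according to the congruence. The equation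
`he` makes this cancel against the term `e • f`; `he0` lets the diagonal matrices act on both
summands by one scalar. The ranks are written `rk μ ∘ swap` so that ties are also covered. -/
lemma IsEigen.swap (hr : 1 < r) (hp : p ∣ r) (hc : ∀ l : ℕ, ¬ p ∣ l → c l = 0) {i j : Fin n}
    (hij : (i : ℕ) + 1 = j) {μ : Fin n → ℕ} {f : Pol n}
    (hf : IsEigen (opK r p n c0 c) (fun κ => wtK r p n c0 c κ μ) f) {e : ℂ}
    (he : e * (wtz r c0 c μ i - wtz r c0 c μ j) =
      c0 * if μ i ≡ μ j [MOD r] then (r : ℂ) else 0)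
    (he0 : e = 0 ∨ μ i ≡ μ j [MOD r]) :
    IsEigen (opK r p n c0 c)
      (gwt r p c0 c (μ ∘ Equiv.swap i j) (rk μ ∘ Equiv.swap i j)) (act (sw i j) f + e • f) := by
  have hz : ∀ m, Cherednik.zOp r c0 c m f = wtz r c0 c μ m • f := hf.zOp
  have hsymm : μ j ≡ μ i [MOD r] ↔ μ i ≡ μ j [MOD r] := ⟨Nat.ModEq.symm, Nat.ModEq.symm⟩
  rintro (m | ⟨a, ha⟩)
  · change Cherednik.zOp r c0 c m (act (sw i j) f + e • f) =
      wtz r c0 c μ (Equiv.swap i j m) • (act (sw i j) f + e • f)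
    rw [map_add, map_smul, hz]
    by_cases hj : m = j
    · subst hj
      have : ∑ l ∈ Finset.range r, act (rf r m i l) (act (sw i m) f) =
          ∑ l ∈ Finset.range r, act (dg (quotDg r m i ^ l)) f :=
        Finset.sum_congr rfl fun l _ => by rw [← act_mul, rf_mul_sw]
      rw [Equiv.swap_apply_right, zOp_act_swap_right hr hp c0 hc hij, this, hf.sum_quotDg hr, hz,
        map_smul, smul_add, add_assoc, smul_smul, smul_smul, smul_smul, ← add_smul]
      congr 2
      linear_combination -he
    · by_cases hi : m = i
      · subst hi
        have : ∑ l ∈ Finset.range r, act (sw m j) (act (rf r j m l) f) =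
            ∑ l ∈ Finset.range r, act (dg (quotDg r m j ^ l)) f :=
          Finset.sum_congr rfl fun l _ => by rw [← act_mul, sw_mul_rf]
        rw [Equiv.swap_apply_left, zOp_act_swap_left hr hp c0 hc hij, this, hf.sum_quotDg hr, hz,
          map_smul, smul_add, sub_eq_add_neg, add_assoc, smul_smul, smul_smul, smul_smul,
          ← neg_smul, ← add_smul]
        simp only [hsymm]
        congr 2
        linear_combination he
      · rw [Equiv.swap_apply_of_ne_of_ne hi hj, zOp_act_swap_of_ne hr hp c0 hc hij hi hj, hz,
          map_smul, smul_add, smul_comm e]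
  · change act (dg a) (act (sw i j) f + e • f) =
      tw a (μ ∘ Equiv.swap i j) • (act (sw i j) f + e • f)
    have h1 : tw (a ∘ Equiv.swap i j) μ = tw a (μ ∘ Equiv.swap i j) := by
      rw [← tw_comp _ _ (Equiv.swap i j)]
      congr 1
      funext x
      simp
    have hmem := dg_comp_mem ha (Equiv.swap i j)
    have h2 : act (dg (a ∘ Equiv.swap i j)) f = tw (a ∘ Equiv.swap i j) μ • f := hf.act_dg hmem
    have h3 : act (dg a) f = tw a μ • f := hf.act_dg ha
    rw [map_add, map_smul, sw_eq_pm, act_dg_act_pm, h2, h3, map_smul, h1, smul_add]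
    congr 1
    rcases he0 with rfl | he0
    · simp
    · rw [smul_comm, tw_congr ha]
      intro x
      rw [Function.comp_apply, Equiv.swap_apply_def]
      split_ifs with h1 h2
      · rw [h1]; exact he0
      · rw [h2]; exact he0.symm
      · rfl

/-- The coefficient is `c_0 / (m - c_0 q)`. Its being `1` or `-1` would mean `m = c_0 (q + 1)` or `m
= c_0 (q - 1)`; both are excluded, and the bound `q < n` is what admits `q + 1`. -/
lemma Generic.exists_coeff (hg : Generic r n c0 c k) {m q : ℕ} (hm : 1 ≤ m) (hq : 1 ≤ q)
    (hqn : q < n) : ∃ e : ℂ, e * (m - c0 * q) = c0 ∧ e ^ 2 ≠ 1 := by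
  have h0 : (m : ℂ) - c0 * q ≠ 0 := sub_ne_zero.2 (hg.ne_of_mul_eq hq hqn.le hm)
  have h1 := hg.ne_of_mul_eq (q := q + 1) (m := m) (by omega) hqn hm
  have h2 : (m : ℂ) ≠ c0 * (q - 1) := by
    rcases Nat.eq_or_lt_of_le hq with rfl | hq'
    · simp only [Nat.cast_one, sub_self, mul_zero]
      exact_mod_cast (by omega : m ≠ 0)
    · have := hg.ne_of_mul_eq (q := q - 1) (m := m) (by omega) (by omega) hm
      rwa [Nat.cast_sub hq, Nat.cast_one] at this
  refine ⟨c0 / (m - c0 * q), div_mul_cancel₀ _ h0, fun h => ?_⟩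
  rw [div_pow, div_eq_one_iff_eq (pow_ne_zero _ h0)] at h
  rcases sq_eq_sq_iff_eq_or_eq_neg.1 h with h | h
  · exact h1 (by push_cast; linear_combination -h)
  · exact h2 (by linear_combination h)

/-- For parts congruent modulo `r` the `d`-terms cancel and the weights differ by `±r (m - c_0 q)`,
with `q` the distance of the ranks. Otherwise `e = 0` works. -/
lemma Special.exists_coeff (hs : Special r p n c0 c k) {μ : Fin n → ℕ} {i j : Fin n}
    (hμ : μ i ≠ μ j) :
    ∃ e : ℂ, e * (wtz r c0 c μ i - wtz r c0 c μ j) =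
      c0 * (if μ i ≡ μ j [MOD r] then (r : ℂ) else 0) ∧ (e = 0 ∨ μ i ≡ μ j [MOD r]) ∧
      e ^ 2 ≠ 1 := by
  have hr := hs.one_lt
  split_ifs with hmod
  · have hd : dpar r c (-((μ i : ℤ) + 1)) = dpar r c (-((μ j : ℤ) + 1)) := by
      refine dpar_congr (p := p) (by omega) hs.supp (Dvd.dvd.mul_left ?_ _)
      have e : -((μ i : ℤ) + 1) - -((μ j : ℤ) + 1) = μ j - μ i := by ring
      rw [e]
      exact Nat.modEq_iff_dvd.1 hmod
    have hw : wtz r c0 c μ i - wtz r c0 c μ j =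
        ((μ i : ℂ) - μ j) - r * c0 * ((rk μ i : ℂ) - rk μ j) := by
      rw [wtz, wtz, hd]; ring
    rw [hw]
    rcases lt_or_gt_of_ne hμ with h | h
    · have hrk : rk μ i < rk μ j := rk_lt_iff.2 (Or.inl h)
      obtain ⟨m, hm⟩ := (Nat.modEq_iff_dvd' h.le).1 hmod
      obtain ⟨e, he, he'⟩ := hs.toGeneric.exists_coeff (m := m) (q := rk μ j - rk μ i)
        (Nat.pos_of_ne_zero fun e => by rw [e] at hm; omega) (by omega)
        (by have := rk_lt μ j; omega)
      rw [Nat.cast_sub hrk.le] at he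
      have hm' : (μ j : ℂ) - μ i = r * m := by
        rw [← Nat.cast_sub h.le, hm]; push_cast; ring
      exact ⟨-e, by linear_combination r * he + e * hm', Or.inr hmod, by rwa [neg_sq]⟩
    · have hrk : rk μ j < rk μ i := rk_lt_iff.2 (Or.inl h)
      obtain ⟨m, hm⟩ := (Nat.modEq_iff_dvd' h.le).1 hmod.symm
      obtain ⟨e, he, he'⟩ := hs.toGeneric.exists_coeff (m := m) (q := rk μ i - rk μ j)
        (Nat.pos_of_ne_zero fun e => by rw [e] at hm; omega) (by omega)
        (by have := rk_lt μ i; omega)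
      rw [Nat.cast_sub hrk.le] at he
      have hm' : (μ i : ℂ) - μ j = r * m := by
        rw [← Nat.cast_sub h.le, hm]; push_cast; ring
      exact ⟨e, by linear_combination r * he + e * hm', Or.inr hmod, he'⟩
  · exact ⟨0, by simp, Or.inl rfl, by simp⟩

/-- The intertwiner attached to an adjacent transposition that moves `μ`. -/
lemma Special.exists_swap (hs : Special r p n c0 c k) {i j : Fin n} (hij : (i : ℕ) + 1 = j)
    {μ : Fin n → ℕ} (hμ : μ i ≠ μ j) {f : Pol n}
    (hf : IsEigen (opK r p n c0 c) (fun κ => wtK r p n c0 c κ μ) f) (hf0 : f ≠ 0) :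
    ∃ e : ℂ, act (sw i j) f + e • f ≠ 0 ∧ IsEigen (opK r p n c0 c)
      (fun κ => wtK r p n c0 c κ (μ ∘ Equiv.swap i j)) (act (sw i j) f + e • f) := by
  have hlt : i < j := by rw [Fin.lt_def]; omega
  obtain ⟨e, he, he0, he2⟩ := hs.exists_coeff hμ
  refine ⟨e, fun h => ?_, ?_⟩
  -- If the combination vanished, the involution would act on `f` by `-e`, forcing `e ^ 2 = 1`.
  · have h1 : act (sw i j) f = (-e) • f := by rw [neg_smul]; exact eq_neg_of_add_eq_zero_left h
    have h2 := congrArg (act (sw i j)) h1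
    rw [act_sw_sw, map_smul, h1, smul_smul] at h2
    have h3 : (1 - e ^ 2) • f = 0 := by
      rw [sub_smul, one_smul, sub_eq_zero]
      convert h2 using 2
      ring
    rcases smul_eq_zero.1 h3 with h3 | h3
    · exact he2 (sub_eq_zero.1 h3).symm
    · exact hf0 h3
  · have := hf.swap hs.one_lt hs.dvd hs.supp hij he he0
    have hrk : rk (μ ∘ Equiv.swap i j) = rk μ ∘ Equiv.swap i j :=
      funext fun x => rk_comp_swap hlt hμ (fun m h1 h2 => by
        rw [Fin.lt_def] at h1 h2; omega) x
    intro κ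
    simp only [wtK, hrk]
    exact this κ

lemma rk_of_tie {μ : Fin n → ℕ} {i j : Fin n} (hij : (i : ℕ) + 1 = j) (h : μ i = μ j) :
    rk μ i = rk μ j + 1 := by
  have : (Finset.univ.filter fun x => Prec μ x i) =
      insert j (Finset.univ.filter fun x => Prec μ x j) := by
    ext x
    simp only [Finset.mem_filter, Finset.mem_univ, true_and, Finset.mem_insert]
    have hx : x = j → μ x = μ j := fun e => by rw [e]
    simp only [Prec, h, Fin.lt_def, Fin.ext_iff] at *
    omega
  rw [rk, this, Finset.card_insert_of_notMem (by simp [Prec.irrefl]), rk]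

/-- The adjacent transpositions fixing `μ` stabilize the line of eigenvectors. -/
lemma Special.swap_of_tie (hs : Special r p n c0 c k) {i j : Fin n} (hij : (i : ℕ) + 1 = j)
    {μ : Fin n → ℕ} (hμ : μ i = μ j) {f : Pol n}
    (hf : IsEigen (opK r p n c0 c) (fun κ => wtK r p n c0 c κ μ) f)
    (hfμ : (monoBasis n).repr f μ = 1) : ∃ e : ℂ, act (sw i j) f = e • f := by
  have hμs : μ ∘ Equiv.swap i j = μ := by
    funext x
    rw [Function.comp_apply, Equiv.swap_apply_def]
    split_ifs with h1 h2
    · rw [h1, hμ]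
    · rw [h2, hμ]
    · rfl
  have hw : wtz r c0 c μ i - wtz r c0 c μ j = -(r * c0) := by
    rw [wtz, wtz, rk_of_tie hij hμ, hμ]; push_cast; ring
  -- In a tie the two ranks are consecutive, so the weights differ by `-r c_0` and the coefficient
  -- is `-1`.
  have h := hf.swap hs.one_lt hs.dvd hs.supp hij (e := -1)
    (by rw [hw, hμ, if_pos (Nat.ModEq.refl _)]; ring) (Or.inr (by rw [hμ]))
  rw [hμs] at h
  set g := act (sw i j) f + (-1 : ℂ) • f with hgdef
  have huniq : ∀ ν, (∀ κ, IsGen r p n κ → wtK r p n c0 c κ ν =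
      gwt r p c0 c μ (rk μ ∘ Equiv.swap i j) κ) → ν = μ := fun ν hν => by
    refine hs.toGeneric.gwt_unique hs.one_lt hs.dvd hs.supp
      (v := (Equiv.swap i j).trans (rkPerm μ)) (fun a b hab => ?_) hν
    have := le_of_rkPerm_lt _ _ hab
    have e := fun x => congrFun hμs x
    simp only [Function.comp_apply] at e
    rwa [e, e] at this
  have ht := isTriangular_opK r p n c0 c
  have hsum : act (sw i j) f = g + f := by rw [hgdef]; simp
  by_cases hg0 : g = 0
  · exact ⟨1, by rw [hsum, hg0, zero_add, one_smul]⟩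
  -- A nonzero `g` has the weights of some exponent, which by uniqueness is `μ` itself, so `g` lies
  -- on the line of `f`.
  · have hgμ := ht.repr_ne_zero (fun _ _ _ => ExpLT.trans) ExpLT.irrefl
      (fun ν hν => huniq ν fun κ _ => hν κ) h hg0
    obtain ⟨x, hx, -, hwx⟩ := ht.exists_weight (fun _ _ _ => ExpLT.trans) ExpLT.irrefl h hgμ
    have hxμ := huniq x fun κ _ => hwx κ
    subst hxμ
    have hg' : IsEigen (opK r p n c0 c) (fun κ => wtK r p n c0 c κ x) g := fun κ => by
      simp only [h κ, hwx κ]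
    have := ht.eq_smul (fun _ _ _ => ExpLT.trans) ExpLT.irrefl (fun ν hν =>
      hs.toGeneric.wtK_injective hs.one_lt hs.dvd hs.supp fun κ _ => hν κ) hf hg' hfμ
    refine ⟨(monoBasis n).repr g x + 1, ?_⟩
    rw [add_smul, one_smul, hsum, ← this]

end Swap

/-! ### Exponents -/

section Exponents

variable {m : ℕ}

/-- The action of the raising operator on exponents. -/
def rot (μ : Fin (m + 1) → ℕ) : Fin (m + 1) → ℕ := fun i =>
  μ (i + 1) + if i = Fin.last m then 1 else 0

lemma rot_last (μ : Fin (m + 1) → ℕ) : rot μ (Fin.last m) = μ 0 + 1 := by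
  rw [rot, if_pos rfl, Fin.last_add_one]

lemma rot_of_ne (μ : Fin (m + 1) → ℕ) {i : Fin (m + 1)} (hi : i ≠ Fin.last m) :
    rot μ i = μ (i + 1) := by
  rw [rot, if_neg hi, add_zero]

/-- The part that wraps around goes from first to last place, hence from losing its ties to winning
them, but it also grows by one. The two effects compensate, so all precedences are kept. -/
lemma prec_rot (μ : Fin (m + 1) → ℕ) (i j : Fin (m + 1)) :
    Prec (rot μ) i j ↔ Prec μ (i + 1) (j + 1) := by
  have key : ∀ x : Fin (m + 1), (x = Fin.last m ∧ ((x + 1 : Fin (m + 1)) : ℕ) = 0 ∧ (x : ℕ) = m) ∨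
      (x ≠ Fin.last m ∧ ((x + 1 : Fin (m + 1)) : ℕ) = x + 1 ∧ (x : ℕ) < m) := fun x => by
    by_cases hx : x = Fin.last m
    · exact Or.inl ⟨hx, by rw [hx, Fin.last_add_one]; rfl, by rw [hx]; rfl⟩
    · have := Fin.val_lt_last hx
      exact Or.inr ⟨hx, Fin.val_add_one_of_lt' (by omega), this⟩
  simp only [Prec, rot, Fin.lt_def]
  rcases key i with ⟨hi, h1, h2⟩ | ⟨hi, h1, h2⟩ <;> rcases key j with ⟨hj, h3, h4⟩ | ⟨hj, h3, h4⟩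
  · rw [if_pos hi, if_pos hj]; omega
  · rw [if_pos hi, if_neg hj]; omega
  · rw [if_neg hi, if_pos hj]; omega
  · rw [if_neg hi, if_neg hj]; omega

lemma rk_rot (μ : Fin (m + 1) → ℕ) (i : Fin (m + 1)) : rk (rot μ) i = rk μ (i + 1) := by
  rw [rk, rk, ← Finset.card_map (cyc m).symm.toEmbedding]
  congr 1
  ext x
  rw [Finset.mem_map_equiv, Equiv.symm_symm, Finset.mem_filter, Finset.mem_filter, prec_rot,
    ← cyc_symm (cyc m x), Equiv.symm_apply_apply]
  simp

/-- Closure under adjacent transpositions implies closure under all permutations. -/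
lemma comp_perm_of_comp_swap {P : (Fin (m + 1) → ℕ) → Prop}
    (h : ∀ μ (i j : Fin (m + 1)), (i : ℕ) + 1 = j → μ i ≠ μ j → P μ → P (μ ∘ Equiv.swap i j))
    (σ : Equiv.Perm (Fin (m + 1))) : ∀ {μ}, P μ → P (μ ∘ σ) := by
  have hσ : σ ∈ Submonoid.closure (Set.range fun i : Fin m => Equiv.swap i.castSucc i.succ) := by
    rw [Equiv.Perm.mclosure_swap_castSucc_succ]; trivial
  induction hσ using Submonoid.closure_induction with
  | mem x hx =>
    obtain ⟨i, rfl⟩ := hx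
    intro μ hμ
    by_cases e : μ i.castSucc = μ i.succ
    · have : μ ∘ Equiv.swap i.castSucc i.succ = μ := by
        funext x
        rw [Function.comp_apply, Equiv.swap_apply_def]
        split_ifs with h1 h2
        · rw [h1, e]
        · rw [h2, e]
        · rfl
      rwa [this]
    · exact h μ _ _ (by simp) e hμ
  | one => exact fun hμ => hμ
  | mul x y _ _ hx hy => exact fun hμ => hy (hx hμ)

/-- Up to permutations, adding one to an arbitrary part is the same as `rot`. -/
lemma rot_comp_perm (μ : Fin (m + 1) → ℕ) (i : Fin (m + 1)) :
    rot (μ ∘ (Equiv.swap i (Fin.last m) * cyc m)) ∘ Equiv.swap i (Fin.last m) =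
      μ + Pi.single i 1 := by
  funext x
  have : Equiv.swap i (Fin.last m) x = Fin.last m ↔ x = i := by
    rw [Equiv.swap_apply_eq_iff, Equiv.swap_apply_right]
  simp only [Function.comp_apply, rot, Equiv.Perm.mul_apply, cyc_add_one, Equiv.swap_apply_self,
    Pi.add_apply, Pi.single_apply, this]

lemma add_single_of_rot {P : (Fin (m + 1) → ℕ) → Prop}
    (h : ∀ μ (σ : Equiv.Perm (Fin (m + 1))), P μ → P (μ ∘ σ)) (hrot : ∀ μ, P μ → P (rot μ))
    {μ : Fin (m + 1) → ℕ} (i : Fin (m + 1)) (hμ : P μ) : P (μ + Pi.single i 1) := by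
  rw [← rot_comp_perm]
  exact h _ _ (hrot _ (h _ _ hμ))

lemma of_add_single {P : (Fin (m + 1) → ℕ) → Prop}
    (h : ∀ μ (σ : Equiv.Perm (Fin (m + 1))), P μ → P (μ ∘ σ)) {k : ℕ}
    (hrot : ∀ μ : Fin (m + 1) → ℕ, ¬ (μ 0 + 1 = k ∧ ∀ j, μ j ≤ μ 0) → P (rot μ) → P μ)
    {μ : Fin (m + 1) → ℕ} (i : Fin (m + 1)) (hi : ¬ (μ i + 1 = k ∧ ∀ j, μ j ≤ μ i))
    (hμ : P (μ + Pi.single i 1)) : P μ := by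
  rw [← rot_comp_perm] at hμ
  have h1 := h _ (Equiv.swap i (Fin.last m)) hμ
  have h2 : ∀ ν : Fin (m + 1) → ℕ, (ν ∘ Equiv.swap i (Fin.last m)) ∘ Equiv.swap i (Fin.last m) = ν :=
    fun ν => by funext x; simp
  rw [h2] at h1
  set σ := Equiv.swap i (Fin.last m) * cyc m with hσ
  have h0 : σ 0 = i := by rw [hσ, Equiv.Perm.mul_apply, cyc_zero, Equiv.swap_apply_right]
  have h3 := h _ σ⁻¹ (hrot (μ ∘ σ) (fun hcon => hi ?_) h1)
  · convert h3 using 1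
    funext x
    simp
  · simp only [Function.comp_apply, h0] at hcon
    refine ⟨hcon.1, fun j => ?_⟩
    have := hcon.2 (σ⁻¹ j)
    simpa using this

variable {n : ℕ}

lemma exists_add_single_le {ν μ : Fin n → ℕ} (h : ν ≤ μ) (hne : ν ≠ μ) :
    ∃ i, ν + Pi.single i 1 ≤ μ := by
  obtain ⟨i, hi⟩ := Function.ne_iff.1 hne
  refine ⟨i, fun x => ?_⟩
  have : ν x ≤ μ x := h x
  rw [Pi.add_apply, Pi.single_apply]
  split_ifs with hx
  · subst hx; exact lt_of_le_of_ne this hi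
  · exact this

lemma of_le_of_add_single {P : (Fin n → ℕ) → Prop} {μ : Fin n → ℕ}
    (h : ∀ ν i, ν + Pi.single i 1 ≤ μ → P ν → P (ν + Pi.single i 1)) :
    ∀ {ν : Fin n → ℕ}, ν ≤ μ → P ν → P μ := by
  have key : ∀ (d : ℕ) (ν : Fin n → ℕ), ∑ i, μ i = ∑ i, ν i + d → ν ≤ μ → P ν → P μ := by
    intro d
    induction d with
    | zero =>
      intro ν hd hle hν
      have : ν = μ := funext fun i =>
        (Finset.sum_eq_sum_iff_of_le fun i _ => hle i).1 hd.symm i (Finset.mem_univ i)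
      rwa [← this]
    | succ d ih =>
      intro ν hd hle hν
      obtain ⟨i, hi⟩ := exists_add_single_le hle fun e => by rw [e] at hd; omega
      refine ih _ ?_ hi (h ν i hi hν)
      simp only [Pi.add_apply, Finset.sum_add_distrib, Finset.sum_pi_single', Finset.mem_univ,
        if_true]
      omega
  intro ν hle
  exact key (∑ i, μ i - ∑ i, ν i) ν
    (Nat.add_sub_of_le (Finset.sum_le_sum fun i _ => hle i)).symm hle

/-- Going down preserves `P` because going up preserves the failure of `P`. -/
lemma of_le_of_sub_single {P : (Fin n → ℕ) → Prop} {ν μ : Fin n → ℕ}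
    (h : ∀ ξ i, ν ≤ ξ → ξ + Pi.single i 1 ≤ μ → P (ξ + Pi.single i 1) → P ξ) (hle : ν ≤ μ)
    (hμ : P μ) : P ν := by
  by_contra hν
  refine of_le_of_add_single (P := fun ξ => ν ≤ ξ ∧ ¬ P ξ) (μ := μ) (fun ξ i h1 h2 => ?_) hle
    ⟨le_rfl, hν⟩ |>.2 hμ
  exact ⟨h2.1.trans (le_add_of_nonneg_right (zero_le)), fun h3 => h2.2 (h ξ i h2.1 h1 h3)⟩

/-- The sets of exponents that correspond to submodules. -/
lemma exponent_dichotomy {P : (Fin (m + 1) → ℕ) → Prop} {k : ℕ}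
    (hswap : ∀ μ (i j : Fin (m + 1)), (i : ℕ) + 1 = j → μ i ≠ μ j → P μ → P (μ ∘ Equiv.swap i j))
    (hrot : ∀ μ, P μ → P (rot μ))
    (hrot' : ∀ μ : Fin (m + 1) → ℕ, ¬ (μ 0 + 1 = k ∧ ∀ j, μ j ≤ μ 0) → P (rot μ) → P μ) :
    (∀ μ, ¬ P μ) ∨ (∀ μ, P μ) ∨ ∀ μ, P μ ↔ ∃ i, k ≤ μ i := by
  have hperm : ∀ μ (σ : Equiv.Perm (Fin (m + 1))), P μ → P (μ ∘ σ) := fun μ σ =>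
    comp_perm_of_comp_swap hswap σ
  have hup : ∀ {μ ν}, ν ≤ μ → P ν → P μ := fun {μ ν} hle hν =>
    of_le_of_add_single (P := P) (fun ξ i _ => add_single_of_rot hperm hrot i) hle hν
  -- From an exponent with all parts below `k` one descends to zero without meeting the barrier,
  -- since every part removed from is less than `k - 1`; then all exponents are reached by
  -- ascending.
  by_cases h1 : ∃ μ, P μ ∧ ∀ i, μ i < k
  · obtain ⟨μ, hμ, hlt⟩ := h1
    refine Or.inr (Or.inl fun ν => hup (ν := 0) (fun i => Nat.zero_le _) ?_)
    refine of_le_of_sub_single (μ := μ) (fun ξ i _ h2 => of_add_single hperm hrot' i ?_)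
      (fun i => Nat.zero_le _) hμ
    rintro ⟨h3, -⟩
    have h4 : (ξ + Pi.single i 1 : Fin (m + 1) → ℕ) i ≤ μ i := h2 i
    have := hlt i
    rw [Pi.add_apply, Pi.single_eq_same] at h4
    omega
  · push Not at h1
    by_cases h2 : ∃ μ, P μ
    · obtain ⟨μ, hμ⟩ := h2
      obtain ⟨i, hi⟩ := h1 μ hμ
      refine Or.inr (Or.inr fun ν => ⟨h1 ν, fun ⟨j, hj⟩ => ?_⟩)
      -- While the part at `i` stays at least `k`, the barrier is never met: it needs a maximal part
      -- equal to `k - 1`.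
      have h3 : P (Pi.single i k) := by
        refine of_le_of_sub_single (μ := μ) (fun ξ x h2 _ => of_add_single hperm hrot' x ?_)
          (fun x => ?_) hμ
        · rintro ⟨h3, h4⟩
          have h5 : (Pi.single i k : Fin (m + 1) → ℕ) i ≤ ξ i := h2 i
          have := h4 i
          rw [Pi.single_eq_same] at h5
          omega
        · rw [Pi.single_apply]
          split_ifs with hx
          · rw [hx]; exact hi
          · exact Nat.zero_le _
      have h4 := hperm _ (Equiv.swap i j) h3
      refine hup (fun x => ?_) h4
      simp only [Function.comp_apply, Pi.single_apply, Equiv.swap_apply_eq_iff,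
        Equiv.swap_apply_left]
      split_ifs with hx
      · rw [hx]; exact hj
      · exact Nat.zero_le _
    · exact Or.inl (not_exists.1 h2)

end Exponents

/-! ### Raising and lowering joint eigenvectors -/

section Raise

variable {r p m k : ℕ} {c0 : ℂ} {c : ℕ → ℂ}

lemma raise_add (f g : Pol (m + 1)) : raise (f + g) = raise f + raise g := by
  simp only [raise, map_add, mul_add]

lemma raise_smul (a : ℂ) (f : Pol (m + 1)) : raise (a • f) = a • raise f := by
  simp only [raise, map_smul, mul_smul_comm]

lemma raise_eq_zero {f : Pol (m + 1)} (h : raise f = 0) : f = 0 := by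
  rcases mul_eq_zero.1 h with h | h
  · exact absurd h (px_ne_zero _)
  · rw [← act_inv_act (pm (cyc m)) f, h, map_zero]

lemma lowerOp_add (f g : Pol (m + 1)) :
    lowerOp r c0 c (f + g) = lowerOp r c0 c f + lowerOp r c0 c g := by
  simp only [lowerOp, map_add]

lemma lowerOp_smul (a : ℂ) (f : Pol (m + 1)) :
    lowerOp r c0 c (a • f) = a • lowerOp r c0 c f := by
  simp only [lowerOp, map_smul]

lemma tw_rot (a : Fin (m + 1) → ℂˣ) (μ : Fin (m + 1) → ℕ) :
    tw a (rot μ) = (a (Fin.last m) : ℂ)⁻¹ * tw (a ∘ cyc m) μ := by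
  have h : tw (a ∘ cyc m) μ = ∏ i, ((a i : ℂ)⁻¹) ^ μ (i + 1) := by
    rw [tw, ← Equiv.prod_comp (cyc m).symm]
    refine Finset.prod_congr rfl fun i _ => ?_
    rw [Function.comp_apply, Equiv.apply_symm_apply, cyc_symm]
  rw [h, tw]
  simp only [rot, pow_add, Finset.prod_mul_distrib]
  rw [mul_comm]
  congr 1
  rw [Finset.prod_eq_single (Fin.last m)]
  · simp
  · intro x _ hx; simp [hx]
  · simp

lemma act_dg_raise {μ : Fin (m + 1) → ℕ} {f : Pol (m + 1)}
    (hf : IsEigen (opK r p (m + 1) c0 c) (fun κ => wtK r p (m + 1) c0 c κ μ) f)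
    {a : Fin (m + 1) → ℂˣ} (ha : dg a ∈ G r p (m + 1)) :
    act (dg a) (raise f) = tw a (rot μ) • raise f := by
  have hmem := dg_comp_mem ha (cyc m)
  have h2 : act (dg (a ∘ cyc m)) f = tw (a ∘ cyc m) μ • f := hf.act_dg hmem
  rw [raise, map_mul, act_px, dualAct_dg, map_smul, lin_xv, act_dg_act_pm, h2, map_smul, tw_rot,
    smul_mul_smul_comm]

lemma dg_zt_pow_mem (hp : p ∣ r) {n : ℕ} (i : Fin n) {l : ℕ} (hl : p ∣ l) :
    dg (Pi.mulSingle i (zeta r) ^ l) ∈ G r p n := by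
  obtain ⟨q, rfl⟩ := hl
  rw [← zt_pow_eq_dg, pow_mul]
  exact pow_mem (ztp_mem hp i) q

/-- The value of `∑_l c_l (1 - ζ^{-l}) ζ_i^l` on a vector of weight `d` for `ζ_i`. -/
lemma ztSum_eq (hc : ∀ l : ℕ, ¬ p ∣ l → c l = 0) {n : ℕ} {i : Fin n} {d : ℕ}
    {f : Pol n} (hf : ∀ l, p ∣ l → act (zt r i ^ l) f = (((zeta r : ℂ) ^ l)⁻¹) ^ d • f) :
    ztSum r c i f = (dpar r c (-(d : ℤ)) - dpar r c (-((d : ℤ) + 1))) • f := by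
  have h : ∀ l, (c l * (1 - ((zeta r : ℂ) ^ l)⁻¹)) • act (zt r i ^ l) f =
      (c l * (1 - (((zeta r : ℂ) ^ l)⁻¹)) * (((zeta r : ℂ) ^ l)⁻¹) ^ d) • f := fun l => by
    by_cases hl : p ∣ l
    · rw [hf l hl, smul_smul]
    · rw [hc l hl]; simp
  rw [ztSum, Finset.sum_congr rfl fun l _ => h l, ← Finset.sum_smul]
  congr 1
  have e1 : dpar r c 0 - dpar r c (-(d : ℤ)) =
      ∑ l ∈ Finset.Ico 1 r, c l * (1 - (((zeta r : ℂ) ^ l)⁻¹) ^ d) := by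
    rcases d with _ | d
    · simp
    · exact_mod_cast dpar_sub r c d
  have e2 := dpar_sub r c d
  rw [← sub_sub_sub_cancel_left _ _ (dpar r c 0), e1, e2, ← Finset.sum_sub_distrib]
  refine Finset.sum_congr rfl fun l _ => ?_
  ring

/-- On the last index the term `ztSum` contributes `d_{-(μ_1 + 1)} - d_{-(μ_1 + 2)}`, which
telescopes with the `d`-terms of the old weight. The ranks agree by `rk_rot`. -/
lemma IsEigen.raise (hr : 1 < r) (hp : p ∣ r) (hc : ∀ l : ℕ, ¬ p ∣ l → c l = 0)
    {μ : Fin (m + 1) → ℕ} {f : Pol (m + 1)}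
    (hf : IsEigen (opK r p (m + 1) c0 c) (fun κ => wtK r p (m + 1) c0 c κ μ) f) :
    IsEigen (opK r p (m + 1) c0 c) (fun κ => wtK r p (m + 1) c0 c κ (rot μ))
      (Cherednik.raise f) := by
  have hz : ∀ i, Cherednik.zOp r c0 c i f = wtz r c0 c μ i • f := hf.zOp
  rintro (i | ⟨a, ha⟩)
  · change Cherednik.zOp r c0 c i (Cherednik.raise f) =
      wtz r c0 c (rot μ) i • Cherednik.raise f
    by_cases hi : i = Fin.last m
    · subst hi
      have hzt : ∀ l, p ∣ l → act (zt r (Fin.last m) ^ l) (Cherednik.raise f) =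
          (((zeta r : ℂ) ^ l)⁻¹) ^ (μ 0 + 1) • Cherednik.raise f := fun l hl => by
        rw [zt_pow_eq_dg, act_dg_raise hf (dg_zt_pow_mem hp _ hl), tw_pow, tw_mulSingle, rot_last,
          inv_pow, inv_pow, inv_pow, pow_right_comm]
      rw [zOp_last_raise hr hp c0 hc, hz, raise_smul, ztSum_eq hc hzt,
        ← one_smul ℂ (Cherednik.raise f), smul_smul, smul_smul, smul_smul, ← add_smul, ← _root_.sub_smul]
      congr 1
      rw [wtz, wtz, rot_last, rk_rot, Fin.last_add_one]
      push_cast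
      ring
    · rw [zOp_raise hr hp c0 hc hi, hz, raise_smul, wtz, wtz, rot_of_ne μ hi, rk_rot]
  · exact act_dg_raise hf ha

/-- The lowering operator kills the eigenvectors of exponents with last part zero. -/
lemma IsEigen.lowerOp_eq_zero (hp : p ∣ r) (hc : ∀ l : ℕ, ¬ p ∣ l → c l = 0)
    {μ : Fin (m + 1) → ℕ} {f : Pol (m + 1)}
    (hf : IsEigen (opK r p (m + 1) c0 c) (fun κ => wtK r p (m + 1) c0 c κ μ) f)
    (hμ : μ (Fin.last m) = 0) : lowerOp r c0 c f = 0 := by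
  refine raise_eq_zero ?_
  have hzt : ∀ l, p ∣ l → act (zt r (Fin.last m) ^ l) f =
      (((zeta r : ℂ) ^ l)⁻¹) ^ 0 • f := fun l hl => by
    have h : act (dg (Pi.mulSingle (Fin.last m) (zeta r) ^ l)) f =
        tw (Pi.mulSingle (Fin.last m) (zeta r) ^ l) μ • f := hf.act_dg (dg_zt_pow_mem hp _ hl)
    rw [zt_pow_eq_dg, h, tw_pow, tw_mulSingle, hμ, pow_zero, pow_zero, one_pow]
  -- A zero in the last place precedes every other entry, ties included. The remaining scalar in
  -- `raise ∘ lowerOp` is then zero, and `raise` is injective.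
  have hrk : rk μ (Fin.last m) = 0 := by
    rw [rk, Finset.card_eq_zero, Finset.filter_eq_empty_iff]
    intro x _
    have := Fin.le_last x
    unfold Prec
    rw [not_or, not_and, not_lt, not_lt, hμ]
    exact ⟨Nat.zero_le _, fun _ => this⟩
  have hz : Cherednik.zOp r c0 c (Fin.last m) f = wtz r c0 c μ (Fin.last m) • f := hf.zOp _
  rw [raise_lowerOp, hz, ztSum_eq hc hzt, wtz, hrk, hμ]
  nth_rw 2 [← one_smul ℂ f]
  rw [← _root_.sub_smul, ← add_smul]
  convert zero_smul ℂ f using 2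
  push_cast
  rw [neg_zero]
  ring

/-- The scalar by which `lowerOp ∘ raise` acts vanishes only on the distinguished hyperplane. -/
lemma Special.wtz_zero_eq_zero_iff (hs : Special r p (m + 1) c0 c k) (μ : Fin (m + 1) → ℕ) :
    wtz r c0 c μ 0 = 0 ↔ μ 0 + 1 = k ∧ ∀ j, μ j ≤ μ 0 := by
  have hr := hs.one_lt
  have hon := hs.onH
  rw [OnH] at hon
  push_cast at hon
  constructor
  · intro h
    rw [wtz] at h
    have hrk := rk_lt μ 0
    -- If `r` divided `μ 0 + 1`, the `d`-terms would cancel and `c_0` times the rank would be a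
    -- positive integer.
    have hnd : ¬ r ∣ μ 0 + 1 := by
      intro hd
      have : dpar r c (-((μ 0 : ℤ) + 1)) = dpar r c 0 := by
        refine dpar_congr (p := p) (by omega) hs.supp (Dvd.dvd.mul_left ?_ _)
        rw [sub_zero, Int.dvd_neg]
        exact_mod_cast hd
      rw [this, sub_self, sub_zero] at h
      obtain ⟨q, hq⟩ := hd
      have hr0 : (r : ℂ) ≠ 0 := by exact_mod_cast (by omega : r ≠ 0)
      have hq' : (μ 0 : ℂ) + 1 = r * q := by exact_mod_cast hq
      have h1 : (q : ℂ) = c0 * rk μ 0 := by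
        refine mul_left_cancel₀ hr0 ?_
        linear_combination h - hq'
      have hq1 : 1 ≤ q := Nat.pos_of_ne_zero fun e => by rw [e] at hq; omega
      rcases Nat.eq_zero_or_pos (rk μ 0) with h0 | h0
      · rw [h0, Nat.cast_zero, mul_zero] at h1
        have : q = 0 := by exact_mod_cast h1
        omega
      · exact hs.toGeneric.ne_of_mul_eq h0 hrk.le hq1 h1
    by_cases he : (μ 0 + 1, m + 1 - rk μ 0) = (k, 1)
    · simp only [Prod.mk.injEq] at he
      refine ⟨he.1, fun j => ?_⟩
      by_contra hj
      have := rk_lt_iff.2 (Or.inl (not_le.1 hj) : Prec μ 0 j)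
      have := rk_lt μ j
      omega
    -- Vanishing of the weight is the equation of `H_{j,l}` with `j = μ 0 + 1` and `n - l` the rank
    -- of the first index.
    · refine absurd ?_ (hs.not_onH _ _ (Nat.succ_pos _) hnd (by omega) (by omega) he)
      rw [OnH, Nat.cast_sub hrk.le]
      push_cast
      linear_combination -h
  · rintro ⟨h1, h2⟩
    -- The first index comes after all its ties, so a maximal first part has the top rank, which
    -- corresponds to `l = 1`.
    have hrk : rk μ 0 = m := by
      have : (Finset.univ.filter fun j => Prec μ j 0) = Finset.univ.erase 0 := by
        ext x
        simp only [Finset.mem_filter, Finset.mem_univ, true_and, Finset.mem_erase, and_true]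
        have := h2 x
        rw [← Fin.pos_iff_ne_zero]
        unfold Prec
        constructor
        · rintro (h | h)
          · exact Fin.pos_iff_ne_zero.2 fun e => by rw [e] at h; omega
          · exact h.2
        · intro h
          rcases this.lt_or_eq with h' | h'
          · exact Or.inl h'
          · exact Or.inr ⟨h', h⟩
      rw [rk, this, Finset.card_erase_of_mem (Finset.mem_univ _), Finset.card_univ,
        Fintype.card_fin, Nat.add_sub_cancel]
    have hk : (μ 0 : ℂ) + 1 = k := by exact_mod_cast h1
    have hk' : (μ 0 : ℤ) + 1 = k := by exact_mod_cast h1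
    rw [wtz, hrk, hk, hk']
    linear_combination -hon

end Raise

/-! ### Existence of the joint eigenvectors and the operators between them -/

section Family

variable {r p m k : ℕ} {c0 : ℂ} {c : ℕ → ℂ}

lemma isEigen_mono_zero (r p n : ℕ) (c0 : ℂ) (c : ℕ → ℂ) :
    IsEigen (opK r p n c0 c) (fun κ => wtK r p n c0 c κ 0) (mono 0) := fun κ => by
  have h := isTriangular_opK r p n c0 c κ 0
  have h0 : {ν : Fin n → ℕ | ExpLT ν 0} = ∅ := by
    ext ν
    refine ⟨fun hν => ?_, fun h => h.elim⟩
    have hsum := ExpLT.sum_eq hν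
    simp only [Pi.zero_apply, Finset.sum_const_zero, Finset.sum_eq_zero_iff, Finset.mem_univ,
      true_implies] at hsum
    have : ν = 0 := funext hsum
    subst this
    exact ExpLT.irrefl _ hν
  rwa [h0, Set.image_empty, Submodule.span_empty, Submodule.mem_bot, sub_eq_zero,
    monoBasis_apply] at h

/-- The constant polynomial is an eigenvector, and swaps and raising never produce zero. Together
they increase any single part by one, so every exponent is reached. -/
lemma Special.exists_isEigen (hs : Special r p (m + 1) c0 c k) (μ : Fin (m + 1) → ℕ) :
    ∃ f : Pol (m + 1), f ≠ 0 ∧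
      IsEigen (opK r p (m + 1) c0 c) (fun κ => wtK r p (m + 1) c0 c κ μ) f := by
  let P : (Fin (m + 1) → ℕ) → Prop := fun μ => ∃ f : Pol (m + 1), f ≠ 0 ∧
      IsEigen (opK r p (m + 1) c0 c) (fun κ => wtK r p (m + 1) c0 c κ μ) f
  have hswap : ∀ μ (i j : Fin (m + 1)), (i : ℕ) + 1 = j → μ i ≠ μ j → P μ →
      P (μ ∘ Equiv.swap i j) := fun μ i j hij hμ ⟨f, hf0, hf⟩ => by
    obtain ⟨e, h1, h2⟩ := hs.exists_swap hij hμ hf hf0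
    exact ⟨_, h1, h2⟩
  have hrot : ∀ μ, P μ → P (rot μ) := fun μ ⟨f, hf0, hf⟩ =>
    ⟨raise f, fun h => hf0 (raise_eq_zero h), hf.raise hs.one_lt hs.dvd hs.supp⟩
  have h0 : P 0 := ⟨mono 0, by rw [← monoBasis_apply]; exact (monoBasis (m + 1)).ne_zero 0,
    isEigen_mono_zero _ _ _ _ _⟩
  exact of_le_of_add_single (P := P) (ν := 0) (fun ν i _ => add_single_of_rot (P := P)
    (fun μ σ => comp_perm_of_comp_swap hswap σ) hrot i) (fun i => Nat.zero_le _) h0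

/-- A normalized family of joint eigenvectors. -/
def IsJackFamily (r p : ℕ) {n : ℕ} (c0 : ℂ) (c : ℕ → ℂ) (f : (Fin n → ℕ) → Pol n) : Prop :=
  ∀ μ, IsEigen (opK r p n c0 c) (fun κ => wtK r p n c0 c κ μ) (f μ) ∧
    (monoBasis n).repr (f μ) μ = 1

lemma Special.wtK_injective {n : ℕ} (hs : Special r p n c0 c k) (μ ν : Fin n → ℕ)
    (h : ∀ κ, wtK r p n c0 c κ μ = wtK r p n c0 c κ ν) : μ = ν :=
  hs.toGeneric.wtK_injective hs.one_lt hs.dvd hs.supp fun κ _ => h κ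

lemma Special.exists_isJackFamily (hs : Special r p (m + 1) c0 c k) :
    ∃ f : (Fin (m + 1) → ℕ) → Pol (m + 1), IsJackFamily r p c0 c f := by
  choose g hg0 hg using hs.exists_isEigen
  refine ⟨fun μ => ((monoBasis (m + 1)).repr (g μ) μ)⁻¹ • g μ, fun μ => ⟨fun κ => ?_, ?_⟩⟩
  · rw [map_smul, hg μ κ, smul_comm]
  · rw [map_smul, Finsupp.smul_apply, smul_eq_mul, inv_mul_cancel₀]
    exact (isTriangular_opK r p (m + 1) c0 c).repr_ne_zero (fun _ _ _ => ExpLT.trans) ExpLT.irrefl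
      (fun ν hν => hs.wtK_injective _ _ hν) (hg μ) (hg0 μ)

lemma IsJackFamily.ne_zero {n : ℕ} {f : (Fin n → ℕ) → Pol n} (hf : IsJackFamily r p c0 c f)
    (μ : Fin n → ℕ) : f μ ≠ 0 := fun h => by
  have := (hf μ).2
  rw [h] at this
  simp at this

lemma IsJackFamily.exists_smul {n : ℕ} (hs : Special r p n c0 c k) {f : (Fin n → ℕ) → Pol n}
    (hf : IsJackFamily r p c0 c f) {μ : Fin n → ℕ} {g : Pol n} (hg0 : g ≠ 0)
    (hg : IsEigen (opK r p n c0 c) (fun κ => wtK r p n c0 c κ μ) g) :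
    ∃ a : ℂ, a ≠ 0 ∧ g = a • f μ := by
  have h := (isTriangular_opK r p n c0 c).eq_smul (fun _ _ _ => ExpLT.trans) ExpLT.irrefl
    (fun ν hν => hs.wtK_injective _ _ hν) (hf μ).1 hg (hf μ).2
  refine ⟨_, fun h0 => hg0 ?_, h⟩
  rw [h, h0, zero_smul]

lemma IsJackFamily.swap {n : ℕ} (hs : Special r p n c0 c k) {f : (Fin n → ℕ) → Pol n}
    (hf : IsJackFamily r p c0 c f) {i j : Fin n} (hij : (i : ℕ) + 1 = j) {μ : Fin n → ℕ}
    (hμ : μ i ≠ μ j) : ∃ a b : ℂ, b ≠ 0 ∧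
      act (sw i j) (f μ) = a • f μ + b • f (μ ∘ Equiv.swap i j) := by
  obtain ⟨e, h1, h2⟩ := hs.exists_swap hij hμ (hf μ).1 (hf.ne_zero μ)
  obtain ⟨b, hb, h3⟩ := hf.exists_smul hs h1 h2
  refine ⟨-e, b, hb, ?_⟩
  rw [← h3, neg_smul, neg_add_eq_sub, add_sub_cancel_right]

lemma IsJackFamily.raise (hs : Special r p (m + 1) c0 c k) {f : (Fin (m + 1) → ℕ) → Pol (m + 1)}
    (hf : IsJackFamily r p c0 c f) (μ : Fin (m + 1) → ℕ) :
    ∃ a : ℂ, a ≠ 0 ∧ Cherednik.raise (f μ) = a • f (rot μ) :=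
  hf.exists_smul hs (fun h => hf.ne_zero μ (raise_eq_zero h))
    ((hf μ).1.raise hs.one_lt hs.dvd hs.supp)

/-- Up to the nonzero scalar of `raise`, the coefficient is the eigenvalue of `lowerOp ∘ raise =
z_1`. Its vanishing locus is the barrier used in `exponent_dichotomy`. -/
lemma IsJackFamily.lowerOp_rot (hs : Special r p (m + 1) c0 c k)
    {f : (Fin (m + 1) → ℕ) → Pol (m + 1)} (hf : IsJackFamily r p c0 c f)
    (μ : Fin (m + 1) → ℕ) : ∃ a : ℂ, (a = 0 ↔ μ 0 + 1 = k ∧ ∀ j, μ j ≤ μ 0) ∧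
      lowerOp r c0 c (f (rot μ)) = a • f μ := by
  obtain ⟨a, ha, h⟩ := hf.raise hs μ
  have h1 : f (rot μ) = a⁻¹ • Cherednik.raise (f μ) := by
    rw [h, smul_smul, inv_mul_cancel₀ ha, one_smul]
  have h2 : zOp r c0 c 0 (f μ) = wtz r c0 c μ 0 • f μ := (hf μ).1.zOp 0
  refine ⟨a⁻¹ * wtz r c0 c μ 0, ?_, ?_⟩
  · rw [← hs.wtz_zero_eq_zero_iff]
    simp [ha]
  · rw [h1, lowerOp_smul, lowerOp_raise hs.one_lt hs.dvd c0 hs.supp, h2, smul_smul]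

lemma exists_rot {μ : Fin (m + 1) → ℕ} (h : μ (Fin.last m) ≠ 0) : ∃ ν, μ = rot ν := by
  refine ⟨fun x => μ (cyc m x) - if cyc m x = Fin.last m then 1 else 0, funext fun x => ?_⟩
  rw [rot, cyc_add_one]
  split_ifs with hx
  · rw [hx]; omega
  · rfl

end Family

/-! ### Submodules -/

section Stable

variable {r p m k : ℕ} {c0 : ℂ} {c : ℕ → ℂ}

lemma exists_eq_dg_mul_pm {n : ℕ} {g : V n ≃ₗ[ℂ] V n} (hr : r ≠ 0) (hg : g ∈ G r p n) :
    ∃ (a : Fin n → ℂˣ) (σ : Equiv.Perm (Fin n)), dg a ∈ G r p n ∧ g = dg a * pm σ := by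
  obtain ⟨σ, a, h1, h2, h3⟩ := id hg
  have h0 : ∀ i, a i ≠ 0 := fun i h => by
    have := h1 i
    rw [h, zero_pow hr] at this
    exact zero_ne_one this
  have h : g = dg (fun i => Units.mk0 (a i) (h0 i)) * pm σ := by
    ext v i
    rw [h3]
    rfl
  refine ⟨_, σ, ?_, h⟩
  rw [← mul_inv_eq_iff_eq_mul] at h
  rw [← h]
  exact mul_mem hg (inv_mem (pm_mem r p σ))

/-- A subspace stable under the diagonal matrices, the adjacent transpositions, and the raising
and lowering operators is a submodule. -/
lemma rho_mem_of_stable (hr : 1 < r) (hp : p ∣ r) (hc : ∀ l : ℕ, ¬ p ∣ l → c l = 0)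
    {N : Submodule ℂ (Pol (m + 1))}
    (hdg : ∀ a : Fin (m + 1) → ℂˣ, dg a ∈ G r p (m + 1) → ∀ f ∈ N, act (dg a) f ∈ N)
    (hsw : ∀ i j : Fin (m + 1), (i : ℕ) + 1 = j → ∀ f ∈ N, act (sw i j) f ∈ N)
    (hraise : ∀ f ∈ N, raise f ∈ N) (hlower : ∀ f ∈ N, lowerOp r c0 c f ∈ N)
    (a : HH r p (m + 1) c0 c) : ∀ f ∈ N, rho hr hp c0 hc a f ∈ N := by
  have hpm : ∀ σ : Equiv.Perm (Fin (m + 1)), ∀ f ∈ N, act (pm σ) f ∈ N := by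
    intro σ
    have hσ : σ ∈ Submonoid.closure (Set.range fun i : Fin m => Equiv.swap i.castSucc i.succ) := by
      rw [Equiv.Perm.mclosure_swap_castSucc_succ]; trivial
    induction hσ using Submonoid.closure_induction with
    | mem x hx =>
      obtain ⟨i, rfl⟩ := hx
      intro f hf
      rw [← sw_eq_pm]
      exact hsw _ _ (by simp) f hf
    | one => intro f hf; rwa [pm_one, act_one]
    | mul x y _ _ hx hy => intro f hf; rw [pm_mul, act_mul]; exact hx _ (hy _ hf)
  have hpx : ∀ i, ∀ f ∈ N, px i * f ∈ N := by
    intro i f hf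
    -- Undoing the cyclic permutation turns `raise` into multiplication by the last variable;
    -- conjugating by a transposition gives the other variables. The Dunkl operators are recovered
    -- from `lowerOp` in the same way.
    have h1 := hraise _ (hpm (cyc m)⁻¹ _ (hpm (Equiv.swap i (Fin.last m)) f hf))
    rw [raise, ← pm_inv, act_act_inv] at h1
    have h2 := hpm (Equiv.swap i (Fin.last m)) _ h1
    rwa [map_mul, act_pm_px, Equiv.swap_apply_right, ← sw_eq_pm, act_sw_sw] at h2
  have hdunkl : ∀ i, ∀ f ∈ N, dunkl r c0 c i f ∈ N := by
    intro i f hf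
    have h1 := hpm (cyc m) _ (hlower _ (hpm (Equiv.swap i (Fin.last m)) f hf))
    rw [lowerOp, act_act_inv] at h1
    have h2 := hpm (Equiv.swap i (Fin.last m)) _ h1
    rwa [act_dunkl hr hp c0 hc, Equiv.swap_apply_right, ← sw_eq_pm, act_sw_sw] at h2
  induction a using RCA.induction with
  | halg a =>
    intro f hf
    rw [AlgHom.commutes, Module.algebraMap_end_apply]
    exact N.smul_mem _ hf
  | hX x =>
    intro f hf
    rw [rho_X, lin_apply, Finset.sum_mul]
    refine Submodule.sum_mem _ fun i _ => ?_
    rw [smul_mul_assoc]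
    exact N.smul_mem _ (hpx i f hf)
  | hY v =>
    intro f hf
    rw [rho_Y, dunklV_apply]
    exact Submodule.sum_mem _ fun i _ => N.smul_mem _ (hdunkl i f hf)
  | hT w =>
    intro f hf
    rw [rho_T]
    obtain ⟨a, σ, ha, h⟩ := exists_eq_dg_mul_pm (by omega) w.2
    rw [h, act_mul]
    exact hdg a ha _ (hpm σ f hf)
  | hmul a b ha hb =>
    intro f hf
    rw [map_mul, Module.End.mul_apply]
    exact ha _ (hb f hf)
  | hadd a b ha hb =>
    intro f hf
    rw [map_add, LinearMap.add_apply]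
    exact N.add_mem (ha f hf) (hb f hf)

lemma rho_xi (hr : 1 < r) (hp : p ∣ r) (c0 : ℂ) (hc : ∀ l : ℕ, ¬ p ∣ l → c l = 0) {n : ℕ}
    (i : Fin n) (f : Pol n) : rho hr hp c0 hc (xi r p n c0 c i) f = px i * f := by
  rw [xi, rho_X, lin_xv]

lemma rho_yi (hr : 1 < r) (hp : p ∣ r) (c0 : ℂ) (hc : ∀ l : ℕ, ¬ p ∣ l → c l = 0) {n : ℕ}
    (i : Fin n) (f : Pol n) : rho hr hp c0 hc (yi r p n c0 c i) f = dunkl r c0 c i f := by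
  rw [yi, rho_Y, dunklV_yv]

lemma rho_zi (hr : 1 < r) (hp : p ∣ r) (c0 : ℂ) (hc : ∀ l : ℕ, ¬ p ∣ l → c l = 0) {n : ℕ}
    (i : Fin n) : rho hr hp c0 hc (zi r p n c0 c i) = zOp r c0 c i := by
  refine LinearMap.ext fun f => ?_
  rw [zi, map_add, map_mul, map_smul, phi, LinearMap.add_apply, Module.End.mul_apply, rho_xi,
    rho_yi, LinearMap.smul_apply, map_sum, LinearMap.sum_apply, zOp_apply]
  congr 2
  refine Finset.sum_congr rfl fun j _ => ?_
  rw [map_sum, LinearMap.sum_apply]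
  refine Finset.sum_congr rfl fun l _ => ?_
  rw [rho_T]
  rfl

/-- The exponents with at least one part of size at least `k`. -/
def bigExp (k n : ℕ) : Set (Fin n → ℕ) := {μ | ∃ i, k ≤ μ i}

lemma span_mem_of_forall {E I : Type*} [AddCommGroup E] [Module ℂ E] {f : I → E} {S : Set I}
    {F : E → E} (hadd : ∀ x y, F (x + y) = F x + F y) (hsmul : ∀ (a : ℂ) x, F (a • x) = a • F x)
    (h : ∀ μ ∈ S, F (f μ) ∈ Submodule.span ℂ (f '' S)) :
    ∀ x ∈ Submodule.span ℂ (f '' S), F x ∈ Submodule.span ℂ (f '' S) := by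
  intro x hx
  induction hx using Submodule.span_induction with
  | mem x hx => obtain ⟨μ, hμ, rfl⟩ := hx; exact h μ hμ
  | zero =>
    have := hsmul 0 0
    rw [zero_smul, zero_smul] at this
    rw [this]
    exact zero_mem _
  | add x y _ _ hx hy => rw [hadd]; exact add_mem hx hy
  | smul a x _ hx => rw [hsmul]; exact Submodule.smul_mem _ _ hx

variable {f : (Fin (m + 1) → ℕ) → Pol (m + 1)}

/-- Permutations and raising keep a part of size at least `k`. Lowering could lose it only if that
part is the last one, equal to `k`, and no other part reaches `k`; the scalar of `lowerOp` vanishes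
in exactly that case. -/
lemma IsJackFamily.rho_mem_span (hs : Special r p (m + 1) c0 c k) (hf : IsJackFamily r p c0 c f)
    (a : HH r p (m + 1) c0 c) : ∀ g ∈ Submodule.span ℂ (f '' bigExp k (m + 1)),
      rho hs.one_lt hs.dvd c0 hs.supp a g ∈ Submodule.span ℂ (f '' bigExp k (m + 1)) := by
  have hmem : ∀ μ (i : Fin (m + 1)), k ≤ μ i →
      f μ ∈ Submodule.span ℂ (f '' bigExp k (m + 1)) := fun μ i hi =>
    Submodule.subset_span ⟨μ, ⟨i, hi⟩, rfl⟩
  refine rho_mem_of_stable _ _ _ (fun b hb => ?_) (fun i j hij => ?_) ?_ ?_ a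
  · refine span_mem_of_forall (map_add _) (map_smul _) ?_
    rintro μ ⟨i, hi⟩
    rw [(hf μ).1.act_dg hb]
    exact Submodule.smul_mem _ _ (hmem μ i hi)
  · refine span_mem_of_forall (map_add _) (map_smul _) ?_
    rintro μ ⟨x, hx⟩
    by_cases hμ : μ i = μ j
    · obtain ⟨e, he⟩ := hs.swap_of_tie hij hμ (hf μ).1 (hf μ).2
      rw [he]
      exact Submodule.smul_mem _ _ (hmem μ x hx)
    · obtain ⟨e, b, -, he⟩ := hf.swap hs hij hμ
      rw [he]
      refine add_mem (Submodule.smul_mem _ _ (hmem μ x hx)) (Submodule.smul_mem _ _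
        (hmem _ (Equiv.swap i j x) ?_))
      rwa [Function.comp_apply, Equiv.swap_apply_self]
  · refine span_mem_of_forall raise_add raise_smul ?_
    rintro μ ⟨x, hx⟩
    obtain ⟨e, -, he⟩ := hf.raise hs μ
    rw [he]
    refine Submodule.smul_mem _ _ (hmem _ (cyc m x) ?_)
    rw [rot, ← cyc_symm, Equiv.symm_apply_apply]
    omega
  · refine span_mem_of_forall lowerOp_add lowerOp_smul ?_
    rintro μ ⟨x, hx⟩
    by_cases h0 : μ (Fin.last m) = 0
    · rw [(hf μ).1.lowerOp_eq_zero hs.dvd hs.supp h0]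
      exact zero_mem _
    · obtain ⟨ν, rfl⟩ := exists_rot h0
      obtain ⟨e, he0, he⟩ := hf.lowerOp_rot hs ν
      rw [he]
      by_cases h1 : e = 0
      · rw [h1, zero_smul]
        exact zero_mem _
      · refine Submodule.smul_mem _ _ ?_
        rw [he0] at h1
        by_cases hxl : x = Fin.last m
        · rw [hxl, rot_last] at hx
          by_cases h2 : k ≤ ν 0
          · exact hmem ν 0 h2
          · have h3 : ν 0 + 1 = k := by omega
            -- A nonzero scalar with `ν 0 = k - 1` provides another part larger than `ν 0`, hence at
            -- least `k`.
            rw [not_and, not_forall] at h1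
            obtain ⟨j, hj⟩ := h1 h3
            exact hmem ν j (by omega)
        · rw [rot_of_ne ν hxl] at hx
          exact hmem ν _ hx

lemma IsJackFamily.span_eq_top (hs : Special r p (m + 1) c0 c k) (hf : IsJackFamily r p c0 c f) :
    Submodule.span ℂ (Set.range f) = ⊤ := by
  refine span_eq_top_of_triangular (b := monoBasis (m + 1)) (ExpLT.wellFounded (m + 1)) fun μ => ?_
  exact (isTriangular_opK r p (m + 1) c0 c).sub_mem_lower (fun _ _ _ => ExpLT.trans) ExpLT.irrefl
    (fun ν hν => hs.wtK_injective _ _ hν) (hf μ).1 (hf μ).2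

/-- The subspaces of the polynomial representation that are submodules. -/
lemma IsJackFamily.eq_bot_or_top_or_span (hs : Special r p (m + 1) c0 c k)
    (hf : IsJackFamily r p c0 c f) {N : Submodule ℂ (Pol (m + 1))}
    (hN : ∀ a, ∀ g ∈ N, rho hs.one_lt hs.dvd c0 hs.supp a g ∈ N) :
    N = ⊥ ∨ N = ⊤ ∨ N = Submodule.span ℂ (f '' bigExp k (m + 1)) := by
  have hT : ∀ w ∈ G r p (m + 1), ∀ g ∈ N, act w g ∈ N := fun w hw g hg => by
    have := hN (T _ _ _ ⟨w, hw⟩) g hg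
    rwa [rho_T] at this
  have hspan : N = Submodule.span ℂ (f '' {μ | f μ ∈ N}) := by
    refine eq_span_of_stable (fun μ => (hf μ).1) hs.wtK_injective (hf.span_eq_top hs) ?_
    rintro (i | a) g hg
    · have := hN (zi r p (m + 1) c0 c i) g hg
      rwa [rho_zi] at this
    · exact hT _ a.2 g hg
  have hsmul : ∀ {a : ℂ} {g : Pol (m + 1)}, a ≠ 0 → a • g ∈ N → g ∈ N := fun {a g} ha h => by
    have := N.smul_mem a⁻¹ h
    rwa [smul_smul, inv_mul_cancel₀ ha, one_smul] at this
  -- The span of the eigenvectors inside `N` is controlled by the set of their exponents, and the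
  -- nonzero coefficients of swapping, raising and lowering are its closure properties.
  have hdich : (∀ μ, f μ ∉ N) ∨ (∀ μ, f μ ∈ N) ∨ ∀ μ, f μ ∈ N ↔ ∃ i, k ≤ μ i := by
    refine exponent_dichotomy (P := fun μ => f μ ∈ N) (fun μ i j hij hμ h => ?_)
      (fun μ h => ?_) (fun μ h0 h => ?_)
    · obtain ⟨a, b, hb, e⟩ := hf.swap hs hij hμ
      have h1 := hT _ (sw_mem r p i j) _ h
      rw [e] at h1
      exact hsmul hb ((N.add_mem_iff_right (N.smul_mem a h)).1 h1)
    · obtain ⟨a, ha, e⟩ := hf.raise hs μ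
      have h1 := hN (xi r p (m + 1) c0 c (Fin.last m)) _ (hT _ (pm_mem r p (cyc m)) _ h)
      rw [rho_xi] at h1
      change Cherednik.raise (f μ) ∈ N at h1
      rw [e] at h1
      exact hsmul ha h1
    · obtain ⟨a, ha, e⟩ := hf.lowerOp_rot hs μ
      have h1 := hT _ (inv_mem (pm_mem r p (cyc m))) _
        (hN (yi r p (m + 1) c0 c (Fin.last m)) _ h)
      rw [rho_yi] at h1
      change lowerOp r c0 c (f (rot μ)) ∈ N at h1
      rw [e] at h1
      exact hsmul (fun h2 => h0 (ha.1 h2)) h1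
  rcases hdich with h | h | h
  · refine Or.inl ?_
    rw [hspan]
    simp [h]
  · refine Or.inr (Or.inl ?_)
    rw [hspan, ← hf.span_eq_top hs]
    simp [h]
  · refine Or.inr (Or.inr ?_)
    conv_lhs => rw [hspan]
    simp only [h]
    rfl

lemma IsJackFamily.span_ne_bot (hf : IsJackFamily r p c0 c f) :
    Submodule.span ℂ (f '' bigExp k (m + 1)) ≠ ⊥ := fun h => by
  have : f (fun _ => k) ∈ Submodule.span ℂ (f '' bigExp k (m + 1)) :=
    Submodule.subset_span ⟨_, ⟨0, le_rfl⟩, rfl⟩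
  rw [h, Submodule.mem_bot] at this
  exact hf.ne_zero _ this

lemma IsJackFamily.span_ne_top (hs : Special r p (m + 1) c0 c k) (hf : IsJackFamily r p c0 c f) :
    Submodule.span ℂ (f '' bigExp k (m + 1)) ≠ ⊤ := fun h => by
  have h1 : f 0 ∈ Submodule.span ℂ (f '' bigExp k (m + 1)) := h ▸ Submodule.mem_top
  obtain ⟨i, hi⟩ := mem_of_mem_span (fun μ => (hf μ).1) hs.wtK_injective hf.ne_zero h1
  have := hs.pos
  simp at hi
  omega

end Stable

/-! ### Jack polynomials -/

section Jack

variable {r p m k : ℕ} {c0 : ℂ} {c : ℕ → ℂ}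

lemma exists_isGen_of_mem (hr : 1 < r) (hp : p ∣ r) (hc : ∀ l : ℕ, ¬ p ∣ l → c l = 0) {n : ℕ}
    {κ : Idx r p n} (hκ : IsGen r p n κ) :
    ∃ a ∈ tAlg r p n c0 c hp, rho hr hp c0 hc a = opK r p n c0 c κ := by
  rcases κ with i | ⟨a, ha⟩
  · exact ⟨_, Algebra.subset_adjoin (Or.inl (Or.inl ⟨i, rfl⟩)), rho_zi hr hp c0 hc i⟩
  · rcases hκ with ⟨i, j, hij, h⟩ | ⟨i, h⟩
    · refine ⟨_, Algebra.subset_adjoin (Or.inl (Or.inr ⟨i, j, hij, rfl⟩)),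
        LinearMap.ext fun f => ?_⟩
      rw [rho_T]
      change act (zt r i * (zt r j)⁻¹) f = act (dg a) f
      rw [zt_mul_inv_eq_dg, show a = _ from h]
    · refine ⟨_, Algebra.subset_adjoin (Or.inr ⟨i, rfl⟩), LinearMap.ext fun f => ?_⟩
      rw [rho_T]
      change act (zt r i ^ p) f = act (dg a) f
      rw [zt_pow_eq_dg, show a = _ from h]

lemma IsEigen.exists_of_mem_tAlg (hr : 1 < r) (hp : p ∣ r) (hc : ∀ l : ℕ, ¬ p ∣ l → c l = 0)
    {n : ℕ} {l : Idx r p n → ℂ} {f : Pol n} (hf : IsEigen (opK r p n c0 c) l f)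
    {a : HH r p n c0 c} (ha : a ∈ tAlg r p n c0 c hp) :
    ∃ e : ℂ, rho hr hp c0 hc a f = e • f := by
  induction ha using Algebra.adjoin_induction with
  | mem x hx =>
    rcases hx with (⟨i, rfl⟩ | ⟨i, j, -, rfl⟩) | ⟨i, rfl⟩
    · exact ⟨_, by rw [rho_zi]; exact hf.zOp i⟩
    · exact ⟨_, by
        rw [rho_T]
        simp only [zt_mul_inv_eq_dg]
        exact hf.act_dg (zt_mul_inv_eq_dg r i j ▸ quot_mem r p i j)⟩
    · exact ⟨_, by
        rw [rho_T]
        simp only [zt_pow_eq_dg]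
        exact hf.act_dg (zt_pow_eq_dg r i p ▸ ztp_mem hp i)⟩
  | algebraMap a => exact ⟨a, by rw [AlgHom.commutes, Module.algebraMap_end_apply]⟩
  | add a b _ _ ha hb =>
    obtain ⟨x, hx⟩ := ha
    obtain ⟨y, hy⟩ := hb
    exact ⟨x + y, by rw [map_add, LinearMap.add_apply, hx, hy, add_smul]⟩
  | mul a b _ _ ha hb =>
    obtain ⟨x, hx⟩ := ha
    obtain ⟨y, hy⟩ := hb
    exact ⟨y * x, by rw [map_mul, Module.End.mul_apply, hy, map_smul, hx, smul_smul]⟩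

lemma equivMM_sub_mon_mem_iff (hr : 1 < r) (hp : p ∣ r) (hc : ∀ l : ℕ, ¬ p ∣ l → c l = 0) {n : ℕ}
    (μ : Fin n → ℕ) (g : Pol n) :
    equivMM hr hp c0 hc g - mon r p n c0 c μ ∈
        Submodule.span ℂ (mon r p n c0 c '' {ν | ExpLT ν μ}) ↔
      g - monoBasis n μ ∈ Submodule.span ℂ (monoBasis n '' {ν | ExpLT ν μ}) := by
  have h1 : Submodule.span ℂ (mon r p n c0 c '' {ν | ExpLT ν μ}) =
      (Submodule.span ℂ (monoBasis n '' {ν | ExpLT ν μ})).map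
        (equivMM hr hp c0 hc).toLinearMap := by
    rw [Submodule.map_span, Set.image_image]
    congr 1
    exact Set.image_congr fun ν _ => by
      rw [monoBasis_apply, LinearEquiv.coe_coe, equivMM_mono]
  rw [h1, ← equivMM_mono hr hp c0 hc, ← map_sub, monoBasis_apply]
  exact (equivMM hr hp c0 hc).injective.mem_set_image

/-- The definition provides eigenvalues only for `𝔱`, so the triangularity argument runs over its
generators alone: the leading term forces each eigenvalue, and these already determine the line.
Conversely the family diagonalizes every element of `𝔱`. -/
lemma IsJackFamily.isJack_iff {n : ℕ} (hs : Special r p n c0 c k) {f : (Fin n → ℕ) → Pol n}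
    (hf : IsJackFamily r p c0 c f) (μ : Fin n → ℕ) (g : MM r p n c0 c) :
    IsJack r p n c0 c hs.dvd μ g ↔ g = equivMM hs.one_lt hs.dvd c0 hs.supp (f μ) := by
  have ht := isTriangular_opK r p n c0 c
  set Φ := equivMM (n := n) hs.one_lt hs.dvd c0 hs.supp with hΦ
  constructor
  · obtain ⟨g, rfl⟩ := Φ.surjective g
    rintro ⟨-, h2, h3⟩
    rw [hΦ, equivMM_sub_mon_mem_iff] at h3
    let op' : {κ // IsGen r p n κ} → Pol n →ₗ[ℂ] Pol n := fun κ => opK r p n c0 c κ.1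
    let wt' : {κ // IsGen r p n κ} → (Fin n → ℕ) → ℂ := fun κ => wtK r p n c0 c κ.1
    have ht' : IsTriangular (monoBasis n) ExpLT op' wt' := fun κ => ht κ.1
    have hg : IsEigen op' (fun κ => wt' κ μ) g := fun κ => by
      obtain ⟨a, ha, hκ⟩ := exists_isGen_of_mem (c0 := c0) hs.one_lt hs.dvd hs.supp κ.2
      obtain ⟨e, he⟩ := h2 a ha
      rw [hΦ, smul_equivMM, ← map_smul] at he
      have he' : op' κ g = e • g := by
        rw [← (equivMM hs.one_lt hs.dvd c0 hs.supp).injective he, hκ]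
      rw [he', ht'.weight_of_sub_mem (fun _ _ _ => ExpLT.trans) ExpLT.irrefl h3 he']
    have h := ht'.eq_smul (fun _ _ _ => ExpLT.trans) ExpLT.irrefl (fun ν hν =>
      hs.toGeneric.wtK_injective hs.one_lt hs.dvd hs.supp fun κ hκ => hν ⟨κ, hκ⟩)
      (fun κ => (hf μ).1 κ.1) hg (hf μ).2
    rw [((sub_mem_lower_iff ExpLT.irrefl).1 h3).1, one_smul] at h
    rw [h]
  · rintro rfl
    refine ⟨fun h => hf.ne_zero μ (Φ.map_eq_zero_iff.1 h), fun a ha => ?_, ?_⟩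
    · obtain ⟨e, he⟩ := (hf μ).1.exists_of_mem_tAlg hs.one_lt hs.dvd hs.supp ha
      exact ⟨e, by rw [hΦ, smul_equivMM, he, map_smul]⟩
    · rw [hΦ, equivMM_sub_mon_mem_iff]
      exact ht.sub_mem_lower (fun _ _ _ => ExpLT.trans) ExpLT.irrefl
        (fun ν hν => hs.wtK_injective _ _ hν) (hf μ).1 (hf μ).2

/-- The submodule of the polynomial representation given by a stable space of polynomials. -/
def submoduleOfStable (hr : 1 < r) (hp : p ∣ r) (hc : ∀ l : ℕ, ¬ p ∣ l → c l = 0) {n : ℕ}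
    (N : Submodule ℂ (Pol n)) (hN : ∀ a, ∀ g ∈ N, rho hr hp c0 hc a g ∈ N) :
    Submodule (HH r p n c0 c) (MM r p n c0 c) where
  carrier := {x | (equivMM hr hp c0 hc).symm x ∈ N}
  zero_mem' := by simp
  add_mem' := fun {x y} hx hy => by
    simp only [Set.mem_ofPred_eq, map_add] at *
    exact N.add_mem hx hy
  smul_mem' := fun a x hx => by
    obtain ⟨g, rfl⟩ := (equivMM hr hp c0 hc).surjective x
    simp only [Set.mem_ofPred_eq, LinearEquiv.symm_apply_apply, smul_equivMM] at *
    exact hN a g hx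

end Jack
end Cherednik
end

/-! ### Transfer of the classification to the standard module -/

theorem mainTheorem4 (r p n : ℕ) (hr : 1 < r) (hp : p ∣ r) (hn : 1 ≤ n)
    (c0 : ℂ) (c : ℕ → ℂ) (hc : ∀ l : ℕ, ¬ p ∣ l → c l = 0)
    (k : ℕ) (hk : 0 < k) (hkr : ¬ r ∣ k)
    (hH : Cherednik.OnH r n c0 c k 1)
    (hother : ∀ j l : ℕ, 0 < j → ¬ r ∣ j → 1 ≤ l → l ≤ n → (j, l) ≠ (k, 1) →
      ¬ Cherednik.OnH r n c0 c j l)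
    (hx : ∀ q m : ℕ, 1 ≤ q → q ≤ n → 1 ≤ m → c0 ≠ (m : ℂ) / (q : ℂ)) :
    ∃ f : (Fin n → ℕ) → Cherednik.MM r p n c0 c,
      (∀ (μ : Fin n → ℕ) (g : Cherednik.MM r p n c0 c),
        Cherednik.IsJack r p n c0 c hp μ g ↔ g = f μ) ∧
      ∃ N : Submodule (Cherednik.HH r p n c0 c) (Cherednik.MM r p n c0 c),
        (N.restrictScalars ℂ : Submodule ℂ (Cherednik.MM r p n c0 c)) =
            Submodule.span ℂ (f '' {μ | ∃ i, k ≤ μ i}) ∧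
          ∀ N' : Submodule (Cherednik.HH r p n c0 c) (Cherednik.MM r p n c0 c),
            (N' ≠ ⊥ ∧ N' ≠ ⊤) ↔ N' = N := by
  obtain ⟨m, rfl⟩ : ∃ m, n = m + 1 := ⟨n - 1, by omega⟩
  have hs : Cherednik.Special r p (m + 1) c0 c k :=
    { onH := hH, not_onH := hother, c0_ne := hx, one_lt := hr, dvd := hp, supp := hc, pos := hk }
  obtain ⟨f, hf⟩ := hs.exists_isJackFamily
  set Φ := Cherednik.equivMM (n := m + 1) hr hp c0 hc with hΦ
  set S := Submodule.span ℂ (f '' Cherednik.bigExp k (m + 1)) with hS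
  set N := Cherednik.submoduleOfStable hr hp hc S (hf.rho_mem_span hs) with hN
  have hmem : ∀ g, Φ g ∈ N ↔ g ∈ S := fun g => by
    change Φ.symm (Φ g) ∈ S ↔ _
    rw [Φ.symm_apply_apply]
  refine ⟨fun μ => Φ (f μ), fun μ g => hf.isJack_iff hs μ g, N, ?_, fun N' => ?_⟩
  · have h : Submodule.span ℂ ((fun μ => Φ (f μ)) '' {μ | ∃ i, k ≤ μ i}) =
        S.map Φ.toLinearMap := by
      rw [hS, Submodule.map_span, Set.image_image]
      rfl
    rw [h]
    ext x
    obtain ⟨g, rfl⟩ := Φ.surjective x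
    rw [Submodule.restrictScalars_mem, hmem]
    exact Φ.injective.mem_set_image.symm
  · constructor
    · rintro ⟨h1, h2⟩
      -- The preimage of `N'` in the polynomial ring is stable under the algebra, so it is one of
      -- the three classified subspaces; the first two are ruled out by properness.
      let M : Submodule ℂ (Cherednik.Pol (m + 1)) :=
        (N'.restrictScalars ℂ).comap Φ.toLinearMap
      have hM : ∀ g, g ∈ M ↔ Φ g ∈ N' := fun g => Iff.rfl
      rcases hf.eq_bot_or_top_or_span hs (N := M) (fun a g hg => by
        rw [hM] at hg ⊢
        rw [hΦ, ← Cherednik.smul_equivMM]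
        exact N'.smul_mem a hg) with h | h | h
      · refine absurd (eq_bot_iff.2 fun x hx => ?_) h1
        obtain ⟨g, rfl⟩ := Φ.surjective x
        rw [← hM, h, Submodule.mem_bot] at hx
        rw [hx, map_zero]
        exact zero_mem _
      · refine absurd (eq_top_iff.2 fun x _ => ?_) h2
        obtain ⟨g, rfl⟩ := Φ.surjective x
        rw [← hM, h]
        trivial
      · ext x
        obtain ⟨g, rfl⟩ := Φ.surjective x
        rw [hmem, ← hM, h]
    · rintro rfl
      constructor
      · refine fun h => hf.span_ne_bot (k := k) (eq_bot_iff.2 fun g hg => ?_)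
        have := (hmem g).2 hg
        rw [h, Submodule.mem_bot] at this
        exact Φ.map_eq_zero_iff.1 this
      · refine fun h => hf.span_ne_top hs (eq_top_iff.2 fun g _ => (hmem g).1 ?_)
        rw [h]
        trivial
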